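/- Model. Macro base stations (tier 1) and helpers (tier 2) form independent homogeneous Poisson point processes in $\mathbb R^2$ with intensities $\lambda_1,\lambda_2>0$ and transmit powers $P_1,P_2>0$; users have intensity $\lambda_u>0$ and the tagged user is at the origin. A station of tier $i$ at distance $z$ is received with power $P_i h z^{-\alpha}$, $2<\alpha\le 4$, with i.i.d. fading $h\sim\exp(1)$; the noise power is $\sigma^2\ge 0$, the bandwidth is $W>0$, the rate demand is $R_0>0$. There are $N$ contents with Zipf popularities $q_n=n^{-\gamma}/\sum_{k=1}^N k^{-\gamma}$, $\gamma\ge 0$; the second group is $\{N_{Mp}+1,\dots,N\}$, of size $N_{Lp}=N-N_{Mp}\geq 1$, and $Q_{Lp}=\sum_{n>N_{Mp}}q_n$. Each helper independently stores $N_2$ random contents of the second group ($1\le N_2\le N_{Lp}$), each content with the same probability $p_{Lp}=N_2/N_{Lp}$. A user requesting a content $n$ of the second group is associated with the station of largest mean received power $P_iz^{-\alpha}$ among all macro base stations and all helpers caching $n$. Let $A_2$ be the probability that a user, whose request follows the popularity law, is associated with a helper: $A_2=\sum_{n>N_{Mp}}q_n\Pr(\text{a user requesting }n\text{ is associated with a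 helper})$. Each helper is independently active (interfering) with probability $$p_a=1-\Bigl(1+\frac{A_2\lambda_u}{3.5\lambda_2}\Bigr)^{-3.5},$$ and the load $L_2$ of the serving helper is independent of everything else with $$P_{L_2}(l+1)=\Pr(L_2=l+1)=\frac{3.5^{3.5}}{l!}\,\frac{\Gamma(l+4.5)}{\Gamma(3.5)}\Bigl(\frac{A_2\lambda_u}{\lambda_2}\Bigr)^{l}\Bigl(3.5+\frac{A_2\lambda_u}{\lambda_2}\Bigr)^{-(l+4.5)},\quad l\ge 0 .$$ The positions, fading gains, cached sets, activity marks and the load are mutually independent. For a user served by a helper at distance $z$, $\mathrm{SINR}=P_2hz^{-\alpha}/(I+\sigma^2)$, where $I$ is the total power received from all macro base stations and from all active helpers other than the serving one, caching the requested content or not; the access delivery rate is $\frac{W}{L_2}\log_2(1+\mathrm{SINR})$. For a fixed requested content of the second group, let $C_{Lp,2}$ be the probability that the tagged user is associated with a helper and that its access delivery rate is at least $R_0$. Lemma 3. For every content of the second group, $$C_{Lp,2}=\int_0^\infty\sum_{l_2=0}^\infty 2\pi p_{Lp}\lambda_2 z\,\exp\bigl(-z^\alpha P_2^{-1}\delta_2\sigma^2\bigr)\exp\Bigl(-\pi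 p_{Lp}\lambda_2z^2\bigl(\xi_2G(\delta_2,\alpha)+\varsigma_2H(\delta_2,\alpha)+\zeta_2\bigr)\Bigr)P_{L_2}(l_2+1)\,dz,$$ where $\delta_2=2^{(l_2+1)R_0/W}-1$ and, with $\lambda_1'=\lambda_1$ and $\lambda_2'=p_{Lp}\lambda_2$, $$\xi_k=\frac{\lambda_1P_1^{2/\alpha}+p_ap_{Lp}\lambda_2P_2^{2/\alpha}}{\lambda_k'P_k^{2/\alpha}},\quad \varsigma_k=\frac{p_a(1-p_{Lp})\lambda_2P_2^{2/\alpha}}{\lambda_k'P_k^{2/\alpha}},\quad \zeta_k=\frac{\lambda_1P_1^{2/\alpha}+p_{Lp}\lambda_2P_2^{2/\alpha}}{\lambda_k'P_k^{2/\alpha}},$$ $$G(x,y)=\frac{2x}{y-2}\,{}_2F_1\Bigl(1,1-\frac2y;2-\frac2y;-x\Bigr),\qquad H(x,y)=\frac2y\,x^{2/y}B\Bigl(\frac2y,1-\frac2y\Bigr).$$ In $p_a$ and $P_{L_2}$, the quantity $A_2$ is given explicitly by $A_2=Q_{Lp}\,\dfrac{\lambda_2'P_2^{2/\alpha}}{\lambda_1'P_1^{2/\alpha}+\lambda_2'P_2^{2/\alpha}}$.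 -/

import Mathlib

open MeasureTheory ProbabilityTheory Set
open scoped ENNReal

noncomputable section

namespace CacheHetNet

/-! ## Special functions -/

/-- The Gauss hypergeometric function `₂F₁(a, b; c; x)` for `0 < b < c` and real `x < 1`, through
Euler's integral. (Mathlib's `ordinaryHypergeometric` is the sum of the power series and is
meaningless for `|x| > 1`, while arguments `x < -1` are needed here; Euler's integral is the
analytic continuation of that sum.) -/
def gaussF (a b c x : ℝ) : ℝ :=
  (beta b (c - b))⁻¹ *
    ∫ t in (0 : ℝ)..1, t ^ (b - 1) * (1 - t) ^ (c - b - 1) * (1 - x * t) ^ (-a)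

/-- `G(x, y) = 2 x / (y - 2) · ₂F₁(1, 1 - 2/y; 2 - 2/y; -x)`. -/
def G (x y : ℝ) : ℝ :=
  2 * x / (y - 2) * gaussF 1 (1 - 2 / y) (2 - 2 / y) (-x)

/-- `H(x, y) = (2/y) x^(2/y) B(2/y, 1 - 2/y)`. -/
def H (x y : ℝ) : ℝ :=
  2 / y * x ^ (2 / y) * beta (2 / y) (1 - 2 / y)

/-! ## Poisson point processes in the plane -/

/-- The Euclidean plane; the tagged user is at the origin. -/
abbrev Plane : Type := EuclideanSpace ℝ (Fin 2)

/-- The number of points of the point process `X` in the set `B`, counted with multiplicity. -/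
def pointCount {Ω : Type*} (X : ℕ → Ω → Plane) (B : Set Plane) (ω : Ω) : ℕ∞ :=
  {j : ℕ | X j ω ∈ B}.encard

/-- `X` enumerates a homogeneous Poisson point process of intensity `lam`: the number of points in
a Borel set of finite area is Poisson distributed with mean `lam` times the area, and the numbers
of points in pairwise disjoint such sets are independent. -/
structure IsPoissonProcess {Ω : Type*} [MeasurableSpace Ω] (μ : Measure Ω) (lam : ℝ)
    (X : ℕ → Ω → Plane) : Prop where
  measurable : ∀ j, Measurable (X j)
  law : ∀ B : Set Plane, MeasurableSet B → volume B < ∞ → ∀ k : ℕ,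
    μ {ω | pointCount X B ω = k} =
      ENNReal.ofReal (Real.exp (-(lam * (volume B).toReal)) *
        (lam * (volume B).toReal) ^ k / (k.factorial : ℝ))
  indep : ∀ (m : ℕ) (B : Fin m → Set Plane),
    (∀ i, MeasurableSet (B i)) → (∀ i, volume (B i) < ∞) → Pairwise (Function.onFun Disjoint B) →
    iIndepFun (fun i => pointCount X (B i)) μ

/-! ## Parameters of the network -/

/-- The two tiers of base stations. -/
inductive Tier
  | mbs
  | helper

/-- The numerical parameters of the network with their standing constraints. -/
structure Params where
  /-- intensity of the macro base stations -/
  lam1 : ℝ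
  /-- intensity of the helpers -/
  lam2 : ℝ
  /-- intensity of the users -/
  lamU : ℝ
  /-- transmit power of the macro base stations -/
  P1 : ℝ
  /-- transmit power of the helpers -/
  P2 : ℝ
  /-- path loss exponent -/
  α : ℝ
  /-- noise power `σ²` -/
  noise : ℝ
  /-- system bandwidth -/
  W : ℝ
  /-- rate demand -/
  R0 : ℝ
  /-- shape parameter of the Zipf popularity law -/
  γ : ℝ
  /-- number of contents in the library; the contents are `1, …, N` -/
  N : ℕ
  /-- number of contents in the first group; the first group is `1, …, NMp` -/
  NMp : ℕ
  /-- number of contents that each helper stores -/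
  N2 : ℕ
  lam1_pos : 0 < lam1
  lam2_pos : 0 < lam2
  lamU_pos : 0 < lamU
  P1_pos : 0 < P1
  P2_pos : 0 < P2
  two_lt_α : 2 < α
  α_le_four : α ≤ 4
  noise_nonneg : 0 ≤ noise
  W_pos : 0 < W
  R0_pos : 0 < R0
  γ_nonneg : 0 ≤ γ
  NMp_lt : NMp < N
  N2_pos : 0 < N2
  N2_le : N2 ≤ N - NMp

namespace Params

variable (p : Params)

/-- The second content group `NMp + 1, …, N`. -/
def groupLp : Finset ℕ := Finset.Ioc p.NMp p.N

/-- Popularity `q_n` of the content of rank `n` (Zipf law). -/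
def popularity (n : ℕ) : ℝ :=
  (n : ℝ) ^ (-p.γ) / ∑ k ∈ Finset.Icc 1 p.N, (k : ℝ) ^ (-p.γ)

/-- Probability `Q_Lp` that the requested content belongs to the second group. -/
def QLp : ℝ := ∑ n ∈ p.groupLp, p.popularity n

/-- Caching probability `p_Lp = N₂ / N_Lp` of the contents of the second group. -/
def pLp : ℝ := (p.N2 : ℝ) / (p.groupLp.card : ℝ)

/-- Transmit power `P_k`. -/
def power : Tier → ℝ
  | .mbs => p.P1
  | .helper => p.P2

/-- Equivalent density `λ'_k` in the content-centric network. -/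
def effDensity : Tier → ℝ
  | .mbs => p.lam1
  | .helper => p.pLp * p.lam2

/-- `λ'_k P_k^(2/α)`. -/
def weight (k : Tier) : ℝ := p.effDensity k * p.power k ^ (2 / p.α)

/-- `A_{Lp,k} = λ'_k P_k^(2/α) / ∑ᵢ λ'_i P_i^(2/α)`. -/
def assocLp (k : Tier) : ℝ := p.weight k / (p.weight .mbs + p.weight .helper)

/-- Probability that a helper is active, when `A2` is the probability that a user is associated
with the helper tier: `1 - (1 + A₂ λ_u / (3.5 λ₂))^(-3.5)`. -/
def activeProb (A2 : ℝ) : ℝ :=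
  1 - (1 + A2 * p.lamU / (3.5 * p.lam2)) ^ (-3.5 : ℝ)

/-- Probability that the load of the serving helper is `l + 1`, when `A2` is the probability that
a user is associated with the helper tier. -/
def loadProb (A2 : ℝ) (l : ℕ) : ℝ :=
  (3.5 : ℝ) ^ (3.5 : ℝ) / (l.factorial : ℝ) * (Real.Gamma (l + 4.5) / Real.Gamma 3.5) *
    (A2 * p.lamU / p.lam2) ^ l * (3.5 + A2 * p.lamU / p.lam2) ^ (-((l : ℝ) + 4.5))

/-- Closed form `A₂ = Q_Lp A_{Lp,2}`. -/
def A2 : ℝ := p.QLp * p.assocLp .helper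

/-- The active probability `p_a` at the closed form of `A₂`. -/
def pa : ℝ := p.activeProb p.A2

/-- SINR threshold `2^((l+1) R₀ / W) - 1` at load `l + 1`. -/
def threshold (l : ℕ) : ℝ := (2 : ℝ) ^ (((l : ℝ) + 1) * p.R0 / p.W) - 1

/-- The coefficient `ξ_k`, as a function of the active probability `pa`. -/
def xi (pa : ℝ) (k : Tier) : ℝ :=
  (p.lam1 * p.P1 ^ (2 / p.α) + pa * p.pLp * p.lam2 * p.P2 ^ (2 / p.α)) / p.weight k

/-- The coefficient `ς_k`, as a function of the active probability `pa`. -/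
def varsigma (pa : ℝ) (k : Tier) : ℝ :=
  (pa * (1 - p.pLp) * p.lam2 * p.P2 ^ (2 / p.α)) / p.weight k

/-- The coefficient `ζ_k`. -/
def zeta (k : Tier) : ℝ :=
  (p.lam1 * p.P1 ^ (2 / p.α) + p.pLp * p.lam2 * p.P2 ^ (2 / p.α)) / p.weight k

end Params

/-! ## The random network -/

/-- The independent sources of randomness. -/
inductive Source
  | mbsPos
  | helperPos
  | mbsFading (j : ℕ)
  | helperFading (j : ℕ)
  | cache (j : ℕ)
  | active (j : ℕ)
  | load

/-- The random elements of the network seen by the tagged user. -/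
structure Network (Ω : Type*) where
  /-- positions of the macro base stations -/
  mbsPos : ℕ → Ω → Plane
  /-- positions of the helpers -/
  helperPos : ℕ → Ω → Plane
  /-- fading gains of the macro base stations -/
  mbsFading : ℕ → Ω → ℝ
  /-- fading gains of the helpers -/
  helperFading : ℕ → Ω → ℝ
  /-- contents cached by the helpers -/
  cache : ℕ → Ω → Finset ℕ
  /-- whether a helper is transmitting to other users -/
  active : ℕ → Ω → Bool
  /-- load of the helper that serves the tagged user, the tagged user included -/
  load : Ω → ℕ

namespace Network

variable {Ω : Type*} (S : Network Ω) (p : Params)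

/-- Sigma-algebra generated by one of the sources of randomness. -/
@[reducible] def sigma : Source → MeasurableSpace Ω
  | .mbsPos => ⨆ j, MeasurableSpace.comap (S.mbsPos j) inferInstance
  | .helperPos => ⨆ j, MeasurableSpace.comap (S.helperPos j) inferInstance
  | .mbsFading j => MeasurableSpace.comap (S.mbsFading j) inferInstance
  | .helperFading j => MeasurableSpace.comap (S.helperFading j) inferInstance
  | .cache j => MeasurableSpace.comap (S.cache j) ⊤
  | .active j => MeasurableSpace.comap (S.active j) ⊤
  | .load => MeasurableSpace.comap S.load ⊤

/-- Mean power `P₁ z^(-α)` received from macro base station `j`. -/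
def mbsMean (j : ℕ) (ω : Ω) : ℝ := p.P1 * ‖S.mbsPos j ω‖ ^ (-p.α)

/-- Mean power `P₂ z^(-α)` received from helper `j`. -/
def helperMean (j : ℕ) (ω : Ω) : ℝ := p.P2 * ‖S.helperPos j ω‖ ^ (-p.α)

/-- A user requesting content `n` of the second group is associated with helper `j`: the helper
caches `n` and offers the largest mean received power among all macro base stations and all the
helpers that cache `n`. -/
def ServedBy (n j : ℕ) (ω : Ω) : Prop :=
  n ∈ S.cache j ω ∧
    (∀ i, S.mbsMean p i ω ≤ S.helperMean p j ω) ∧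
    ∀ k, n ∈ S.cache k ω → S.helperMean p k ω ≤ S.helperMean p j ω

/-- Interference from all macro base stations. -/
def mbsInterference (ω : Ω) : ℝ≥0∞ :=
  ∑' i, ENNReal.ofReal (S.mbsFading i ω * S.mbsMean p i ω)

/-- Interference from the active helpers that cache `n`, the serving helper `j` excepted. -/
def cachingInterference (n j : ℕ) (ω : Ω) : ℝ≥0∞ :=
  ∑' k, if k ≠ j ∧ n ∈ S.cache k ω ∧ S.active k ω = true then
    ENNReal.ofReal (S.helperFading k ω * S.helperMean p k ω) else 0

/-- Interference from the active helpers that do not cache `n`. -/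
def nonCachingInterference (n : ℕ) (ω : Ω) : ℝ≥0∞ :=
  ∑' k, if n ∉ S.cache k ω ∧ S.active k ω = true then
    ENNReal.ofReal (S.helperFading k ω * S.helperMean p k ω) else 0

/-- SINR of the tagged user when it requests `n` and is served by helper `j`. -/
def sinr (n j : ℕ) (ω : Ω) : ℝ :=
  (ENNReal.ofReal (S.helperFading j ω * S.helperMean p j ω) /
    (S.mbsInterference p ω + S.cachingInterference p n j ω + S.nonCachingInterference p n ω +
      ENNReal.ofReal p.noise)).toReal

/-- Access delivery rate `(W / L) log₂ (1 + SINR)` from helper `j`. -/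
def rate (n j : ℕ) (ω : Ω) : ℝ :=
  p.W / (S.load ω : ℝ) * Real.logb 2 (1 + S.sinr p n j ω)

/-- The event that the tagged user requesting `n` is associated with the helper tier. -/
def helperAssoc (n : ℕ) : Set Ω := {ω | ∃ j, S.ServedBy p n j ω}

/-- The event that the tagged user requesting `n` is associated with a helper and its access
delivery rate meets the rate demand. -/
def accessSuccess (n : ℕ) : Set Ω := {ω | ∃ j, S.ServedBy p n j ω ∧ p.R0 ≤ S.rate p n j ω}

/-- Probability `A₂` that a user is associated with the helper tier (the requested content being
drawn from the popularity law). -/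
def helperTierProb [MeasurableSpace Ω] (μ : Measure Ω) : ℝ :=
  ∑ n ∈ p.groupLp, p.popularity n * μ.real (S.helperAssoc p n)

/-- The probabilistic model of the network: independent Poisson processes of base stations, i.i.d.
unit-mean exponential fading, independent random caches of `N₂` contents of the second group with
equal caching probabilities, independently active helpers, and an independent load. -/
structure IsModel [m0 : MeasurableSpace Ω] (μ : Measure Ω) : Prop where
  sigma_le : ∀ s, S.sigma s ≤ m0
  indep : iIndep S.sigma μ
  mbs_poisson : IsPoissonProcess μ p.lam1 S.mbsPos
  helper_poisson : IsPoissonProcess μ p.lam2 S.helperPos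
  mbsFading_law : ∀ j, μ.map (S.mbsFading j) = expMeasure 1
  helperFading_law : ∀ j, μ.map (S.helperFading j) = expMeasure 1
  cache_mem : ∀ j, ∀ᵐ ω ∂μ, S.cache j ω ∈ p.groupLp.powersetCard p.N2
  cache_prob : ∀ j, ∀ n ∈ p.groupLp, μ {ω | n ∈ S.cache j ω} = ENNReal.ofReal p.pLp
  active_prob : ∀ j, μ {ω | S.active j ω = true} =
    ENNReal.ofReal (p.activeProb (S.helperTierProb p μ))
  load_prob : ∀ l : ℕ, μ {ω | S.load ω = l + 1} =
    ENNReal.ofReal (p.loadProb (S.helperTierProb p μ) l)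

end Network

end CacheHetNet

end

set_option linter.unusedSectionVars false

noncomputable section

namespace CacheHetNet

open Filter Topology

/-! ## The function `exp (-x)` on the extended nonnegative reals -/

/-! Up to a null set, success is the disjoint union, over loads `l + 1` and helpers `j`, of the
events that the load is `l + 1`, that `j` serves the user and that the SINR reaches the threshold
`δ` of that load (`accessSuccess_ae_eq`). Disjointness holds because almost surely no two helpers
are equidistant from the origin. The load is independent of the rest, so the task is to sum over `j`
the probability that `j` serves and the SINR is at least `δ`.

Fix the positions and average over the marks (`IsMarking.measure_success`). The gain of the serving
helper is exponential, so its tail at the normalized noise plus interference is the exponential of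
minus that quantity, which factors over the stations. What remains is `p_Lp` times a noise factor, a
product of `macroKernel` over the macro stations and a product of `helperKernel` over the other
helpers. The helpers are never split into a caching and a non-caching process: `helperKernel`
averages over the cache and activity marks of one point, and a helper nearer than the serving one is
allowed only if it does not cache the content.

Averaging over the macro positions is the probability generating functional (`lintegral_iprod_eq`);
summing over the serving helper is the Mecke formula (`lintegral_tsum_iprod_norm`). The exponents
are plane integrals of one minus the kernels: interferers outside the exclusion discs give `G`,
non-caching helpers in the whole plane give `H`, and the void discs give `ζ`. Polar coordinates turn
the Mecke integral into the integral over `z`.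

A Poisson process is given here only through its counts. Independent Poisson counts yield the
generating functional for step functions, hence for all `f ≤ 1` by monotone limits. Replacing `f` by
`f (1 - t b)` and differentiating at `t = 0` yields the Mecke formula for a product not depending on
the marked point; dependence through a countable function, then through the norm by dyadic
approximation, follows.

The activity and load laws refer to the true association probability, which has to be identified
with `A2`. At `δ = 0` the SINR condition is void and the same computation, valid for every activity
probability in `[0, 1]`, gives a value free of that probability (`lintegral_successDensity_zero`).
This yields `helperTierProb_eq` without circularity.

Working in `[0, ∞]` with `negExp` and `iprod` removes convergence questions: a divergent
interference contributes the factor 0. -/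

/-- `exp (-x)` for `x ∈ [0, ∞]`. -/
def negExp (x : ℝ≥0∞) : ℝ≥0∞ := (EReal.exp x)⁻¹

@[simp] lemma negExp_zero : negExp 0 = 1 := by simp [negExp]

@[simp] lemma negExp_top : negExp ∞ = 0 := by simp [negExp]

lemma negExp_ofReal {x : ℝ} (hx : 0 ≤ x) :
    negExp (ENNReal.ofReal x) = ENNReal.ofReal (Real.exp (-x)) := by
  rw [negExp, EReal.coe_ennreal_ofReal, max_eq_left hx, EReal.exp_coe, Real.exp_neg,
    ENNReal.ofReal_inv_of_pos (Real.exp_pos x)]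

lemma negExp_antitone : Antitone negExp := fun a b h => by
  simpa [negExp] using h

lemma negExp_le_one (x : ℝ≥0∞) : negExp x ≤ 1 := by
  simpa using negExp_antitone (zero_le : 0 ≤ x)

lemma negExp_add (a b : ℝ≥0∞) : negExp (a + b) = negExp a * negExp b := by
  have h : ∀ c : ℝ≥0∞, EReal.exp c ≠ 0 := fun c => by simp
  rw [negExp, EReal.coe_ennreal_add, EReal.exp_add, ENNReal.mul_inv (Or.inl (h a)) (Or.inr (h b)),
    negExp, negExp]

lemma continuous_negExp : Continuous negExp := by
  have : Continuous EReal.exp := ENNReal.continuous_exp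
  unfold negExp
  exact continuous_inv.comp (this.comp continuous_coe_ennreal_ereal)

@[fun_prop] lemma measurable_negExp : Measurable negExp := continuous_negExp.measurable

lemma negExp_sum {ι : Type*} (s : Finset ι) (c : ι → ℝ≥0∞) :
    negExp (∑ i ∈ s, c i) = ∏ i ∈ s, negExp (c i) := by
  classical
  induction s using Finset.induction_on with
  | empty => simp
  | insert a s ha ih => rw [Finset.sum_insert ha, Finset.prod_insert ha, negExp_add, ih]

/-! ## Infinite products of numbers in `[0, 1]` -/

/-- The infinite product of a sequence of numbers in `[0, 1]`. -/
def iprod (a : ℕ → ℝ≥0∞) : ℝ≥0∞ := ⨅ n, ∏ k ∈ Finset.range n, a k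

lemma antitone_prod_range {a : ℕ → ℝ≥0∞} (ha : ∀ k, a k ≤ 1) :
    Antitone fun n => ∏ k ∈ Finset.range n, a k :=
  antitone_nat_of_succ_le fun n => by
    rw [Finset.prod_range_succ]
    exact mul_le_of_le_one_right' (ha n)

lemma tendsto_iprod {a : ℕ → ℝ≥0∞} (ha : ∀ k, a k ≤ 1) :
    Tendsto (fun n => ∏ k ∈ Finset.range n, a k) atTop (𝓝 (iprod a)) :=
  tendsto_atTop_iInf (antitone_prod_range ha)

lemma iprod_le_one (a : ℕ → ℝ≥0∞) : iprod a ≤ 1 :=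
  (iInf_le _ 0).trans (by simp)

lemma iprod_ne_top (a : ℕ → ℝ≥0∞) : iprod a ≠ ∞ :=
  ((iprod_le_one a).trans_lt ENNReal.one_lt_top).ne

lemma iprod_mono {a b : ℕ → ℝ≥0∞} (h : ∀ k, a k ≤ b k) : iprod a ≤ iprod b :=
  iInf_mono fun _ => Finset.prod_le_prod' fun k _ => h k

lemma iprod_one : iprod (fun _ => 1) = 1 := by simp [iprod]

lemma iprod_mul {a b : ℕ → ℝ≥0∞} (ha : ∀ k, a k ≤ 1) (hb : ∀ k, b k ≤ 1) :
    iprod (fun k => a k * b k) = iprod a * iprod b := by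
  refine tendsto_nhds_unique (tendsto_iprod fun k => mul_le_one' (ha k) (hb k)) ?_
  simp_rw [Finset.prod_mul_distrib]
  exact ENNReal.Tendsto.mul (tendsto_iprod ha) (Or.inr (iprod_ne_top b)) (tendsto_iprod hb)
    (Or.inr (iprod_ne_top a))

lemma iprod_prod {ι : Type*} (s : Finset ι) {a : ι → ℕ → ℝ≥0∞} (ha : ∀ i k, a i k ≤ 1) :
    iprod (fun k => ∏ i ∈ s, a i k) = ∏ i ∈ s, iprod (a i) := by
  classical
  induction s using Finset.induction_on with
  | empty => simp [iprod_one]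
  | insert i s hi ih =>
    simp_rw [Finset.prod_insert hi]
    rw [iprod_mul (ha i) (fun k => Finset.prod_le_one' fun i _ => ha i k), ih]

lemma iprod_single (j : ℕ) {c : ℝ≥0∞} (hc : c ≤ 1) : iprod (fun k => if k = j then c else 1) = c :=
    by
  refine tendsto_nhds_unique (tendsto_iprod fun k => by split_ifs <;> simp [hc]) ?_
  refine tendsto_const_nhds.congr' ?_
  filter_upwards [eventually_gt_atTop j] with n hn
  simp [Finset.prod_ite_eq', hn]

/-- Multiplying by a product with a single nontrivial factor extracts the factor `a j` without
division, so `a j = 0` is allowed. -/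
lemma iprod_eq_mul_iprod_ne {a : ℕ → ℝ≥0∞} (ha : ∀ k, a k ≤ 1) (j : ℕ) :
    iprod a = a j * iprod (fun k => if k = j then 1 else a k) := by
  conv_rhs => rw [← iprod_single j (ha j)]
  rw [← iprod_mul (fun k => by split_ifs <;> simp [ha]) (fun k => by split_ifs <;> simp [ha])]
  congr 1
  ext k
  split_ifs with h <;> simp [h]

/-- Continuity of `negExp` includes the point `∞`, so no summability is needed; a divergent sum
gives the product 0. -/
lemma negExp_tsum (c : ℕ → ℝ≥0∞) : negExp (∑' k, c k) = iprod fun k => negExp (c k) := by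
  refine tendsto_nhds_unique ?_ (tendsto_iprod fun k => negExp_le_one (c k))
  simp_rw [← negExp_sum]
  exact (continuous_negExp.tendsto _).comp (ENNReal.tendsto_nat_tsum c)

lemma tendsto_finset_prod_of_le_one {ι : Type*} (s : Finset ι) {a : ℕ → ι → ℝ≥0∞} {b : ι → ℝ≥0∞}
    (hb : ∀ i, b i ≤ 1) (h : ∀ i, Tendsto (fun m => a m i) atTop (𝓝 (b i))) :
    Tendsto (fun m => ∏ i ∈ s, a m i) atTop (𝓝 (∏ i ∈ s, b i)) := by
  classical
  induction s using Finset.induction_on with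
  | empty => simp
  | insert i s hi ih =>
    simp_rw [Finset.prod_insert hi]
    refine ENNReal.Tendsto.mul (h i) (Or.inr ?_) ih (Or.inr ?_)
    · exact ((Finset.prod_le_one' fun i _ => hb i).trans_lt ENNReal.one_lt_top).ne
    · exact ((hb i).trans_lt ENNReal.one_lt_top).ne

/-- Both sides are double infima of finite products; after exchanging the infima, a finite product
commutes with decreasing limits of factors at most 1. -/
lemma iprod_iInf {a : ℕ → ℕ → ℝ≥0∞} (ha : ∀ m k, a m k ≤ 1) (hanti : ∀ k, Antitone fun m => a m k) :
    iprod (fun k => ⨅ m, a m k) = ⨅ m, iprod (a m) := by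
  unfold iprod
  rw [iInf_comm]
  refine iInf_congr fun n => ?_
  refine tendsto_nhds_unique (tendsto_finset_prod_of_le_one _
    (fun k => (iInf_le _ 0).trans (ha 0 k)) fun k => tendsto_atTop_iInf (hanti k)) ?_
  exact tendsto_atTop_iInf fun m m' h => Finset.prod_le_prod' fun k _ => hanti k h

/-- Telescoping sum for an infinite product. -/
lemma tsum_mul_prod_add_iprod {b : ℕ → ℝ≥0∞} (hb : ∀ k, b k ≤ 1) :
    (∑' k, b k * ∏ i ∈ Finset.range k, (1 - b i)) + iprod (fun k => 1 - b k) = 1 := by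
  have h1 : ∀ k, 1 - b k ≤ 1 := fun k => tsub_le_self
  have key : ∀ n, (∑ k ∈ Finset.range n, b k * ∏ i ∈ Finset.range k, (1 - b i)) +
      ∏ i ∈ Finset.range n, (1 - b i) = 1 := by
    intro n
    induction n with
    | zero => simp
    | succ n ih =>
      rw [Finset.sum_range_succ, Finset.prod_range_succ, add_assoc, mul_comm (b n), ← mul_add,
        add_tsub_cancel_of_le (hb n), mul_one, ih]
  refine tendsto_nhds_unique ((ENNReal.tendsto_nat_tsum _).add (tendsto_iprod h1)) ?_
  simp_rw [key]
  exact tendsto_const_nhds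

@[fun_prop] lemma measurable_iprod {α : Type*} [MeasurableSpace α] {f : ℕ → α → ℝ≥0∞}
    (hf : ∀ k, Measurable (f k)) : Measurable fun x => iprod fun k => f k x :=
  Measurable.iInf fun _ => Finset.measurable_prod _ fun k _ => hf k

lemma lintegral_iprod {Ω : Type*} [MeasurableSpace Ω] (μ : Measure Ω) [IsFiniteMeasure μ]
    {f : ℕ → Ω → ℝ≥0∞} (hf : ∀ k, Measurable (f k)) (h1 : ∀ k ω, f k ω ≤ 1) :
    ∫⁻ ω, iprod (fun k => f k ω) ∂μ = ⨅ n, ∫⁻ ω, ∏ k ∈ Finset.range n, f k ω ∂μ := by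
  unfold iprod
  rw [lintegral_iInf (fun n => Finset.measurable_prod _ fun k _ => hf k)]
  · exact fun m n h ω => antitone_prod_range (fun k => h1 k ω) h
  · simp

lemma lintegral_iprod_of_iIndepFun {Ω : Type*} [MeasurableSpace Ω] (μ : Measure Ω)
    [IsProbabilityMeasure μ] {f : ℕ → Ω → ℝ≥0∞} (hf : ∀ k, Measurable (f k))
    (h1 : ∀ k ω, f k ω ≤ 1) (hind : iIndepFun f μ) :
    ∫⁻ ω, iprod (fun k => f k ω) ∂μ = iprod fun k => ∫⁻ ω, f k ω ∂μ := by
  rw [lintegral_iprod μ hf h1]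
  refine iInf_congr fun n => ?_
  have := lintegral_prod_eq_prod_lintegral_of_indepFun (Finset.range n) f hind hf
  simpa using this

/-! ## The probability generating functional of a Poisson process -/

/-- The power `c ^ N` for `c ≤ 1` and `N` possibly infinite. -/
def enatPow (c : ℝ≥0∞) (N : ℕ∞) : ℝ≥0∞ := ⨅ (k : ℕ) (_ : (k : ℕ∞) ≤ N), c ^ k

lemma enatPow_coe {c : ℝ≥0∞} (hc : c ≤ 1) (k : ℕ) : enatPow c k = c ^ k := by
  refine le_antisymm (iInf₂_le (f := fun (k : ℕ) (_ : (k : ℕ∞) ≤ _) => c ^ k) k le_rfl) (le_iInf₂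
      fun m hm => ?_)
  exact pow_le_pow_right_of_le_one' hc (by exact_mod_cast hm)

/-- The partial products are powers of `c` with exponent the number of elements of `J` below `n`.
Every finite subset of `J` lies below some `n`, so the two infima agree even for infinite `J`. -/
lemma iprod_ite_mem {c : ℝ≥0∞} (hc : c ≤ 1) (J : Set ℕ) [DecidablePred (· ∈ J)] :
    iprod (fun k => if k ∈ J then c else 1) = enatPow c J.encard := by
  have h : ∀ n, ∏ k ∈ Finset.range n, (if k ∈ J then c else 1) =
      c ^ ((Finset.range n).filter (· ∈ J)).card := by
    intro n
    rw [Finset.prod_ite, Finset.prod_const, Finset.prod_const_one, mul_one]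
  unfold iprod enatPow
  simp_rw [h]
  refine le_antisymm (le_iInf₂ fun k hk => ?_) (le_iInf fun n => ?_)
  · obtain ⟨t, htJ, htk⟩ := Set.exists_subset_encard_eq hk
    have hfin : t.Finite := Set.finite_of_encard_eq_coe htk
    obtain ⟨n, hn⟩ := hfin.bddAbove
    refine (iInf_le _ (n + 1)).trans (pow_le_pow_right_of_le_one' hc ?_)
    have hsub : t ⊆ ((Finset.range (n + 1)).filter (· ∈ J) : Finset ℕ) := fun x hx => by
      exact Finset.mem_coe.2 (Finset.mem_filter.2
        ⟨Finset.mem_range.2 (Nat.lt_succ_of_le (hn hx)), htJ hx⟩)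
    have := Set.encard_le_encard hsub
    rw [htk, Set.encard_coe_eq_coe_finsetCard] at this
    exact_mod_cast this
  · refine iInf₂_le _ ?_
    rw [← Set.encard_coe_eq_coe_finsetCard]
    exact Set.encard_le_encard fun x hx => by simp at hx; exact hx.2

lemma iprod_ite_pointCount {Ω : Type*} (X : ℕ → Ω → Plane) (B : Set Plane) (ω : Ω)
    [DecidablePred (· ∈ B)] {c : ℝ≥0∞} (hc : c ≤ 1) :
    iprod (fun k => if X k ω ∈ B then c else 1) = enatPow c (pointCount X B ω) := by
  classical
  rw [pointCount, ← iprod_ite_mem hc]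
  rfl

namespace IsPoissonProcess

variable {Ω : Type*} [MeasurableSpace Ω] {μ : Measure Ω} [IsProbabilityMeasure μ] {lam : ℝ}
  {X : ℕ → Ω → Plane}

lemma measurable_enatPow (hX : IsPoissonProcess μ lam X) {B : Set Plane} (hB : MeasurableSet B)
    {c : ℝ≥0∞} (hc : c ≤ 1) : Measurable fun ω => enatPow c (pointCount X B ω) := by
  classical
  simp_rw [← iprod_ite_pointCount X B _ hc]
  exact measurable_iprod fun k =>
    Measurable.ite (hX.measurable k hB) measurable_const measurable_const

/-- The event is recovered from `enatPow 2⁻¹` of the count, which is measurable as an infinite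
product of measurable functions and takes the value `2⁻¹ ^ k` only at the count `k`. -/
lemma measurableSet_pointCount (hX : IsPoissonProcess μ lam X) {B : Set Plane}
    (hB : MeasurableSet B) (k : ℕ) : MeasurableSet {ω | pointCount X B ω = k} := by
  have h2 : (2⁻¹ : ℝ≥0∞) ≤ 1 := by simp
  have hinj : ∀ N : ℕ∞, enatPow 2⁻¹ N = 2⁻¹ ^ k ↔ N = k := by
    intro N
    constructor
    · intro h
      induction N using ENat.recTopCoe with
      | top =>
        have h3 : (2⁻¹ : ℝ≥0∞) ^ k ≤ 2⁻¹ ^ (k + 1) := by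
          rw [← h]
          exact iInf₂_le (f := fun (k : ℕ) (_ : (k : ℕ∞) ≤ ⊤) => (2⁻¹ : ℝ≥0∞) ^ k) _ le_top
        rw [← ENNReal.inv_pow, ← ENNReal.inv_pow, ENNReal.inv_le_inv] at h3
        have h4 : (2 : ℕ) ^ (k + 1) ≤ 2 ^ k := by exact_mod_cast h3
        exact absurd h4 (by rw [pow_succ]; have := Nat.two_pow_pos k; omega)
      | coe m =>
        rw [enatPow_coe h2, ← ENNReal.inv_pow, ← ENNReal.inv_pow, inv_inj] at h
        have h4 : (2 : ℕ) ^ m = 2 ^ k := by exact_mod_cast h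
        rw [Nat.pow_right_injective le_rfl h4]
    · rintro rfl
      exact enatPow_coe h2 k
  have : {ω | pointCount X B ω = k} =
      (fun ω => enatPow 2⁻¹ (pointCount X B ω)) ⁻¹' {2⁻¹ ^ k} := by
    ext ω; simp [hinj]
  rw [this]
  exact hX.measurable_enatPow hB h2 (measurableSet_singleton _)

lemma tsum_pow_mul_poisson {a c : ℝ} (ha : 0 ≤ a) (hc : 0 ≤ c) :
    ∑' k : ℕ, ENNReal.ofReal c ^ k * ENNReal.ofReal (Real.exp (-a) * a ^ k / (k.factorial : ℝ)) =
      ENNReal.ofReal (Real.exp (-a) * Real.exp (c * a)) := by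
  have h := (NormedSpace.expSeries_div_hasSum_exp (c * a)).mul_left (Real.exp (-a))
  rw [← Real.exp_eq_exp_ℝ] at h
  rw [← h.tsum_eq, ENNReal.ofReal_tsum_of_nonneg (fun k => by positivity) h.summable]
  refine tsum_congr fun k => ?_
  rw [← ENNReal.ofReal_pow hc, ← ENNReal.ofReal_mul (by positivity)]
  congr 1
  rw [mul_pow]; ring

/-- The Poisson weights sum to one, which leaves no mass for an infinite count. -/
lemma ae_pointCount_lt_top (hX : IsPoissonProcess μ lam X) (hlam : 0 ≤ lam) {B : Set Plane}
    (hB : MeasurableSet B) (hfin : volume B < ∞) :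
    ∀ᵐ ω ∂μ, ω ∈ ⋃ k : ℕ, {ω | pointCount X B ω = k} := by
  have hmeas := fun k : ℕ => hX.measurableSet_pointCount hB k
  change (⋃ k : ℕ, {ω | pointCount X B ω = k}) ∈ ae μ
  rw [mem_ae_iff_prob_eq_one (MeasurableSet.iUnion hmeas), measure_iUnion _ hmeas]
  · simp_rw [hX.law B hB hfin]
    have := tsum_pow_mul_poisson (a := lam * (volume B).toReal) (c := 1) (by positivity) zero_le_one
    simpa [← Real.exp_add] using this
  · intro i j hij
    refine Set.disjoint_left.2 fun ω (h1 : _ = _) (h2 : _ = _) => hij ?_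
    rw [h1] at h2
    exact_mod_cast h2

/-- Generating function of the Poisson law, `E c ^ N = exp (-a (1 - c))`, obtained by splitting over
the almost surely finite values of the count. -/
lemma lintegral_enatPow (hX : IsPoissonProcess μ lam X) (hlam : 0 ≤ lam) {B : Set Plane}
    (hB : MeasurableSet B) (hfin : volume B < ∞) {c : ℝ≥0∞} (hc : c ≤ 1) :
    ∫⁻ ω, enatPow c (pointCount X B ω) ∂μ =
      negExp (ENNReal.ofReal lam * (volume B * (1 - c))) := by
  have hmeas := fun k : ℕ => hX.measurableSet_pointCount hB k
  rw [← setLIntegral_univ, ← setLIntegral_congr (s := ⋃ k : ℕ, {ω | pointCount X B ω = k}),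
    lintegral_iUnion hmeas]
  · lift c to NNReal using (hc.trans_lt ENNReal.one_lt_top).ne
    have h1 : ∀ k : ℕ, ∫⁻ ω in {ω | pointCount X B ω = k}, enatPow c (pointCount X B ω) ∂μ =
        ENNReal.ofReal (c : ℝ) ^ k * ENNReal.ofReal (Real.exp (-(lam * (volume B).toReal)) *
          (lam * (volume B).toReal) ^ k / (k.factorial : ℝ)) := by
      intro k
      rw [← hX.law B hB hfin k, setLIntegral_congr_fun (g := fun _ => (c : ℝ≥0∞) ^ k) (hmeas k),
        setLIntegral_const]
      · simp
      · intro ω (hω : _ = _)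
        simp only [hω, enatPow_coe hc]
    simp_rw [h1]
    rw [tsum_pow_mul_poisson (by positivity) c.coe_nonneg, ← Real.exp_add]
    have hc' : (c : ℝ) ≤ 1 := by exact_mod_cast hc
    have h2 : ENNReal.ofReal lam * (volume B * (1 - (c : ℝ≥0∞))) =
        ENNReal.ofReal (lam * ((volume B).toReal * (1 - c))) := by
      have h0 : 0 ≤ 1 - (c : ℝ) := by linarith
      rw [ENNReal.ofReal_mul hlam, ENNReal.ofReal_mul (by positivity), ENNReal.ofReal_toReal
          hfin.ne,
        ENNReal.ofReal_sub _ c.coe_nonneg]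
      simp
    rw [h2, negExp_ofReal]
    · congr 2; ring
    · have h0 : 0 ≤ 1 - (c : ℝ) := by linarith
      positivity
  · intro i j hij
    refine Set.disjoint_left.2 fun ω (h1 : _ = _) (h2 : _ = _) => hij ?_
    rw [h1] at h2
    exact_mod_cast h2
  · exact eventuallyEq_univ.2 (hX.ae_pointCount_lt_top hlam hB hfin)

/-- The generating functional for a step function. Grouping the factors by the set containing the
point gives a finite product of powers of independent counts, and the Poisson exponents add up to
the integral of `1 - f`. -/
lemma lintegral_iprod_prod (hX : IsPoissonProcess μ lam X) (hlam : 0 ≤ lam) {m : ℕ}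
    {B : Fin m → Set Plane} (hB : ∀ i, MeasurableSet (B i)) (hfin : ∀ i, volume (B i) < ∞)
    (hdisj : Pairwise (Function.onFun Disjoint B)) {c : Fin m → ℝ≥0∞} (hc : ∀ i, c i ≤ 1)
    {f : Plane → ℝ≥0∞} (hf : ∀ x i, x ∈ B i → f x = c i) (hf1 : ∀ x, (∀ i, x ∉ B i) → f x = 1) :
    ∫⁻ ω, iprod (fun k => f (X k ω)) ∂μ =
      negExp (ENNReal.ofReal lam * ∫⁻ x, (1 - f x)) := by
  classical
  have huniq : ∀ x i j, x ∈ B i → x ∈ B j → i = j := fun x i j hi hj => by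
    by_contra h
    exact Set.disjoint_left.1 (hdisj h) hi hj
  have hprod : ∀ x, f x = ∏ i, if x ∈ B i then c i else 1 := by
    intro x
    by_cases hx : ∃ i, x ∈ B i
    · obtain ⟨i, hi⟩ := hx
      rw [hf x i hi, Finset.prod_eq_single i]
      · simp [hi]
      · exact fun j _ hj => if_neg fun h => hj (huniq x j i h hi)
      · simp
    · push Not at hx
      rw [hf1 x hx]
      simp [hx]
  have hsum : ∀ x, 1 - f x = ∑ i, (B i).indicator (fun _ => 1 - c i) x := by
    intro x
    by_cases hx : ∃ i, x ∈ B i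
    · obtain ⟨i, hi⟩ := hx
      rw [hf x i hi, Finset.sum_eq_single i]
      · simp [hi]
      · exact fun j _ hj => Set.indicator_of_notMem (fun h => hj (huniq x j i h hi)) _
      · simp
    · push Not at hx
      rw [hf1 x hx]
      simp [hx]
  simp_rw [hsum, hprod]
  rw [lintegral_finsetSum _ fun i _ => measurable_const.indicator (hB i)]
  simp_rw [lintegral_indicator (hB _), setLIntegral_const]
  have h1 : ∀ ω, iprod (fun k => ∏ i, if X k ω ∈ B i then c i else 1) =
      ∏ i, enatPow (c i) (pointCount X (B i) ω) := fun ω => by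
    rw [iprod_prod _ fun i k => by split_ifs <;> simp [hc]]
    exact Finset.prod_congr rfl fun i _ => iprod_ite_pointCount X (B i) ω (hc i)
  simp_rw [h1]
  have hind : iIndepFun (fun i ω => enatPow (c i) (pointCount X (B i) ω)) μ :=
    (hX.indep m B hB hfin hdisj).comp (fun i => enatPow (c i)) fun i => measurable_of_countable _
  rw [lintegral_prod_eq_prod_lintegral_of_indepFun _ _ hind
    fun i => hX.measurable_enatPow (hB i) (hc i)]
  simp_rw [hX.lintegral_enatPow hlam (hB _) (hfin _) (hc _)]
  rw [← negExp_sum, Finset.mul_sum]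
  simp_rw [mul_comm (1 - c _)]

end IsPoissonProcess

/-- As `f m` decreases, `1 - f m` increases, so monotone convergence applies with no integrability
assumption. -/
lemma negExp_lintegral_eq_iInf {α : Type*} [MeasurableSpace α] (ν : Measure α) (lam : ℝ)
    {f : ℕ → α → ℝ≥0∞} {g : α → ℝ≥0∞} (hf : ∀ m, Measurable (f m))
    (hanti : ∀ x, Antitone fun m => f m x) (hlim : ∀ x, g x = ⨅ m, f m x) :
    negExp (ENNReal.ofReal lam * ∫⁻ x, (1 - g x) ∂ν) =
      ⨅ m, negExp (ENNReal.ofReal lam * ∫⁻ x, (1 - f m x) ∂ν) := by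
  have hmono : ∀ x, Monotone fun m => 1 - f m x := fun x m n h => tsub_le_tsub_left (hanti x h) 1
  have ht : Tendsto (fun m => ∫⁻ x, (1 - f m x) ∂ν) atTop (𝓝 (∫⁻ x, (1 - g x) ∂ν)) := by
    refine lintegral_tendsto_of_tendsto_of_monotone
      (fun m => (measurable_const.sub (hf m)).aemeasurable) (ae_of_all _ hmono) (ae_of_all _ fun x
        => ?_)
    rw [hlim x]
    exact ENNReal.Tendsto.sub tendsto_const_nhds (tendsto_atTop_iInf (hanti x))
      (Or.inl ENNReal.one_ne_top)
  refine tendsto_nhds_unique ((continuous_negExp.tendsto _).comp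
    (ENNReal.Tendsto.const_mul ht (Or.inr ENNReal.ofReal_ne_top))) ?_
  exact tendsto_atTop_iInf fun m n h => negExp_antitone
    (mul_le_mul_right (lintegral_mono fun x => hmono x h) _)

namespace IsPoissonProcess

variable {Ω : Type*} [MeasurableSpace Ω] {μ : Measure Ω} [IsProbabilityMeasure μ] {lam : ℝ}
  {X : ℕ → Ω → Plane}

/-- The sets are the level sets of `u` cut by `S`, which makes their areas finite. Truncated
subtraction keeps the factors in `[0, 1]` without a bound on `u`. -/
lemma lintegral_iprod_simpleFunc (hX : IsPoissonProcess μ lam X) (hlam : 0 ≤ lam)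
    (u : SimpleFunc Plane ℝ≥0∞) {S : Set Plane} (hS : MeasurableSet S) (hfin : volume S < ∞) :
    ∫⁻ ω, iprod (fun k => 1 - S.indicator u (X k ω)) ∂μ =
      negExp (ENNReal.ofReal lam * ∫⁻ x, (1 - (1 - S.indicator u x))) := by
  let e := u.range.equivFin.symm
  refine hX.lintegral_iprod_prod hlam (m := u.range.card)
    (B := fun i => u ⁻¹' {((e i : u.range) : ℝ≥0∞)} ∩ S) (c := fun i => 1 - (e i : ℝ≥0∞))
    (fun i => (u.measurableSet_fiber _).inter hS)
    (fun i => (measure_mono inter_subset_right).trans_lt hfin) ?_ (fun i => tsub_le_self)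
    (f := fun x => 1 - S.indicator u x) ?_ ?_
  · intro i j hij
    refine Set.disjoint_left.2 fun x hi hj => hij ?_
    exact e.injective (Subtype.ext (hi.1.symm.trans hj.1))
  · rintro x i ⟨h1, h2⟩
    have h1' : u x = e i := h1
    simp [h2, h1']
  · intro x hx
    by_cases hS : x ∈ S
    · exact absurd ⟨by simp, hS⟩ (hx (e.symm ⟨u x, SimpleFunc.mem_range_self u x⟩))
    · simp [hS]

/-- The probability generating functional of a Poisson process. -/
theorem lintegral_iprod_eq (hX : IsPoissonProcess μ lam X) (hlam : 0 ≤ lam)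
    {f : Plane → ℝ≥0∞} (hf : Measurable f) (hf1 : ∀ x, f x ≤ 1) :
    ∫⁻ ω, iprod (fun k => f (X k ω)) ∂μ = negExp (ENNReal.ofReal lam * ∫⁻ x, (1 - f x)) := by
  let g : Plane → ℝ≥0∞ := fun x => 1 - f x
  have hg : Measurable g := measurable_const.sub hf
  -- The function `1 - f` is approximated rather than `f`: cutting it off outside a ball sets the
  -- factor to 1 there, so only points in a set of finite area matter.
  let u : ℕ → Plane → ℝ≥0∞ := fun m => (Metric.ball (0 : Plane) m).indicator (SimpleFunc.eapprox g
      m)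
  have hum : ∀ m, Measurable (u m) := fun m =>
    (SimpleFunc.measurable _).indicator measurableSet_ball
  have humono : ∀ x, Monotone fun m => u m x := by
    intro x m n hmn
    refine (Set.indicator_le_indicator_apply_of_subset
      (Metric.ball_subset_ball (Nat.cast_le.2 hmn)) zero_le).trans ?_
    exact Set.indicator_le_indicator (SimpleFunc.monotone_eapprox g hmn x)
  have hulim : ∀ x, Tendsto (fun m => u m x) atTop (𝓝 (g x)) := by
    intro x
    refine (SimpleFunc.tendsto_eapprox hg x).congr' ?_
    obtain ⟨M, hM⟩ := exists_nat_gt ‖x‖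
    filter_upwards [eventually_ge_atTop M] with m hm
    have : x ∈ Metric.ball (0 : Plane) m := by
      rw [mem_ball_zero_iff]
      exact hM.trans_le (by exact_mod_cast hm)
    simp [u, this]
  have hanti : ∀ x, Antitone fun m => 1 - u m x := fun x m n h => tsub_le_tsub_left (humono x h) 1
  have hlim : ∀ x, f x = ⨅ m, (1 - u m x) := by
    intro x
    have h1 : f x = 1 - g x := (ENNReal.sub_sub_cancel ENNReal.one_ne_top (hf1 x)).symm
    rw [h1]
    exact tendsto_nhds_unique (ENNReal.Tendsto.sub tendsto_const_nhds (hulim x)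
      (Or.inl ENNReal.one_ne_top)) (tendsto_atTop_iInf (hanti x))
  rw [negExp_lintegral_eq_iInf volume lam (fun m => measurable_const.sub (hum m)) hanti hlim]
  have h2 : ∀ ω, iprod (fun k => f (X k ω)) = ⨅ m, iprod fun k => 1 - u m (X k ω) := by
    intro ω
    simp_rw [hlim]
    exact iprod_iInf (fun m k => tsub_le_self) fun k => hanti (X k ω)
  simp_rw [h2]
  rw [lintegral_iInf]
  · exact iInf_congr fun m => hX.lintegral_iprod_simpleFunc hlam _ measurableSet_ball (by
      simp [ENNReal.mul_lt_top_iff])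
  · exact fun m => measurable_iprod fun k => measurable_const.sub ((hum m).comp (hX.measurable k))
  · exact fun m n h ω => iprod_mono fun k => hanti (X k ω) h
  · refine ((lintegral_mono fun ω => iprod_le_one _).trans_lt ?_).ne
    simp

end IsPoissonProcess

/-! ## The Mecke formula -/

lemma tendsto_inv_nat_succ : Tendsto (fun n : ℕ => ((n : ℝ≥0∞) + 1)⁻¹) atTop (𝓝 0) := by
  have h : Tendsto (fun n : ℕ => (((n + 1 : ℕ) : ℝ≥0∞))⁻¹) atTop (𝓝 0) :=
    ENNReal.tendsto_inv_nat_nhds_zero.comp (tendsto_add_atTop_nat 1)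
  simpa using h

lemma antitone_inv_nat_succ : Antitone (fun n : ℕ => ((n : ℝ≥0∞) + 1)⁻¹) := fun m n h => by
  rw [ENNReal.inv_le_inv]
  gcongr

/-- The derivative of `t ↦ 1 - exp (-t x)` at 0, read along `t = 1 / (n + 1)`. -/
lemma tendsto_one_sub_negExp_div {x : ℝ≥0∞} (hx : x ≠ ∞) :
    Tendsto (fun n : ℕ => (1 - negExp (((n : ℝ≥0∞) + 1)⁻¹ * x)) * ((n : ℝ≥0∞) + 1)) atTop (𝓝 x) :=
        by
  lift x to NNReal using hx
  have h0 : HasDerivAt (fun t : ℝ => 1 - Real.exp (-(t * x))) x 0 := by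
    have := ((((hasDerivAt_id (0 : ℝ)).mul_const (x : ℝ)).neg).exp).const_sub 1
    simpa using this
  have h1 : Tendsto (fun n : ℕ => ((n : ℝ) + 1) * (1 - Real.exp (-(((n : ℝ) + 1)⁻¹ * x)))) atTop
      (𝓝 (x : ℝ)) := by
    have h2 : Tendsto (fun n : ℕ => ((n : ℝ) + 1)⁻¹) atTop (𝓝[≠] 0) := by
      refine tendsto_nhdsWithin_iff.2 ⟨?_, Eventually.of_forall fun n => ?_⟩
      · simpa [one_div] using tendsto_one_div_add_atTop_nhds_zero_nat (𝕜 := ℝ)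
      · have : (0 : ℝ) < ((n : ℝ) + 1)⁻¹ := by positivity
        exact this.ne'
    have h3 := (hasDerivAt_iff_tendsto_slope.1 h0).comp h2
    refine h3.congr fun n => ?_
    simp [slope_def_field]
    ring
  have h4 := ENNReal.tendsto_ofReal h1
  rw [ENNReal.ofReal_coe_nnreal] at h4
  refine h4.congr fun n => ?_
  have hn : (0 : ℝ) < (n : ℝ) + 1 := by positivity
  have h5 : ((n : ℝ≥0∞) + 1) = ENNReal.ofReal ((n : ℝ) + 1) := by
    rw [ENNReal.ofReal_add (by positivity) zero_le_one]; simp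
  have h6 : ((n : ℝ≥0∞) + 1)⁻¹ * x = ENNReal.ofReal (((n : ℝ) + 1)⁻¹ * x) := by
    rw [h5, ENNReal.ofReal_mul (by positivity), ENNReal.ofReal_inv_of_pos hn]; simp
  rw [h6, negExp_ofReal (by positivity), h5, mul_comm (1 - _), ENNReal.ofReal_mul hn.le,
      ENNReal.ofReal_sub _ (Real.exp_pos _).le,
    ENNReal.ofReal_one]

/-- As the parameter `1 / (n + 1)` decreases to 0 each finite product increases to 1; monotone
convergence for the counting measure gives the limit of the series. -/
lemma tendsto_tsum_mul_prod {b : ℕ → ℝ≥0∞} (hb : ∀ k, b k ≤ 1) :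
    Tendsto (fun n : ℕ => ∑' k, b k * ∏ i ∈ Finset.range k, (1 - ((n : ℝ≥0∞) + 1)⁻¹ * b i)) atTop
      (𝓝 (∑' k, b k)) := by
  simp_rw [← lintegral_count]
  refine lintegral_tendsto_of_tendsto_of_monotone (fun n => (measurable_of_countable
      _).aemeasurable)
    (ae_of_all _ fun k m n h => ?_) (ae_of_all _ fun k => ?_)
  · have := antitone_inv_nat_succ h
    dsimp only
    gcongr
  · have h1 : Tendsto (fun n : ℕ => ∏ i ∈ Finset.range k, (1 - ((n : ℝ≥0∞) + 1)⁻¹ * b i)) atTop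
        (𝓝 (∏ i ∈ Finset.range k, 1)) := by
      refine tendsto_finset_prod_of_le_one _ (fun _ => le_rfl) fun i => ?_
      have h2 : Tendsto (fun n : ℕ => 1 - ((n : ℝ≥0∞) + 1)⁻¹ * b i) atTop (𝓝 (1 - 0 * b i)) :=
        ENNReal.Tendsto.sub tendsto_const_nhds (ENNReal.Tendsto.mul_const tendsto_inv_nat_succ
          (Or.inr ((hb i).trans_lt ENNReal.one_lt_top).ne)) (Or.inl ENNReal.one_ne_top)
      simpa using h2
    have h3 := ENNReal.Tendsto.const_mul (a := b k) h1 (Or.inl (by simp))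
    simpa using h3

lemma tsum_iSup_of_monotone {a : ℕ → ℕ → ℝ≥0∞} (ha : ∀ k, Monotone fun n => a n k) :
    ∑' k, ⨆ n, a n k = ⨆ n, ∑' k, a n k := by
  simp_rw [← lintegral_count]
  exact lintegral_iSup (fun n => measurable_of_countable _) fun m n h k => ha k h

namespace IsPoissonProcess

variable {Ω : Type*} [MeasurableSpace Ω] {μ : Measure Ω} [IsProbabilityMeasure μ] {lam : ℝ}
  {X : ℕ → Ω → Plane}

/-- The generating functional is differentiated at `t = 0` along `f (1 - t b)`. By telescoping, the
difference quotient is exactly a series that increases as `t` decreases, so its limit is taken by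
monotone convergence. On the other side stands the derivative of an exponential, for which `hfin`
makes the slope finite. -/
lemma lintegral_iprod_mul_tsum_of_le_one (hX : IsPoissonProcess μ lam X) (hlam : 0 ≤ lam)
    {f b : Plane → ℝ≥0∞} (hf : Measurable f) (hf1 : ∀ x, f x ≤ 1) (hb : Measurable b)
    (hb1 : ∀ x, b x ≤ 1) (hfin : ∫⁻ x, b x * f x ≠ ∞) :
    ∫⁻ ω, iprod (fun k => f (X k ω)) * ∑' k, b (X k ω) ∂μ =
      ENNReal.ofReal lam * (∫⁻ x, b x * f x) * negExp (ENNReal.ofReal lam * ∫⁻ x, (1 - f x)) := by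
  set A := negExp (ENNReal.ofReal lam * ∫⁻ x, (1 - f x)) with hA
  have hA1 : A ≤ 1 := negExp_le_one _
  have hXm := hX.measurable
  have htop : ∀ n : ℕ, (n : ℝ≥0∞) + 1 ≠ ∞ := fun n => by simp
  have hS : ∀ n : ℕ, Measurable fun ω => iprod (fun k => f (X k ω)) *
      ∑' k, b (X k ω) * ∏ i ∈ Finset.range k, (1 - ((n : ℝ≥0∞) + 1)⁻¹ * b (X i ω)) := fun n => by
    refine (measurable_iprod fun k => hf.comp (hXm k)).mul (Measurable.tsum fun k => ?_)
    exact (hb.comp (hXm k)).mul (Finset.measurable_prod _ fun i _ =>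
      measurable_const.sub ((hb.comp (hXm i)).const_mul _))
  have key : ∀ n : ℕ, ∫⁻ ω, iprod (fun k => f (X k ω)) *
      ∑' k, b (X k ω) * ∏ i ∈ Finset.range k, (1 - ((n : ℝ≥0∞) + 1)⁻¹ * b (X i ω)) ∂μ =
      A * ((1 - negExp (((n : ℝ≥0∞) + 1)⁻¹ * (ENNReal.ofReal lam * ∫⁻ x, b x * f x))) *
        ((n : ℝ≥0∞) + 1)) := by
    intro n
    set t := ((n : ℝ≥0∞) + 1)⁻¹ with ht
    have ht1 : t ≤ 1 := by rw [ht, ENNReal.inv_le_one]; exact le_add_self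
    have htb : ∀ x, t * b x ≤ 1 := fun x => mul_le_one' ht1 (hb1 x)
    have h1 := hX.lintegral_iprod_eq hlam (f := fun x => f x * (1 - t * b x))
      (hf.mul (measurable_const.sub (hb.const_mul _))) (fun x => mul_le_one' (hf1 x) tsub_le_self)
    -- The exponent becomes affine in `t`, so the perturbed functional is `A` times `negExp` of `t`
    -- times the Mecke integral.
    have h2 : ∀ x, 1 - f x * (1 - t * b x) = (1 - f x) + t * (b x * f x) := by
      intro x
      have hfx : f x ≠ ∞ := ((hf1 x).trans_lt ENNReal.one_lt_top).ne
      refine ENNReal.sub_eq_of_eq_add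
        (((mul_le_one' (hf1 x) tsub_le_self).trans_lt ENNReal.one_lt_top).ne) ?_
      have h3 : t * (b x * f x) + f x * (1 - t * b x) = f x := by
        rw [show t * (b x * f x) = f x * (t * b x) by ring, ← mul_add,
          add_tsub_cancel_of_le (htb x), mul_one]
      rw [add_assoc, h3, tsub_add_cancel_of_le (hf1 x)]
    simp_rw [h2] at h1
    have h1m : Measurable fun x => 1 - f x := measurable_const.sub hf
    have h2m : Measurable fun x => b x * f x := hb.mul hf
    rw [lintegral_add_left h1m, lintegral_const_mul _ h2m, mul_add,
      negExp_add, ← hA, mul_left_comm] at h1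
    have h4 : ∫⁻ ω, iprod (fun k => f (X k ω)) ∂μ = A := hX.lintegral_iprod_eq hlam hf hf1
    -- This is `tsum_mul_prod_add_iprod` for `t * b`, multiplied by the product of the `f (X k ω)`.
    have h5 : ∀ ω, iprod (fun k => f (X k ω)) =
        (iprod (fun k => f (X k ω)) *
          ∑' k, b (X k ω) * ∏ i ∈ Finset.range k, (1 - t * b (X i ω))) * t +
        iprod (fun k => f (X k ω) * (1 - t * b (X k ω))) := by
      intro ω
      have h6 := tsum_mul_prod_add_iprod (b := fun k => t * b (X k ω)) fun k => htb _
      rw [iprod_mul (fun k => hf1 _) (fun k => tsub_le_self), mul_assoc, ← mul_add,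
        ← ENNReal.tsum_mul_right]
      conv_lhs => rw [← mul_one (iprod _), ← h6]
      congr 3
      ext k
      ring
    have h7 : (∫⁻ ω, iprod (fun k => f (X k ω)) *
          (∑' k, b (X k ω) * ∏ i ∈ Finset.range k, (1 - t * b (X i ω))) ∂μ) * t +
        A * negExp (t * (ENNReal.ofReal lam * ∫⁻ x, b x * f x)) = A := by
      rw [← h1, ← lintegral_mul_const _ (hS n), ← lintegral_add_left ((hS n).mul_const _)]
      exact (lintegral_congr fun ω => (h5 ω).symm).trans h4
    have h8 : (∫⁻ ω, iprod (fun k => f (X k ω)) *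
          (∑' k, b (X k ω) * ∏ i ∈ Finset.range k, (1 - t * b (X i ω))) ∂μ) * t =
        A * (1 - negExp (t * (ENNReal.ofReal lam * ∫⁻ x, b x * f x))) := by
      rw [ENNReal.mul_sub fun _ _ => (hA1.trans_lt ENNReal.one_lt_top).ne, mul_one]
      refine ENNReal.eq_sub_of_add_eq ?_ h7
      exact ((mul_le_one' hA1 (negExp_le_one _)).trans_lt ENNReal.one_lt_top).ne
    rw [← mul_assoc, ← h8, mul_assoc, ht, ENNReal.inv_mul_cancel (by simp) (htop n), mul_one]
  have hlim1 : Tendsto (fun n : ℕ => ∫⁻ ω, iprod (fun k => f (X k ω)) *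
      ∑' k, b (X k ω) * ∏ i ∈ Finset.range k, (1 - ((n : ℝ≥0∞) + 1)⁻¹ * b (X i ω)) ∂μ) atTop
      (𝓝 (∫⁻ ω, iprod (fun k => f (X k ω)) * ∑' k, b (X k ω) ∂μ)) := by
    refine lintegral_tendsto_of_tendsto_of_monotone (fun n => (hS n).aemeasurable)
      (ae_of_all _ fun ω m n h => ?_) (ae_of_all _ fun ω => ?_)
    · have := antitone_inv_nat_succ h
      dsimp only
      gcongr
    · exact ENNReal.Tendsto.const_mul (tendsto_tsum_mul_prod fun k => hb1 _)
        (Or.inr (iprod_ne_top _))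
  simp_rw [key] at hlim1
  have hx : ENNReal.ofReal lam * ∫⁻ x, b x * f x ≠ ∞ := ENNReal.mul_ne_top ENNReal.ofReal_ne_top
      hfin
  have hlim2 := ENNReal.Tendsto.const_mul (a := A) (tendsto_one_sub_negExp_div hx)
    (Or.inr (hA1.trans_lt ENNReal.one_lt_top).ne)
  rw [tendsto_nhds_unique hlim1 hlim2, mul_comm]

/-- The Mecke formula for a product functional that does not depend on the marked point. -/
theorem lintegral_iprod_mul_tsum (hX : IsPoissonProcess μ lam X) (hlam : 0 ≤ lam)
    {f b : Plane → ℝ≥0∞} (hf : Measurable f) (hf1 : ∀ x, f x ≤ 1) (hb : Measurable b) :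
    ∫⁻ ω, iprod (fun k => f (X k ω)) * ∑' k, b (X k ω) ∂μ =
      ENNReal.ofReal lam * (∫⁻ x, b x * f x) * negExp (ENNReal.ofReal lam * ∫⁻ x, (1 - f x)) := by
  have hfm : Measurable fun ω => iprod (fun k => f (X k ω)) :=
    measurable_iprod fun k => hf.comp (hX.measurable k)
  -- Both sides are additive and monotone continuous in `b`; in the base case of a multiple of the
  -- indicator of a set of finite area, the bounded version applies after factoring out the
  -- constant.
  refine Measurable.ennreal_sigmaFinite_induction (μ := (volume : Measure Plane))
    (motive := fun b => ∫⁻ ω, iprod (fun k => f (X k ω)) * ∑' k, b (X k ω) ∂μ =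
      ENNReal.ofReal lam * (∫⁻ x, b x * f x) * negExp (ENNReal.ofReal lam * ∫⁻ x, (1 - f x)))
    (fun c s hs hfin => ?_) (fun g h _ hg hh ihg ihh => ?_) (fun g hg hmono ih => ?_) hb
  ·
    have h1 : ∀ x, s.indicator (fun _ => c) x = c * s.indicator (fun _ => (1 : ℝ≥0∞)) x := fun x =>
        by
      by_cases hx : x ∈ s <;> simp [hx]
    have hm : Measurable (s.indicator fun _ => (1 : ℝ≥0∞)) := measurable_const.indicator hs
    have h1b : ∀ x, s.indicator (fun _ => (1 : ℝ≥0∞)) x ≤ 1 := fun x =>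
      Set.indicator_le_self' (fun _ _ => zero_le) x
    have h2 := hX.lintegral_iprod_mul_tsum_of_le_one hlam hf hf1 hm h1b (by
      refine ((lintegral_mono (g := s.indicator fun _ => (1 : ℝ≥0∞)) fun x =>
        mul_le_of_le_one_right' (hf1 x)).trans_lt ?_).ne
      rwa [lintegral_indicator hs, setLIntegral_const, one_mul])
    simp_rw [h1, ENNReal.tsum_mul_left, mul_left_comm _ c, mul_assoc c]
    rw [lintegral_const_mul, lintegral_const_mul, h2]
    · ring
    · exact hm.mul hf
    · exact hfm.mul (Measurable.tsum fun k => hm.comp (hX.measurable k))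
  · simp_rw [Pi.add_apply, ENNReal.tsum_add, mul_add, add_mul]
    have hgf : Measurable fun x => g x * f x := hg.mul hf
    rw [lintegral_add_left, ihg, ihh, lintegral_add_left hgf]
    · ring
    · exact hfm.mul (Measurable.tsum fun k => hg.comp (hX.measurable k))
  · have hmk : ∀ x, Monotone fun n => g n x := fun x m n h => hmono h x
    have hX' : ∀ n k, Measurable fun ω => g n (X k ω) := fun n k => (hg n).comp (hX.measurable k)
    simp_rw [tsum_iSup_of_monotone fun k => hmk (X k _), ENNReal.mul_iSup, ENNReal.iSup_mul]
    have hm1 : ∀ n, Measurable fun ω => iprod (fun k => f (X k ω)) * ∑' k, g n (X k ω) :=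
      fun n => hfm.mul (Measurable.tsum (hX' n))
    have hm2 : ∀ n, Measurable fun x => g n x * f x := fun n => (hg n).mul hf
    rw [lintegral_iSup hm1, lintegral_iSup hm2, ENNReal.mul_iSup, ENNReal.iSup_mul]
    · exact iSup_congr ih
    · exact fun m n h x => mul_le_mul_left (hmk x h) _
    · exact fun m n h ω => mul_le_mul_right (ENNReal.tsum_le_tsum fun k => hmk _ h) _

end IsPoissonProcess

/-! ### Dyadic approximation of a radius from below. -/

/-- The lower end point of the dyadic interval of length `2 ^ (-m)` that contains `r`. -/
def dyadicIndex (m : ℕ) (r : ℝ) : ℕ := ⌈r * 2 ^ m⌉₊ - 1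

lemma measurable_dyadicIndex (m : ℕ) : Measurable (dyadicIndex m) :=
  (measurable_of_countable fun n : ℕ => n - 1).comp
    (Nat.measurable_ceil.comp (measurable_id.mul_const _))

/-- The dyadic approximation of `r` from below. -/
def dyadicBelow (m : ℕ) (r : ℝ) : ℝ := dyadicIndex m r / 2 ^ m

lemma dyadicBelow_nonneg (m : ℕ) (r : ℝ) : 0 ≤ dyadicBelow m r := by
  unfold dyadicBelow; positivity

lemma dyadicIndex_cast {m : ℕ} {r : ℝ} (hr : 0 < r) :
    (dyadicIndex m r : ℝ) = ⌈r * 2 ^ m⌉₊ - 1 := by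
  have : 0 < ⌈r * 2 ^ m⌉₊ := Nat.ceil_pos.2 (by positivity)
  rw [dyadicIndex, Nat.cast_sub this, Nat.cast_one]

/-- Taking the ceiling minus one makes the inequality strict, as required by the conditions `hleft`
and `hpos` of the Mecke formula. -/
lemma dyadicBelow_lt {m : ℕ} {r : ℝ} (hr : 0 < r) : dyadicBelow m r < r := by
  rw [dyadicBelow, dyadicIndex_cast hr, div_lt_iff₀ (by positivity)]
  linarith [Nat.ceil_lt_add_one (a := r * 2 ^ m) (by positivity)]

lemma sub_le_dyadicBelow {m : ℕ} {r : ℝ} (hr : 0 < r) : r - (1 / 2) ^ m ≤ dyadicBelow m r := by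
  rw [dyadicBelow, dyadicIndex_cast hr, le_div_iff₀ (by positivity), sub_mul, ← mul_pow]
  norm_num
  exact Nat.le_ceil _

lemma tendsto_dyadicBelow {r : ℝ} (hr : 0 < r) :
    Tendsto (fun m => dyadicBelow m r) atTop (𝓝 r) := by
  refine tendsto_of_tendsto_of_tendsto_of_le_of_le ?_ tendsto_const_nhds
    (fun m => sub_le_dyadicBelow hr) (fun m => (dyadicBelow_lt hr).le)
  simpa using (tendsto_pow_atTop_nhds_zero_of_lt_one (by norm_num : (0 : ℝ) ≤ 1 / 2)
    (by norm_num)).const_sub r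

lemma monotone_dyadicBelow {r : ℝ} (hr : 0 < r) : Monotone fun m => dyadicBelow m r := by
  refine monotone_nat_of_le_succ fun m => ?_
  have h1 : 2 * dyadicIndex m r ≤ dyadicIndex (m + 1) r := by
    have h2 : ((2 * dyadicIndex m r : ℕ) : ℝ) < r * 2 ^ (m + 1) := by
      push_cast
      rw [dyadicIndex_cast hr, pow_succ]
      linarith [Nat.ceil_lt_add_one (a := r * 2 ^ m) (by positivity)]
    have h3 := Nat.lt_ceil.2 h2
    unfold dyadicIndex at h3 ⊢
    omega
  have h2 : (2 * dyadicIndex m r : ℝ) ≤ dyadicIndex (m + 1) r := by exact_mod_cast h1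
  unfold dyadicBelow
  rw [div_le_div_iff₀ (by positivity) (by positivity), pow_succ]
  nlinarith [pow_pos (two_pos : (0 : ℝ) < 2) m]

namespace IsPoissonProcess

variable {Ω : Type*} [MeasurableSpace Ω] {μ : Measure Ω} [IsProbabilityMeasure μ] {lam : ℝ}
  {X : ℕ → Ω → Plane}

/-- The Mecke formula for a product functional that depends on the marked point through a
countably valued function. -/
theorem lintegral_tsum_iprod_countable (hX : IsPoissonProcess μ lam X) (hlam : 0 ≤ lam)
    {τ : Plane → ℕ} (hτ : Measurable τ) {f : ℕ → Plane → ℝ≥0∞} (hf : ∀ i, Measurable (f i))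
    (hf1 : ∀ i x, f i x ≤ 1) {w : Plane → ℝ≥0∞} (hw : Measurable w)
    (hne : ∀ x, w x ≠ 0 → f (τ x) x ≠ 0) :
    ∫⁻ ω, ∑' j, w (X j ω) * iprod (fun k => if k = j then 1 else f (τ (X j ω)) (X k ω)) ∂μ =
      ENNReal.ofReal lam *
        ∫⁻ x, w x * negExp (ENNReal.ofReal lam * ∫⁻ y, (1 - f (τ x) y)) := by
  -- The known formula has a product over all points, the marked one included. Dividing `w` by the
  -- factor of the marked point removes it; `hne` excludes a zero divisor where `w` does not vanish.
  let b : ℕ → Plane → ℝ≥0∞ := fun i x => if τ x = i then w x / f i x else 0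
  have hb : ∀ i, Measurable (b i) := fun i =>
    Measurable.ite (hτ (measurableSet_singleton i)) (hw.div (hf i)) measurable_const
  have hbf : ∀ i x, b i x * f i x = if τ x = i then w x else 0 := by
    intro i x
    by_cases h : τ x = i
    · simp only [b, h, if_true]
      by_cases hw0 : w x = 0
      · simp [hw0]
      · exact ENNReal.div_mul_cancel (h ▸ hne x hw0) ((hf1 i x).trans_lt ENNReal.one_lt_top).ne
    · simp [b, h]
  have h1 : ∀ ω, ∑' j, w (X j ω) * iprod (fun k => if k = j then 1 else f (τ (X j ω)) (X k ω)) =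
      ∑' i, iprod (fun k => f i (X k ω)) * ∑' j, b i (X j ω) := by
    intro ω
    simp_rw [← ENNReal.tsum_mul_left]
    rw [ENNReal.tsum_comm]
    refine tsum_congr fun j => ?_
    rw [tsum_eq_single (τ (X j ω))]
    · rw [iprod_eq_mul_iprod_ne (fun k => hf1 _ _) j, mul_right_comm,
        mul_comm (f _ _) (b _ _), hbf]
      simp
    · intro i hi
      simp [b, hi.symm]
  simp_rw [h1]
  have hm : ∀ i, Measurable fun x => b i x * f i x := fun i => (hb i).mul (hf i)
  have hm' : ∀ i, Measurable fun ω => iprod (fun k => f i (X k ω)) * ∑' j, b i (X j ω) := fun i =>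
    (measurable_iprod fun k => (hf i).comp (hX.measurable k)).mul
      (Measurable.tsum fun j => (hb i).comp (hX.measurable j))
  rw [lintegral_tsum fun i => (hm' i).aemeasurable]
  simp_rw [hX.lintegral_iprod_mul_tsum hlam (hf _) (hf1 _) (hb _), mul_assoc]
  rw [ENNReal.tsum_mul_left]
  congr 1
  simp_rw [← lintegral_mul_const _ (hm _)]
  rw [← lintegral_tsum fun i => ((hm i).mul_const _).aemeasurable]
  refine lintegral_congr fun x => ?_
  rw [tsum_eq_single (τ x)]
  · simp [hbf]
  · intro i hi
    simp [hbf, hi.symm]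

/-- The distance of the marked point is replaced by its dyadic approximation from below, which takes
countably many values. Since `φ` decreases and is left continuous in the radius, both sides converge
downwards; decreasing convergence requires finite integrals, hence the bounded support of `w`. -/
lemma lintegral_tsum_iprod_ball (hX : IsPoissonProcess μ lam X) (hlam : 0 ≤ lam)
    {φ : ℝ → Plane → ℝ≥0∞} (hφ : Measurable (Function.uncurry φ)) (hφ1 : ∀ z y, φ z y ≤ 1)
    (hanti : ∀ y, AntitoneOn (fun z => φ z y) (Ici 0))
    (hleft : ∀ y z, 0 < z → ∀ u : ℕ → ℝ, Monotone u → (∀ m, 0 ≤ u m ∧ u m < z) →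
      Tendsto u atTop (𝓝 z) → ⨅ m, φ (u m) y = φ z y)
    (hpos : ∀ z y, 0 ≤ z → z < ‖y‖ → φ z y ≠ 0)
    {w : ℝ → ℝ≥0∞} (hw : Measurable w) (hw1 : ∀ r, w r ≤ 1) (hw0 : w 0 = 0) {R : ℝ}
    (hwR : ∀ r, R ≤ r → w r = 0) :
    ∫⁻ ω, ∑' j, w ‖X j ω‖ * iprod (fun k => if k = j then 1 else φ ‖X j ω‖ (X k ω)) ∂μ =
      ENNReal.ofReal lam *
        ∫⁻ x : Plane, w ‖x‖ * negExp (ENNReal.ofReal lam * ∫⁻ y, (1 - φ ‖x‖ y)) := by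
  have hφz : ∀ z, Measurable (φ z) := fun z => hφ.comp (measurable_const.prodMk measurable_id)
  have hXm := hX.measurable
  have hwx : Measurable fun x : Plane => w ‖x‖ := hw.comp measurable_norm
  have hpos' : ∀ x : Plane, w ‖x‖ ≠ 0 → 0 < ‖x‖ := fun x h =>
    (norm_nonneg x).lt_of_ne fun h0 => h (h0 ▸ hw0)
  have hτ : ∀ m, Measurable fun x : Plane => dyadicIndex m ‖x‖ := fun m =>
    (measurable_dyadicIndex m).comp measurable_norm
  have step := fun m : ℕ => hX.lintegral_tsum_iprod_countable hlam (hτ m)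
    (f := fun i => φ ((i : ℝ) / 2 ^ m)) (fun i => hφz _) (fun i => hφ1 _) hwx
    (fun x hx => hpos _ _ (by positivity) (dyadicBelow_lt (hpos' x hx)))
  have hz : ∀ m (x : Plane), (dyadicIndex m ‖x‖ : ℝ) / 2 ^ m = dyadicBelow m ‖x‖ := fun m x => rfl
  simp_rw [hz] at step
  have hbm : ∀ m, Measurable fun x : Plane => dyadicBelow m ‖x‖ := fun m =>
    (measurable_of_countable fun i : ℕ => (i : ℝ) / 2 ^ m).comp (hτ m)
  have hinf : ∀ (x : Plane) y, 0 < ‖x‖ → φ ‖x‖ y = ⨅ m, φ (dyadicBelow m ‖x‖) y := fun x y hx =>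
    (hleft y _ hx _ (monotone_dyadicBelow hx) (fun m => ⟨dyadicBelow_nonneg _ _, dyadicBelow_lt hx⟩)
      (tendsto_dyadicBelow hx)).symm
  have hantim : ∀ (x : Plane) y, 0 < ‖x‖ → Antitone fun m => φ (dyadicBelow m ‖x‖) y :=
    fun x y hx m n h => hanti y (dyadicBelow_nonneg _ _) (dyadicBelow_nonneg _ _)
      (monotone_dyadicBelow hx h)
  have hwtop : ∀ r, w r ≠ ∞ := fun r => ((hw1 r).trans_lt ENNReal.one_lt_top).ne
  have hIm : ∀ m, Measurable fun x : Plane =>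
      w ‖x‖ * negExp (ENNReal.ofReal lam * ∫⁻ y, (1 - φ (dyadicBelow m ‖x‖) y)) := by
    intro m
    refine hwx.mul (measurable_negExp.comp (Measurable.const_mul ?_ _))
    refine Measurable.lintegral_prod_right' (f := fun q : Plane × Plane =>
      1 - φ (dyadicBelow m ‖q.1‖) q.2) ?_
    exact measurable_const.sub (hφ.comp (((hbm m).comp measurable_fst).prodMk measurable_snd))
  have hR : ∫⁻ x : Plane, w ‖x‖ < ∞ := by
    refine (lintegral_mono (g := (Metric.ball (0 : Plane) R).indicator fun _ => 1) fun x =>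
        ?_).trans_lt ?_
    · by_cases hx : ‖x‖ < R
      · simp [hx, hw1]
      · simp [hx, hwR _ (not_lt.1 hx)]
    · rw [lintegral_indicator measurableSet_ball, setLIntegral_const]
      simp [ENNReal.mul_lt_top_iff]
  have hRHS : ∫⁻ x : Plane, w ‖x‖ * negExp (ENNReal.ofReal lam * ∫⁻ y, (1 - φ ‖x‖ y)) =
      ⨅ m, ∫⁻ x : Plane,
        w ‖x‖ * negExp (ENNReal.ofReal lam * ∫⁻ y, (1 - φ (dyadicBelow m ‖x‖) y)) := by
    rw [← lintegral_iInf hIm]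
    · refine lintegral_congr fun x => ?_
      by_cases hx : w ‖x‖ = 0
      · simp [hx]
      · have hx' := hpos' x hx
        rw [negExp_lintegral_eq_iInf volume lam (fun m => hφz _) (fun y => hantim x y hx')
          (fun y => hinf x y hx'), ENNReal.mul_iInf_of_ne hx (hwtop _)]
    · intro m n h x
      by_cases hx : w ‖x‖ = 0
      · simp [hx]
      · have hx' := hpos' x hx
        dsimp only
        gcongr
        refine negExp_antitone ?_
        gcongr with y
        exact hantim x y hx' h
    · exact ((lintegral_mono fun x => mul_le_of_le_one_right' (negExp_le_one _)).trans_lt hR).ne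
  have hFm : ∀ m, Measurable fun q : Ω × ℕ => w ‖X q.2 q.1‖ *
      iprod (fun k => if k = q.2 then 1 else φ (dyadicBelow m ‖X q.2 q.1‖) (X k q.1)) := by
    intro m
    refine measurable_from_prod_countable_left fun j => ?_
    refine (hwx.comp (hXm j)).mul (measurable_iprod fun k => ?_)
    by_cases hkj : k = j
    · simp [hkj]
    · simp only [hkj, if_false]
      exact hφ.comp (((hbm m).comp (hXm j)).prodMk (hXm k))
  -- Expectation and sum over the marked point form one integral over a product with counting
  -- measure, so decreasing convergence is used once for both.
  have hcount : ∀ F : Ω × ℕ → ℝ≥0∞, Measurable F →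
      ∫⁻ ω, ∑' j, F (ω, j) ∂μ = ∫⁻ q, F q ∂(μ.prod Measure.count) := by
    intro F hF
    rw [lintegral_prod _ hF.aemeasurable]
    simp_rw [lintegral_count]
  have hLHS : ∫⁻ ω, ∑' j, w ‖X j ω‖ * iprod (fun k => if k = j then 1 else φ ‖X j ω‖ (X k ω)) ∂μ =
      ⨅ m, ∫⁻ ω, ∑' j, w ‖X j ω‖ *
        iprod (fun k => if k = j then 1 else φ (dyadicBelow m ‖X j ω‖) (X k ω)) ∂μ := by
    have h1 : ∀ (q : Ω × ℕ), w ‖X q.2 q.1‖ *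
          iprod (fun k => if k = q.2 then 1 else φ ‖X q.2 q.1‖ (X k q.1)) =
        ⨅ m, w ‖X q.2 q.1‖ *
          iprod (fun k => if k = q.2 then 1 else φ (dyadicBelow m ‖X q.2 q.1‖) (X k q.1)) := by
      intro q
      by_cases hx : w ‖X q.2 q.1‖ = 0
      · simp [hx]
      · have hx' := hpos' _ hx
        rw [← ENNReal.mul_iInf_of_ne hx (hwtop _), ← iprod_iInf]
        · congr 2
          ext k
          split_ifs
          · simp
          · exact hinf _ _ hx'
        · intro m k; split_ifs <;> simp [hφ1]
        · intro k m n h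
          dsimp only
          split_ifs
          · exact le_rfl
          · exact hantim _ _ hx' h
    have h2 : ∀ m, _ := fun m => hcount _ (hFm m)
    dsimp only at h2
    simp_rw [h2]
    rw [← lintegral_iInf hFm]
    · simp_rw [← h1]
      refine hcount (fun q => w ‖X q.2 q.1‖ *
        iprod (fun k => if k = q.2 then 1 else φ ‖X q.2 q.1‖ (X k q.1))) ?_
      simp_rw [h1]
      exact Measurable.iInf hFm
    · intro m n h q
      by_cases hx : w ‖X q.2 q.1‖ = 0
      · simp [hx]
      · dsimp only
        gcongr
        refine iprod_mono fun k => ?_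
        split_ifs
        · exact le_rfl
        · exact hantim _ _ (hpos' _ hx) h
    -- Finiteness of the left side is read off from the Mecke formula already known for the
    -- approximation.
    · rw [← h2, step]
      refine ENNReal.mul_ne_top ENNReal.ofReal_ne_top ?_
      exact ((lintegral_mono fun x => mul_le_of_le_one_right' (negExp_le_one _)).trans_lt hR).ne
  rw [hLHS, hRHS]
  simp_rw [step]
  by_cases h0 : ENNReal.ofReal lam = 0
  · simp [h0]
  · rw [ENNReal.mul_iInf_of_ne h0 ENNReal.ofReal_ne_top]

/-- The Mecke formula for a product functional that depends on the marked point through its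
distance to the origin. -/
theorem lintegral_tsum_iprod_norm (hX : IsPoissonProcess μ lam X) (hlam : 0 ≤ lam)
    {φ : ℝ → Plane → ℝ≥0∞} (hφ : Measurable (Function.uncurry φ)) (hφ1 : ∀ z y, φ z y ≤ 1)
    (hanti : ∀ y, AntitoneOn (fun z => φ z y) (Ici 0))
    (hleft : ∀ y z, 0 < z → ∀ u : ℕ → ℝ, Monotone u → (∀ m, 0 ≤ u m ∧ u m < z) →
      Tendsto u atTop (𝓝 z) → ⨅ m, φ (u m) y = φ z y)
    (hpos : ∀ z y, 0 ≤ z → z < ‖y‖ → φ z y ≠ 0)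
    {w : ℝ → ℝ≥0∞} (hw : Measurable w) (hw1 : ∀ r, w r ≤ 1) (hw0 : w 0 = 0) :
    ∫⁻ ω, ∑' j, w ‖X j ω‖ * iprod (fun k => if k = j then 1 else φ ‖X j ω‖ (X k ω)) ∂μ =
      ENNReal.ofReal lam *
        ∫⁻ x : Plane, w ‖x‖ * negExp (ENNReal.ofReal lam * ∫⁻ y, (1 - φ ‖x‖ y)) := by
  -- Bounded truncations increase to `w`, so this last limit is by monotone convergence.
  let v : ℕ → ℝ → ℝ≥0∞ := fun n => (Iio (n : ℝ)).indicator w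
  have hv : ∀ n, Measurable (v n) := fun n => hw.indicator measurableSet_Iio
  have hvmono : ∀ r, Monotone fun n => v n r := fun r m n h =>
    Set.indicator_le_indicator_apply_of_subset (Iio_subset_Iio (Nat.cast_le.2 h)) zero_le
  have hvsup : ∀ r, w r = ⨆ n, v n r := by
    intro r
    refine le_antisymm ?_ (iSup_le fun n => Set.indicator_le_self' (fun _ _ => zero_le) r)
    obtain ⟨n, hn⟩ := exists_nat_gt r
    refine le_iSup_of_le n ?_
    simp [v, hn]
  have hstep := fun n : ℕ => hX.lintegral_tsum_iprod_ball hlam hφ hφ1 hanti hleft hpos (hv n)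
    (fun r => (Set.indicator_le_self' (fun _ _ => zero_le) r).trans (hw1 r))
    (by simp [v, Set.indicator_apply, hw0]) (R := n) (fun r hr => by simp [v, hr])
  have hIm : Measurable fun x : Plane =>
      negExp (ENNReal.ofReal lam * ∫⁻ y, (1 - φ ‖x‖ y)) := by
    refine (measurable_negExp.comp (Measurable.const_mul ?_ _))
    refine Measurable.lintegral_prod_right' (f := fun q : Plane × Plane => 1 - φ ‖q.1‖ q.2) ?_
    exact measurable_const.sub (hφ.comp ((measurable_norm.comp measurable_fst).prodMk
        measurable_snd))
  have hPm : ∀ j, Measurable fun ω =>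
      iprod (fun k => if k = j then 1 else φ ‖X j ω‖ (X k ω)) := fun j => by
    refine measurable_iprod fun k => ?_
    by_cases hkj : k = j
    · simp [hkj]
    · simp only [hkj, if_false]
      exact hφ.comp ((measurable_norm.comp (hX.measurable j)).prodMk (hX.measurable k))
  have hm1 : ∀ n, Measurable fun x : Plane =>
      v n ‖x‖ * negExp (ENNReal.ofReal lam * ∫⁻ y, (1 - φ ‖x‖ y)) := fun n =>
    ((hv n).comp measurable_norm).mul hIm
  have hm2 : ∀ n, Measurable fun ω => ∑' j, v n ‖X j ω‖ *
      iprod (fun k => if k = j then 1 else φ ‖X j ω‖ (X k ω)) := fun n =>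
    Measurable.tsum fun j => ((hv n).comp (measurable_norm.comp (hX.measurable j))).mul (hPm j)
  simp_rw [hvsup, ENNReal.iSup_mul]
  simp_rw [fun ω => tsum_iSup_of_monotone (a := fun n j => v n ‖X j ω‖ *
      iprod (fun k => if k = j then 1 else φ ‖X j ω‖ (X k ω)))
      fun j m n h => mul_le_mul_left (hvmono _ h) _]
  rw [lintegral_iSup hm1 fun m n h x => mul_le_mul_left (hvmono _ h) _, lintegral_iSup hm2
    fun m n h ω => ENNReal.tsum_le_tsum fun j => mul_le_mul_left (hvmono _ h) _, ENNReal.mul_iSup]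
  exact iSup_congr hstep

end IsPoissonProcess

/-! ### Almost sure properties: no point at the origin and no ties in distance. -/

namespace IsPoissonProcess

variable {Ω : Type*} [MeasurableSpace Ω] {μ : Measure Ω} [IsProbabilityMeasure μ] {lam : ℝ}
  {X : ℕ → Ω → Plane}

lemma ae_ne_zero (hX : IsPoissonProcess μ lam X) : ∀ᵐ ω ∂μ, ∀ j, X j ω ≠ 0 := by
  have h := hX.law {0} (measurableSet_singleton 0) (by simp) 0
  have h1 : {ω | pointCount X {0} ω = (0 : ℕ)} ∈ ae μ := by
    rw [mem_ae_iff_prob_eq_one (hX.measurableSet_pointCount (measurableSet_singleton 0) 0), h]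
    simp
  filter_upwards [h1] with ω hω j hj
  have h2 : {j : ℕ | X j ω ∈ ({0} : Set Plane)}.encard = 0 := by simpa [pointCount] using hω
  rw [Set.encard_eq_zero] at h2
  exact Set.eq_empty_iff_forall_notMem.1 h2 j hj

/-- At least two points have probability `1 - exp (-a) (1 + a)`, and `exp (-a) ≥ 1 - a` bounds this
by `a ^ 2`. -/
lemma measure_two_le_pointCount (hX : IsPoissonProcess μ lam X) (hlam : 0 ≤ lam) {B : Set Plane}
    (hB : MeasurableSet B) (hfin : volume B < ∞) :
    μ {ω | ∃ j k, j ≠ k ∧ X j ω ∈ B ∧ X k ω ∈ B} ≤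
      ENNReal.ofReal ((lam * (volume B).toReal) ^ 2) := by
  set a := lam * (volume B).toReal with ha
  have ha0 : 0 ≤ a := by positivity
  have hm := hX.measurableSet_pointCount hB
  have hsub : {ω | ∃ j k, j ≠ k ∧ X j ω ∈ B ∧ X k ω ∈ B} ⊆
      ({ω | pointCount X B ω = (0 : ℕ)} ∪ {ω | pointCount X B ω = (1 : ℕ)})ᶜ := by
    rintro ω ⟨j, k, hjk, hj, hk⟩ (h | h)
    · have h2 : {j : ℕ | X j ω ∈ B}.encard = 0 := by simpa [pointCount] using h
      rw [Set.encard_eq_zero] at h2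
      exact Set.eq_empty_iff_forall_notMem.1 h2 j hj
    · have h2 : {j : ℕ | X j ω ∈ B}.encard = 1 := by simpa [pointCount] using h
      obtain ⟨i, hi⟩ := Set.encard_eq_one.1 h2
      have hj' : j ∈ ({i} : Set ℕ) := hi ▸ hj
      have hk' : k ∈ ({i} : Set ℕ) := hi ▸ hk
      exact hjk (hj'.trans hk'.symm)
  refine (measure_mono hsub).trans ?_
  rw [prob_compl_eq_one_sub ((hm 0).union (hm 1)), measure_union _ (hm 1), hX.law B hB hfin,
    hX.law B hB hfin, ← ha, ← ENNReal.ofReal_add (by positivity) (by positivity),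
    ← ENNReal.ofReal_one, ← ENNReal.ofReal_sub _ (by positivity)]
  · refine ENNReal.ofReal_le_ofReal ?_
    have h1 := Real.add_one_le_exp (-a)
    simp
    nlinarith
  · refine Set.disjoint_left.2 fun ω (h1 : _ = _) (h2 : _ = _) => ?_
    rw [h1] at h2
    exact absurd h2 (by simp)

lemma volume_annulus {a b : ℝ} (ha : 0 ≤ a) (hab : a ≤ b) :
    volume {x : Plane | a ≤ ‖x‖ ^ 2 ∧ ‖x‖ ^ 2 < b} = ENNReal.ofReal (Real.pi * (b - a)) := by
  have hset : {x : Plane | a ≤ ‖x‖ ^ 2 ∧ ‖x‖ ^ 2 < b} =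
      Metric.ball 0 (Real.sqrt b) \ Metric.ball 0 (Real.sqrt a) := by
    ext x
    simp only [mem_ofPred_eq, Set.mem_sdiff, mem_ball_zero_iff, not_lt]
    rw [Real.lt_sqrt (norm_nonneg x), Real.sqrt_le_left (norm_nonneg x), and_comm]
  rw [hset, measure_sdiff (Metric.ball_subset_ball (Real.sqrt_le_sqrt hab))
    measurableSet_ball.nullMeasurableSet (by simp [ENNReal.mul_eq_top])]
  simp only [EuclideanSpace.volume_ball_fin_two]
  rw [← ENNReal.ofReal_pow (Real.sqrt_nonneg _), ← ENNReal.ofReal_pow (Real.sqrt_nonneg _),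
    Real.sq_sqrt (ha.trans hab), Real.sq_sqrt ha, ← ENNReal.ofReal_mul (ha.trans hab),
    ← ENNReal.ofReal_mul ha, ← ENNReal.ofReal_sub _ (by positivity)]
  congr 1
  ring

/-- Almost surely, no two points of a Poisson process are at the same distance from the origin. -/
lemma ae_norm_injective (hX : IsPoissonProcess μ lam X) (hlam : 0 ≤ lam) :
    ∀ᵐ ω ∂μ, ∀ j k, ‖X j ω‖ = ‖X k ω‖ → j = k := by
  have key : ∀ M : ℕ, μ {ω | ∃ j k, j ≠ k ∧ ‖X j ω‖ = ‖X k ω‖ ∧ ‖X j ω‖ ^ 2 < M} = 0 := by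
    intro M
    set C := (lam * (Real.pi * M)) ^ 2 with hC
    have hbound : ∀ n : ℕ, μ {ω | ∃ j k, j ≠ k ∧ ‖X j ω‖ = ‖X k ω‖ ∧ ‖X j ω‖ ^ 2 < M} ≤
        ENNReal.ofReal (C * (1 / ((n : ℝ) + 1))) := by
      intro n
      have hn : (0 : ℝ) < (n : ℝ) + 1 := by positivity
      -- Slicing by squared norm cuts the disc into `n + 1` annuli of equal area. Two equidistant
      -- points share an annulus, which costs at most `C / (n + 1) ^ 2` for each annulus and `C / (n
      -- + 1)` in total.
      let B : ℕ → Set Plane := fun i =>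
        {x | (i : ℝ) * (M / (n + 1)) ≤ ‖x‖ ^ 2 ∧ ‖x‖ ^ 2 < (i + 1 : ℝ) * (M / (n + 1))}
      have hvol : ∀ i, volume (B i) = ENNReal.ofReal (Real.pi * (M / (n + 1))) := fun i => by
        rw [volume_annulus (by positivity) (by gcongr; simp)]
        congr 1; ring
      have hB : ∀ i, MeasurableSet (B i) := fun i => by measurability
      have hsub : {ω | ∃ j k, j ≠ k ∧ ‖X j ω‖ = ‖X k ω‖ ∧ ‖X j ω‖ ^ 2 < M} ⊆
          ⋃ i ∈ Finset.range (n + 1), {ω | ∃ j k, j ≠ k ∧ X j ω ∈ B i ∧ X k ω ∈ B i} := by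
        rintro ω ⟨j, k, hjk, he, hlt⟩
        have hM : (0 : ℝ) < M := lt_of_le_of_lt (by positivity) hlt
        have hs : 0 < (M : ℝ) / (n + 1) := by positivity
        have hi : X j ω ∈ B ⌊‖X j ω‖ ^ 2 / (M / (n + 1))⌋₊ := by
          constructor
          · rw [← le_div_iff₀ hs]; exact Nat.floor_le (by positivity)
          · rw [← div_lt_iff₀ hs]; exact Nat.lt_floor_add_one _
        simp only [mem_iUnion, Finset.mem_range]
        refine ⟨_, ?_, j, k, hjk, hi, ?_⟩
        · rw [Nat.floor_lt (by positivity), div_lt_iff₀ hs]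
          push_cast
          rwa [mul_div_cancel₀ _ hn.ne']
        · simpa only [B, mem_ofPred_eq, he] using hi
      refine (measure_mono hsub).trans ((measure_biUnion_finset_le _ _).trans ?_)
      refine (Finset.sum_le_sum fun i _ => hX.measure_two_le_pointCount hlam (hB i)
        (by rw [hvol]; exact ENNReal.ofReal_lt_top)).trans ?_
      simp_rw [hvol]
      rw [ENNReal.toReal_ofReal (by positivity), Finset.sum_const, Finset.card_range, nsmul_eq_mul,
        ← ENNReal.ofReal_natCast, ← ENNReal.ofReal_mul (by positivity)]
      refine ENNReal.ofReal_le_ofReal (le_of_eq ?_)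
      rw [hC]
      push_cast
      field_simp
    have h1 : Tendsto (fun n : ℕ => C * (1 / ((n : ℝ) + 1))) atTop (𝓝 (C * 0)) :=
      tendsto_one_div_add_atTop_nhds_zero_nat.const_mul C
    have h2 := ge_of_tendsto' (ENNReal.tendsto_ofReal h1) hbound
    simpa using h2
  have h2 : ∀ᵐ ω ∂μ, ∀ M : ℕ, ¬ ∃ j k, j ≠ k ∧ ‖X j ω‖ = ‖X k ω‖ ∧ ‖X j ω‖ ^ 2 < M :=
    ae_all_iff.2 fun M => by
      rw [ae_iff]
      simpa using key M
  filter_upwards [h2] with ω hω j k hjk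
  by_contra hne
  obtain ⟨M, hM⟩ := exists_nat_gt (‖X j ω‖ ^ 2)
  exact hω M ⟨j, k, hne, hjk, hM⟩

end IsPoissonProcess

/-! ## Integration over the marks -/

/-- The exponential tail, which turns a success probability into a Laplace transform. Infinite
interference, `a = ∞`, is included and gives 0. -/
lemma expMeasure_one_setOf_le (a : ℝ≥0∞) : expMeasure 1 {x : ℝ | a ≤ ENNReal.ofReal x} = negExp a
    := by
  have hP : IsProbabilityMeasure (expMeasure 1) := isProbabilityMeasure_expMeasure one_pos
  induction a using ENNReal.recTopCoe with
  | top => simp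
  | coe r =>
    rcases eq_or_ne r 0 with rfl | hr
    · simp
    · have hr' : (0 : ℝ) < r := by
        have := pos_iff_ne_zero.2 hr
        exact_mod_cast this
      have hset : {x : ℝ | (r : ℝ≥0∞) ≤ ENNReal.ofReal x} = Ici (r : ℝ) := by
        ext x
        rw [Set.mem_ofPred_eq, ← ENNReal.ofReal_coe_nnreal, ENNReal.ofReal_le_ofReal_iff' ]
        simp [hr'.not_ge]
      have hna : expMeasure 1 (Ici (r : ℝ)) = expMeasure 1 (Ioi (r : ℝ)) := by
        refine measure_congr (Ioi_ae_eq_Ici' ?_).symm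
        rw [expMeasure, gammaMeasure]
        exact withDensity_absolutelyContinuous _ _ (by simp)
      have hcdf := cdf_expMeasure_eq one_pos (r : ℝ)
      rw [if_pos hr'.le, cdf_eq_real, one_mul] at hcdf
      rw [hset, hna, ← compl_Iic, prob_compl_eq_one_sub measurableSet_Iic,
        ← ENNReal.ofReal_toReal (measure_ne_top (expMeasure 1) (Iic (r : ℝ)))]
      rw [measureReal_def] at hcdf
      rw [hcdf, ← ENNReal.ofReal_one, ← ENNReal.ofReal_sub _ (by simp), sub_sub_cancel,
        ← ENNReal.ofReal_coe_nnreal, negExp_ofReal hr'.le]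

/-- The tilted density is `1 / (1 + u)` times the exponential density of rate `1 + u`. -/
lemma lintegral_negExp_expMeasure_one {u : ℝ≥0∞} (hu : u ≠ ∞) :
    ∫⁻ x, negExp (ENNReal.ofReal x * u) ∂(expMeasure 1) = (1 + u)⁻¹ := by
  lift u to NNReal using hu
  have hr : (0 : ℝ) < 1 + u := by positivity
  have h1 : ∀ x, exponentialPDF 1 x * negExp (ENNReal.ofReal x * u) =
      (1 + (u : ℝ≥0∞))⁻¹ * exponentialPDF (1 + u) x := by
    intro x
    rcases lt_or_ge x 0 with hx | hx
    · simp [exponentialPDF_of_neg hx]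
    · have h2 : ENNReal.ofReal x * u = ENNReal.ofReal (x * u) := by
        rw [ENNReal.ofReal_mul hx]; simp
      have h3 : (1 + (u : ℝ≥0∞))⁻¹ = ENNReal.ofReal (1 + u)⁻¹ := by
        rw [ENNReal.ofReal_inv_of_pos hr, ENNReal.ofReal_add zero_le_one u.coe_nonneg]; simp
      rw [exponentialPDF_of_nonneg hx, exponentialPDF_of_nonneg hx, h2, negExp_ofReal (by
          positivity),
        h3, ← ENNReal.ofReal_mul (by positivity), ← ENNReal.ofReal_mul (by positivity),
        ← mul_assoc, inv_mul_cancel₀ hr.ne', one_mul, one_mul, ← Real.exp_add]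
      congr 2
      ring_nf
  have hm : Measurable fun x : ℝ => exponentialPDF 1 x :=
    (measurable_exponentialPDFReal 1).ennreal_ofReal
  have hm2 : Measurable fun x : ℝ => exponentialPDF (1 + u) x :=
    (measurable_exponentialPDFReal _).ennreal_ofReal
  have h0 : expMeasure 1 = volume.withDensity (exponentialPDF 1) := rfl
  rw [h0, lintegral_withDensity_eq_lintegral_mul _ hm (by fun_prop)]
  simp only [Pi.mul_apply, h1]
  rw [lintegral_const_mul _ hm2, lintegral_exponentialPDF_eq_one hr, mul_one]

section Decoupling

variable {Ω α β : Type*} [MeasurableSpace Ω] [MeasurableSpace α] [MeasurableSpace β]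
  {μ : Measure Ω} [IsProbabilityMeasure μ]

/-- Independent random elements can be integrated one after the other. -/
lemma lintegral_decouple {X : Ω → α} {Y : Ω → β} (hX : Measurable X) (hY : Measurable Y)
    (h : IndepFun X Y μ) {G : α → β → ℝ≥0∞} (hG : Measurable (Function.uncurry G)) :
    ∫⁻ ω, G (X ω) (Y ω) ∂μ = ∫⁻ ω, ∫⁻ ω', G (X ω) (Y ω') ∂μ ∂μ := by
  have h1 := (indepFun_iff_map_prod_eq_prod_map_map hX.aemeasurable hY.aemeasurable).1 h
  have h2 : ∫⁻ ω, G (X ω) (Y ω) ∂μ = ∫⁻ q, Function.uncurry G q ∂(μ.map fun ω => (X ω, Y ω)) := by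
    rw [lintegral_map hG (hX.prodMk hY)]
    rfl
  have := Measure.isProbabilityMeasure_map (μ := μ) hY.aemeasurable
  rw [h2, h1, lintegral_prod _ hG.aemeasurable, lintegral_map hG.lintegral_prod_right' hX]
  refine lintegral_congr fun ω => ?_
  have hG' : Measurable fun y => Function.uncurry G (X ω, y) :=
    hG.comp (measurable_const.prodMk measurable_id)
  rw [lintegral_map hG' hY]
  rfl

end Decoupling

lemma iprod_ite_zero_one (P : ℕ → Prop) [DecidablePred P] [Decidable (∀ k, P k)] :
    iprod (fun k => if P k then 1 else 0) = if (∀ k, P k) then 1 else 0 := by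
  split_ifs with h
  · simp [h, iprod_one]
  · push Not at h
    obtain ⟨k, hk⟩ := h
    rw [iprod_eq_mul_iprod_ne (fun k => by split_ifs <;> simp) k]
    simp [hk]

/-- Independent marks: exponential fading gains `h`, `g` and Bernoulli marks `c`, `a`. -/
structure IsMarking {Ω : Type*} [MeasurableSpace Ω] (μ : Measure Ω) (q r : ℝ≥0∞)
    (h g : ℕ → Ω → ℝ) (c a : ℕ → Ω → Bool) : Prop where
  measurable_h : ∀ k, Measurable (h k)
  measurable_g : ∀ k, Measurable (g k)
  measurable_c : ∀ k, Measurable (c k)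
  measurable_a : ∀ k, Measurable (a k)
  indep_g : ∀ j, IndepFun (fun ω => (fun k => c k ω, fun k => a k ω, fun k => h k ω,
    fun k => if k = j then 0 else g k ω)) (g j) μ
  indep_cah_g : IndepFun (fun ω => (fun k => c k ω, fun k => a k ω, fun k => h k ω))
    (fun ω k => g k ω) μ
  indep_c_ah : IndepFun (fun ω k => c k ω) (fun ω => (fun k => a k ω, fun k => h k ω)) μ
  indep_a_h : IndepFun (fun ω k => a k ω) (fun ω k => h k ω) μ
  iIndep_h : iIndepFun h μ
  iIndep_g : iIndepFun g μ
  iIndep_c : iIndepFun c μ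
  iIndep_a : iIndepFun a μ
  law_h : ∀ k, μ.map (h k) = expMeasure 1
  law_g : ∀ k, μ.map (g k) = expMeasure 1
  law_c : ∀ k, μ {ω | c k ω = true} = q
  law_a : ∀ k, μ {ω | a k ω = true} = r

namespace IsMarking

variable {Ω : Type*} [MeasurableSpace Ω] {μ : Measure Ω} [IsProbabilityMeasure μ] {q r : ℝ≥0∞}
    {h g : ℕ → Ω → ℝ} {c a : ℕ → Ω → Bool}

lemma lintegral_bool {b : Ω → Bool} (hb : Measurable b) (x y : ℝ≥0∞) :
    ∫⁻ ω, (if b ω = true then x else y) ∂μ =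
      x * μ {ω | b ω = true} + y * (1 - μ {ω | b ω = true}) := by
  have hs : MeasurableSet {ω | b ω = true} := hb (measurableSet_singleton true)
  have h1 : ∀ ω, (if b ω = true then x else y) = {ω | b ω = true}.indicator (fun _ => x) ω +
      {ω | b ω = true}ᶜ.indicator (fun _ => y) ω := by
    intro ω
    by_cases hω : b ω = true <;> simp [hω]
  simp_rw [h1]
  rw [lintegral_add_left (measurable_const.indicator hs), lintegral_indicator hs,
    lintegral_indicator hs.compl, setLIntegral_const, setLIntegral_const, prob_compl_eq_one_sub hs]

lemma lintegral_fading {x : Ω → ℝ} (hx : Measurable x) (hlaw : μ.map x = expMeasure 1) {u : ℝ≥0∞}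
    (hu : u ≠ ∞) : ∫⁻ ω, negExp (ENNReal.ofReal (x ω) * u) ∂μ = (1 + u)⁻¹ := by
  rw [← lintegral_negExp_expMeasure_one hu, ← hlaw, lintegral_map (by fun_prop) hx]

/-- Indicator that point `j` carries the mark and that all points with the mark satisfy `Q`. -/
def markIndicator (Q : ℕ → Prop) [DecidablePred Q] (j : ℕ) (c : ℕ → Bool) : ℝ≥0∞ :=
  iprod fun k => if (k = j → c k = true) ∧ (c k = true → Q k) then 1 else 0

/-- Normalized noise plus interference at the user when it is served by point `j`. -/
def markLoad (t : ℝ≥0∞) (u v : ℕ → ℝ≥0∞) (j : ℕ) (a : ℕ → Bool) (h g : ℕ → ℝ) : ℝ≥0∞ :=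
  t + (∑' i, ENNReal.ofReal (h i) * u i) +
    ∑' k, if k ≠ j ∧ a k = true then ENNReal.ofReal (g k) * v k else 0

/-- Laplace factor of the first family of interferers. -/
def macroFactor (u : ℕ → ℝ≥0∞) (h : ℕ → ℝ) : ℝ≥0∞ :=
  iprod fun i => negExp (ENNReal.ofReal (h i) * u i)

/-- Laplace factor of the second family of interferers. -/
def activeFactor (v : ℕ → ℝ≥0∞) (j : ℕ) (a : ℕ → Bool) (g : ℕ → ℝ) : ℝ≥0∞ :=
  iprod fun k => if k ≠ j ∧ a k = true then negExp (ENNReal.ofReal (g k) * v k) else 1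

/-- The factor `activeFactor` integrated over the fading. -/
def meanActiveFactor (v : ℕ → ℝ≥0∞) (j : ℕ) (a : ℕ → Bool) : ℝ≥0∞ :=
  iprod fun k => if k ≠ j ∧ a k = true then (1 + v k)⁻¹ else 1

lemma measurable_markIndicator (Q : ℕ → Prop) [DecidablePred Q] (j : ℕ) :
    Measurable (markIndicator Q j) :=
  measurable_iprod fun k => (measurable_of_countable fun b : Bool =>
    (if (k = j → b = true) ∧ (b = true → Q k) then 1 else 0 : ℝ≥0∞)).comp (measurable_pi_apply k)

lemma measurable_markLoad (t : ℝ≥0∞) (u v : ℕ → ℝ≥0∞) (j : ℕ) :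
    Measurable fun x : (ℕ → Bool) × (ℕ → ℝ) × (ℕ → ℝ) => markLoad t u v j x.1 x.2.1 x.2.2 := by
  refine Measurable.add (Measurable.add measurable_const (Measurable.tsum fun i => by fun_prop))
    (Measurable.tsum fun k => ?_)
  refine Measurable.ite ?_ (by fun_prop) measurable_const
  by_cases hk : k = j
  · simp [hk]
  · simp only [ne_eq, hk, not_false_eq_true, true_and]
    exact measurableSet_eq_fun (by fun_prop) measurable_const

lemma measurable_macroFactor (u : ℕ → ℝ≥0∞) : Measurable (macroFactor u) :=
  measurable_iprod fun k => by fun_prop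

lemma measurable_activeFactor (v : ℕ → ℝ≥0∞) (j : ℕ) :
    Measurable (Function.uncurry (activeFactor v j)) := by
  refine measurable_iprod fun k => Measurable.ite ?_ (by fun_prop) measurable_const
  by_cases hk : k = j
  · simp [hk]
  · simp only [ne_eq, hk, not_false_eq_true, true_and]
    exact measurableSet_eq_fun (by fun_prop) measurable_const

lemma measurable_meanActiveFactor (v : ℕ → ℝ≥0∞) (j : ℕ) : Measurable (meanActiveFactor v j) :=
  measurable_iprod fun k => (measurable_of_countable fun b : Bool =>
    (if k ≠ j ∧ b = true then (1 + v k)⁻¹ else 1 : ℝ≥0∞)).comp (measurable_pi_apply k)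

/-- The load does not see the gain of the serving point, so it is a function of the marks with that
gain zeroed, which `indep_g` makes independent of `g j`. -/
lemma markLoad_congr (t : ℝ≥0∞) (u v : ℕ → ℝ≥0∞) (j : ℕ) (a : ℕ → Bool) (h g : ℕ → ℝ) :
    markLoad t u v j a h (fun k => if k = j then 0 else g k) = markLoad t u v j a h g := by
  unfold markLoad
  congr 2
  ext k
  by_cases hk : k = j <;> simp [hk]

lemma negExp_markLoad (t : ℝ≥0∞) (u v : ℕ → ℝ≥0∞) (j : ℕ) (a : ℕ → Bool) (h g : ℕ → ℝ) :
    negExp (markLoad t u v j a h g) = negExp t * macroFactor u h * activeFactor v j a g := by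
  rw [markLoad, negExp_add, negExp_add, negExp_tsum, negExp_tsum, macroFactor, activeFactor]
  congr 2
  ext k
  split_ifs <;> simp

/-- The association condition is a product with one factor per point, so independence of the caching
marks can be used factor by factor. -/
lemma markIndicator_eq (Q : ℕ → Prop) [DecidablePred Q] (j : ℕ) (c : ℕ → Bool)
    [Decidable (c j = true ∧ ∀ k, c k = true → Q k)] :
    markIndicator Q j c = if c j = true ∧ ∀ k, c k = true → Q k then 1 else 0 := by
  classical
  have : (∀ k, (k = j → c k = true) ∧ (c k = true → Q k)) ↔
      (c j = true ∧ ∀ k, c k = true → Q k) :=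
    ⟨fun H => ⟨(H j).1 rfl, fun k => (H k).2⟩, fun H k => ⟨fun hk => hk ▸ H.1, H.2 k⟩⟩
  rw [markIndicator, iprod_ite_zero_one]
  simp only [this]

lemma inv_one_add_le_one (x : ℝ≥0∞) : (1 + x)⁻¹ ≤ 1 := ENNReal.inv_le_one.2 le_self_add

lemma lintegral_macroFactor (hM : IsMarking μ q r h g c a) {u : ℕ → ℝ≥0∞} (hu : ∀ i, u i ≠ ∞) :
    ∫⁻ ω, macroFactor u (fun k => h k ω) ∂μ = iprod (fun i => (1 + u i)⁻¹) := by
  have hhm := hM.measurable_h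
  have hind : iIndepFun (fun k ω => negExp (ENNReal.ofReal (h k ω) * u k)) μ :=
    hM.iIndep_h.comp (fun k x => negExp (ENNReal.ofReal x * u k)) fun k => by fun_prop
  unfold macroFactor
  rw [lintegral_iprod_of_iIndepFun μ (fun k => by fun_prop) (fun k ω => negExp_le_one _) hind]
  congr 1
  ext k
  exact lintegral_fading (hhm k) (hM.law_h k) (hu k)

lemma lintegral_activeFactor (hM : IsMarking μ q r h g c a) {v : ℕ → ℝ≥0∞} (hv : ∀ i, v i ≠ ∞)
    (j : ℕ) (b : ℕ → Bool) :
    ∫⁻ ω, activeFactor v j b (fun k => g k ω) ∂μ = meanActiveFactor v j b := by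
  have hgm := hM.measurable_g
  have hind : iIndepFun (fun k ω' => if k ≠ j ∧ b k = true then
      negExp (ENNReal.ofReal (g k ω') * v k) else 1) μ :=
    hM.iIndep_g.comp (fun k x => if k ≠ j ∧ b k = true then
      negExp (ENNReal.ofReal x * v k) else 1) fun k => by split_ifs <;> fun_prop
  unfold activeFactor meanActiveFactor
  rw [lintegral_iprod_of_iIndepFun μ (fun k => ?_) (fun k ω' => ?_) hind]
  · congr 1
    ext k
    split_ifs
    · exact lintegral_fading (hgm k) (hM.law_g k) (hv k)
    · simp
  · split_ifs <;> fun_prop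
  · split_ifs
    · exact negExp_le_one _
    · exact le_rfl

lemma lintegral_meanActiveFactor (hM : IsMarking μ q r h g c a) (v : ℕ → ℝ≥0∞) (j : ℕ) :
    ∫⁻ ω, meanActiveFactor v j (fun k => a k ω) ∂μ =
      iprod (fun k => if k = j then 1 else ((1 + v k)⁻¹ * r + (1 - r))) := by
  have ham := hM.measurable_a
  have hind : iIndepFun (fun k ω => (if k ≠ j ∧ a k ω = true then (1 + v k)⁻¹ else 1 : ℝ≥0∞)) μ :=
    hM.iIndep_a.comp (fun k b => (if k ≠ j ∧ b = true then (1 + v k)⁻¹ else 1 : ℝ≥0∞))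
      fun k => measurable_of_countable _
  unfold meanActiveFactor
  rw [lintegral_iprod_of_iIndepFun μ (fun k => ?_) (fun k ω => ?_) hind]
  · congr 1
    ext k
    by_cases hk : k = j
    · simp [hk]
    · simp only [ne_eq, hk, not_false_eq_true, true_and, if_false]
      rw [lintegral_bool (ham k), hM.law_a, one_mul]
  · exact (measurable_of_countable fun b : Bool =>
      (if k ≠ j ∧ b = true then (1 + v k)⁻¹ else 1 : ℝ≥0∞)).comp (ham k)
  · split_ifs <;> simp

/-- Point `j` must carry the mark, which gives `q`; any other point is unconstrained if it satisfies
`Q` and must be unmarked otherwise. -/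
lemma lintegral_markIndicator (hM : IsMarking μ q r h g c a) {Q : ℕ → Prop} [DecidablePred Q]
    {j : ℕ} (hQ : Q j) :
    ∫⁻ ω, markIndicator Q j (fun k => c k ω) ∂μ =
      q * iprod (fun k => if k = j then 1 else (if Q k then 1 else 1 - q)) := by
  have hcm := hM.measurable_c
  have hind : iIndepFun (fun k ω =>
      (if (k = j → c k ω = true) ∧ (c k ω = true → Q k) then 1 else 0 : ℝ≥0∞)) μ :=
    hM.iIndep_c.comp (fun k b => (if (k = j → b = true) ∧ (b = true → Q k) then 1 else 0 : ℝ≥0∞))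
      fun k => measurable_of_countable _
  unfold markIndicator
  rw [lintegral_iprod_of_iIndepFun μ (fun k => ?_) (fun k ω => ?_) hind,
    iprod_eq_mul_iprod_ne (fun k => ?_) j]
  · congr 1
    · trans ∫⁻ ω, (if c j ω = true then 1 else 0) ∂μ
      · exact lintegral_congr fun ω => by simp [hQ]
      rw [lintegral_bool (hcm j), hM.law_c]
      simp
    · congr 1
      ext k
      by_cases hk : k = j
      · simp [hk]
      · simp only [hk, if_false, false_imp_iff, true_and]
        by_cases hQk : Q k
        · simp [hQk]
        · simp only [hQk, imp_false, if_false]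
          trans ∫⁻ ω, (if c k ω = true then 0 else 1) ∂μ
          · exact lintegral_congr fun ω => by split_ifs <;> simp_all
          rw [lintegral_bool (hcm k), hM.law_c]
          simp
  · refine (lintegral_mono (g := fun _ => 1) fun ω => ?_).trans (by simp)
    dsimp only
    split_ifs <;> simp
  · exact (measurable_of_countable fun b : Bool =>
      (if (k = j → b = true) ∧ (b = true → Q k) then 1 else 0 : ℝ≥0∞)).comp (hcm k)
  · split_ifs <;> simp

/-- Given all other marks, the event is a tail event of the exponential variable `g j`, independent
of them. -/
lemma lintegral_indicator_mul_load (hM : IsMarking μ q r h g c a) (j : ℕ) (Q : ℕ → Prop)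
    [DecidablePred Q] (t : ℝ≥0∞) (u v : ℕ → ℝ≥0∞) :
    ∫⁻ ω, markIndicator Q j (fun k => c k ω) *
      (if markLoad t u v j (fun k => a k ω) (fun k => h k ω) (fun k => g k ω) ≤
        ENNReal.ofReal (g j ω) then 1 else 0) ∂μ =
      ∫⁻ ω, markIndicator Q j (fun k => c k ω) *
        negExp (markLoad t u v j (fun k => a k ω) (fun k => h k ω) (fun k => g k ω)) ∂μ := by
  have hgm := hM.measurable_g
  have hhm := hM.measurable_h
  have ham := hM.measurable_a
  have hcm := hM.measurable_c
  have hX : Measurable fun ω => ((fun k => c k ω, fun k => a k ω, fun k => h k ω,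
      fun k => if k = j then 0 else g k ω) :
      (ℕ → Bool) × (ℕ → Bool) × (ℕ → ℝ) × (ℕ → ℝ)) := by
    refine Measurable.prodMk (by fun_prop) (Measurable.prodMk (by fun_prop)
      (Measurable.prodMk (by fun_prop) (measurable_pi_iff.2 fun k => ?_)))
    by_cases hk : k = j
    · simp [hk]
    · simpa [hk] using hgm k
  have hD : MeasurableSet {y : ((ℕ → Bool) × (ℕ → Bool) × (ℕ → ℝ) × (ℕ → ℝ)) × ℝ |
      markLoad t u v j y.1.2.1 y.1.2.2.1 y.1.2.2.2 ≤ ENNReal.ofReal y.2} :=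
    measurableSet_le ((measurable_markLoad t u v j).comp (measurable_snd.comp measurable_fst))
      (by fun_prop)
  have hG : Measurable (Function.uncurry
      fun (x : (ℕ → Bool) × (ℕ → Bool) × (ℕ → ℝ) × (ℕ → ℝ)) (y : ℝ) =>
        markIndicator Q j x.1 *
        (if markLoad t u v j x.2.1 x.2.2.1 x.2.2.2 ≤ ENNReal.ofReal y then (1 : ℝ≥0∞) else 0)) :=
    ((measurable_markIndicator Q j).comp (measurable_fst.comp measurable_fst)).mul
      (Measurable.ite hD measurable_const measurable_const)
  have h0 := lintegral_decouple hX (hgm j) (hM.indep_g j) hG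
  simp only [markLoad_congr] at h0
  rw [h0]
  refine lintegral_congr fun ω => ?_
  set b := markLoad t u v j (fun k => a k ω) (fun k => h k ω) (fun k => g k ω)
  have hs : MeasurableSet {x : ℝ | b ≤ ENNReal.ofReal x} :=
    measurableSet_le measurable_const (by fun_prop)
  have hsm : Measurable fun ω' => (if b ≤ ENNReal.ofReal (g j ω') then 1 else 0 : ℝ≥0∞) :=
    Measurable.ite (hgm j hs) measurable_const measurable_const
  rw [lintegral_const_mul _ hsm, ← expMeasure_one_setOf_le, ← hM.law_g j,
    Measure.map_apply (hgm j) hs, ← lintegral_indicator_one (hgm j hs)]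
  exact congrArg _ (lintegral_congr fun x => by simp [Set.indicator_apply])

/-- The fading of the second family is integrated out with the caching, activity and macro fading
marks held fixed. -/
lemma lintegral_indicator_mul_negExp (hM : IsMarking μ q r h g c a) (j : ℕ) (Q : ℕ → Prop)
    [DecidablePred Q] (t : ℝ≥0∞) (u : ℕ → ℝ≥0∞) {v : ℕ → ℝ≥0∞} (hv : ∀ i, v i ≠ ∞) :
    ∫⁻ ω, markIndicator Q j (fun k => c k ω) *
        negExp (markLoad t u v j (fun k => a k ω) (fun k => h k ω) (fun k => g k ω)) ∂μ =
      ∫⁻ ω, markIndicator Q j (fun k => c k ω) *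
        (meanActiveFactor v j (fun k => a k ω) * macroFactor u (fun k => h k ω)) * negExp t ∂μ := by
  have hgm := hM.measurable_g
  have hhm := hM.measurable_h
  have ham := hM.measurable_a
  have hcm := hM.measurable_c
  have hX : Measurable fun ω => ((fun k => c k ω, fun k => a k ω, fun k => h k ω) :
      (ℕ → Bool) × (ℕ → Bool) × (ℕ → ℝ)) := by fun_prop
  obtain ⟨F, hF⟩ : ∃ F : (ℕ → Bool) × (ℕ → Bool) × (ℕ → ℝ) → ℝ≥0∞, ∀ x,
      F x = markIndicator Q j x.1 * negExp t * macroFactor u x.2.2 := ⟨_, fun _ => rfl⟩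
  obtain ⟨A, hA⟩ : ∃ A : (ℕ → Bool) → (ℕ → ℝ) → ℝ≥0∞, A = activeFactor v j := ⟨_, rfl⟩
  have hFm : Measurable F := by
    rw [funext hF]
    exact (((measurable_markIndicator Q j).comp measurable_fst).mul measurable_const).mul
      ((measurable_macroFactor u).comp (measurable_snd.comp measurable_snd))
  have hAm : Measurable (Function.uncurry A) := hA ▸ measurable_activeFactor v j
  have hG : Measurable (Function.uncurry
      fun (x : (ℕ → Bool) × (ℕ → Bool) × (ℕ → ℝ)) (y : ℕ → ℝ) => F x * A x.2.1 y) :=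
    (hFm.comp measurable_fst).mul (hAm.comp
      ((measurable_fst.comp (measurable_snd.comp measurable_fst)).prodMk measurable_snd))
  have h0 := lintegral_decouple hX (measurable_pi_iff.2 hgm) hM.indep_cah_g hG
  have h1 : ∀ ω, markIndicator Q j (fun k => c k ω) *
      negExp (markLoad t u v j (fun k => a k ω) (fun k => h k ω) (fun k => g k ω)) =
      F (fun k => c k ω, fun k => a k ω, fun k => h k ω) *
        A (fun k => a k ω) (fun k => g k ω) := fun ω => by
    rw [negExp_markLoad, hF, hA, ← mul_assoc, ← mul_assoc]
  rw [lintegral_congr h1, h0]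
  refine lintegral_congr fun ω => ?_
  have hK : Measurable fun ω' => A (fun k => a k ω) (fun k => g k ω') :=
    hAm.comp (measurable_const.prodMk (measurable_pi_iff.2 hgm))
  rw [lintegral_const_mul _ hK, hA, hM.lintegral_activeFactor hv, hF, mul_assoc, mul_assoc,
    mul_comm (negExp t), mul_comm (macroFactor _ _), ← mul_assoc]

/-- The probability, over the marks, of a successful transmission from point `j`. -/
theorem measure_success (hM : IsMarking μ q r h g c a) (j : ℕ) {Q : ℕ → Prop} (hQ : Q j)
    (t : ℝ≥0∞) {u v : ℕ → ℝ≥0∞} (hu : ∀ i, u i ≠ ∞) (hv : ∀ i, v i ≠ ∞) [DecidablePred Q] :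
    μ {ω | (c j ω = true ∧ (∀ k, c k ω = true → Q k)) ∧
      markLoad t u v j (fun k => a k ω) (fun k => h k ω) (fun k => g k ω) ≤
        ENNReal.ofReal (g j ω)} =
      q * negExp t * iprod (fun i => (1 + u i)⁻¹) *
        iprod (fun k => if k = j then 1 else
          (if Q k then 1 else 1 - q) * ((1 + v k)⁻¹ * r + (1 - r))) := by
  classical
  have hgm := hM.measurable_g
  have hhm := hM.measurable_h
  have ham := hM.measurable_a
  have hcm := hM.measurable_c
  set E := {ω | (c j ω = true ∧ (∀ k, c k ω = true → Q k)) ∧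
      markLoad t u v j (fun k => a k ω) (fun k => h k ω) (fun k => g k ω) ≤
        ENNReal.ofReal (g j ω)} with hE
  have hevent : ∀ ω, E.indicator (fun _ => (1 : ℝ≥0∞)) ω =
      markIndicator Q j (fun k => c k ω) *
      (if markLoad t u v j (fun k => a k ω) (fun k => h k ω) (fun k => g k ω) ≤
        ENNReal.ofReal (g j ω) then 1 else 0) := by
    intro ω
    rw [markIndicator_eq]
    by_cases h1 : c j ω = true ∧ ∀ k, c k ω = true → Q k
    · rw [if_pos h1, one_mul]
      simp only [hE, Set.indicator_apply, mem_ofPred_eq]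
      exact if_congr (and_iff_right h1) rfl rfl
    · simp [hE, h1]
  have hBm : Measurable fun ω => markIndicator Q j (fun k => c k ω) :=
    (measurable_markIndicator Q j).comp (by fun_prop)
  have hAm : Measurable fun ω => meanActiveFactor v j (fun k => a k ω) :=
    (measurable_meanActiveFactor v j).comp (by fun_prop)
  have hLm : Measurable fun ω => macroFactor u (fun k => h k ω) :=
    (measurable_macroFactor u).comp (by fun_prop)
  have hTm : Measurable fun ω =>
      markLoad t u v j (fun k => a k ω) (fun k => h k ω) (fun k => g k ω) :=
    (measurable_markLoad t u v j).comp (f := fun ω => (fun k => a k ω, fun k => h k ω,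
      fun k => g k ω)) (by fun_prop)
  have hEm : MeasurableSet E := by
    rw [← measurable_indicator_const_iff (1 : ℝ≥0∞)]
    have h1 : Measurable fun ω => (if markLoad t u v j (fun k => a k ω) (fun k => h k ω)
        (fun k => g k ω) ≤ ENNReal.ofReal (g j ω) then 1 else 0 : ℝ≥0∞) :=
      Measurable.ite (measurableSet_le hTm (hgm j).ennreal_ofReal) measurable_const measurable_const
    rw [show (E.indicator fun _ => (1 : ℝ≥0∞)) = _ from funext hevent]
    exact hBm.mul h1
  have h1 : IndepFun (fun ω => meanActiveFactor v j (fun k => a k ω))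
      (fun ω => macroFactor u (fun k => h k ω)) μ :=
    hM.indep_a_h.comp (measurable_meanActiveFactor v j) (measurable_macroFactor u)
  have h2 : IndepFun (fun ω => markIndicator Q j (fun k => c k ω))
      (fun ω => meanActiveFactor v j (fun k => a k ω) * macroFactor u (fun k => h k ω)) μ :=
    hM.indep_c_ah.comp (ψ := fun x : (ℕ → Bool) × (ℕ → ℝ) => meanActiveFactor v j x.1 * macroFactor
        u x.2)
      (measurable_markIndicator Q j) (((measurable_meanActiveFactor v j).comp measurable_fst).mul
        ((measurable_macroFactor u).comp measurable_snd))
  have h3 := lintegral_mul_eq_lintegral_mul_lintegral_of_indepFun hAm hLm h1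
  have h4 := lintegral_mul_eq_lintegral_mul_lintegral_of_indepFun hBm (hAm.mul hLm) h2
  simp only [Pi.mul_apply] at h3 h4
  have hr : r ≤ 1 := by rw [← hM.law_a j]; exact prob_le_one
  -- Each point contributes through association and through interference; since the caching and
  -- activity marks are independent, its joint factor is the product of the two.
  have h5 : iprod (fun k => if k = j then 1 else
      (if Q k then 1 else 1 - q) * ((1 + v k)⁻¹ * r + (1 - r))) =
      iprod (fun k => if k = j then 1 else (if Q k then 1 else 1 - q)) *
      iprod (fun k => if k = j then 1 else ((1 + v k)⁻¹ * r + (1 - r))) := by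
    rw [← iprod_mul]
    · congr 1
      ext k
      by_cases hk : k = j <;> simp [hk]
    · intro k; split_ifs <;> simp
    · intro k
      split_ifs
      · exact le_rfl
      · calc (1 + v k)⁻¹ * r + (1 - r) ≤ 1 * r + (1 - r) := by
              gcongr; exact inv_one_add_le_one _
          _ = 1 := by rw [one_mul, add_tsub_cancel_of_le hr]
  rw [← lintegral_indicator_one hEm]
  have hm : Measurable fun ω => markIndicator Q j (fun k => c k ω) *
      (meanActiveFactor v j (fun k => a k ω) * macroFactor u (fun k => h k ω)) :=
    hBm.mul (hAm.mul hLm)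
  rw [show ∫⁻ ω, E.indicator 1 ω ∂μ = _ from lintegral_congr hevent,
    hM.lintegral_indicator_mul_load j Q t u v, hM.lintegral_indicator_mul_negExp j Q t u hv,
    lintegral_mul_const _ hm, h4, h3, hM.lintegral_macroFactor hu,
    hM.lintegral_meanActiveFactor, hM.lintegral_markIndicator hQ, h5]
  ring

end IsMarking

/-! ## Radial integrals -/

/-- Integration in polar coordinates of a radial function on the plane. -/
lemma lintegral_fun_norm {f : ℝ → ℝ≥0∞} (hf : Measurable f) :
    ∫⁻ x : Plane, f ‖x‖ = ∫⁻ r in Ioi (0 : ℝ), ENNReal.ofReal (2 * Real.pi * r) * f r := by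
  have hdim : Module.finrank ℝ Plane = 2 := by simp
  have hball : (volume : Measure Plane).toSphere univ = ENNReal.ofReal (2 * Real.pi) := by
    rw [Measure.toSphere_apply_univ, hdim, EuclideanSpace.volume_ball_fin_two,
      ENNReal.ofReal_mul two_pos.le]
    simp
  have hfs : Measurable fun r : Ioi (0 : ℝ) => f r := hf.comp measurable_subtype_coe
  have hfp : Measurable fun x : Metric.sphere (0 : Plane) 1 × Ioi (0 : ℝ) => f x.2 :=
    hfs.comp measurable_snd
  calc ∫⁻ x : Plane, f ‖x‖
      = ∫⁻ x : ({(0)}ᶜ : Set Plane), f ‖x.1‖ ∂((volume : Measure Plane).comap Subtype.val) := by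
        rw [lintegral_subtype_comap (measurableSet_singleton _).compl fun x => f ‖x‖,
          MeasureTheory.restrict_compl_singleton]
    _ = ∫⁻ x, f x.2 ∂((volume : Measure Plane).toSphere.prod
          (.volumeIoiPow (Module.finrank ℝ Plane - 1))) := by
        rw [← (volume : Measure Plane).measurePreserving_homeomorphUnitSphereProd.lintegral_comp
          hfp]
        simp
    _ = (volume : Measure Plane).toSphere univ *
          ∫⁻ x : Ioi (0 : ℝ), f x ∂(.volumeIoiPow (Module.finrank ℝ Plane - 1)) := by
        rw [lintegral_prod _ hfp.aemeasurable]
        simp [mul_comm]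
    _ = _ := by
        rw [hball, hdim, Measure.volumeIoiPow, lintegral_withDensity_eq_lintegral_mul _ (by
            fun_prop) hfs]
        simp only [Pi.mul_apply]
        rw [lintegral_subtype_comap measurableSet_Ioi fun r => ENNReal.ofReal (r ^ (2 - 1)) * f r,
          ← lintegral_const_mul]
        · refine lintegral_congr fun r => ?_
          rw [← mul_assoc, ← ENNReal.ofReal_mul (by positivity)]
          norm_num
        · exact (ENNReal.measurable_ofReal.comp (measurable_id.pow_const _)).mul hf

/-! ### Change of variables from the distance to the relative received power. -/

section Substitution

variable {α c : ℝ}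

lemma div_rpow_inv_rpow {t : ℝ} (hα : 0 < α) (hc : 0 < c) (ht : 0 < t) :
    (c / (c * t ^ (-α⁻¹))) ^ α = t := by
  rw [div_mul_cancel_left₀ hc.ne', ← Real.rpow_neg ht.le, ← Real.rpow_mul ht.le, neg_neg,
    inv_mul_cancel₀ hα.ne', Real.rpow_one]

lemma mul_rpow_inv_div {r : ℝ} (hα : 0 < α) (hc : 0 < c) (hr : 0 < r) :
    c * ((c / r) ^ α) ^ (-α⁻¹) = r := by
  rw [← Real.rpow_mul (by positivity), mul_neg, mul_inv_cancel₀ hα.ne', Real.rpow_neg_one]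
  field_simp

/-- The substitution `t = (c / r) ^ α`. -/
lemma lintegral_image_rpow (hα : 0 < α) (hc : 0 < c) {s : Set ℝ} (hs : MeasurableSet s)
    (hs0 : s ⊆ Ioi 0) (g : ℝ → ℝ≥0∞) :
    ∫⁻ r in (fun t => c * t ^ (-α⁻¹)) '' s, ENNReal.ofReal (2 * Real.pi * r) * g ((c / r) ^ α) =
      ∫⁻ t in s, ENNReal.ofReal (2 * Real.pi * c ^ 2 / α * t ^ (-(2 / α) - 1)) * g t := by
  rw [lintegral_image_eq_lintegral_abs_deriv_mul hs (f' := fun t => c * (-α⁻¹ * t ^ (-α⁻¹ - 1)))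
    (fun t ht => ((Real.hasDerivAt_rpow_const (Or.inl (ne_of_gt (hs0 ht)))).const_mul
      c).hasDerivWithinAt)]
  · refine setLIntegral_congr_fun hs fun t ht => ?_
    have ht' : 0 < t := hs0 ht
    rw [div_rpow_inv_rpow hα hc ht', ← mul_assoc, ← ENNReal.ofReal_mul (abs_nonneg _)]
    congr 2
    rw [abs_mul, abs_mul, abs_of_pos hc, abs_neg, abs_of_pos (inv_pos.2 hα),
      abs_of_pos (Real.rpow_pos_of_pos ht' _),
      show -(2 / α) - 1 = (-α⁻¹ - 1) + (-α⁻¹) by ring, Real.rpow_add ht']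
    ring
  · intro t ht u hu htu
    have h := congrArg (fun r => (c / r) ^ α) htu
    simpa only [div_rpow_inv_rpow hα hc (hs0 ht), div_rpow_inv_rpow hα hc (hs0 hu)] using h

lemma image_rpow_Ioi (hα : 0 < α) (hc : 0 < c) :
    (fun t => c * t ^ (-α⁻¹)) '' Ioi 0 = Ioi (0 : ℝ) := by
  ext r
  constructor
  · rintro ⟨t, ht, rfl⟩
    exact mul_pos hc (Real.rpow_pos_of_pos ht _)
  · intro hr
    have hr' : 0 < r := hr
    exact ⟨(c / r) ^ α, Real.rpow_pos_of_pos (by positivity) _, mul_rpow_inv_div hα hc hr⟩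

/-- Stations beyond the exclusion radius are those of relative power at most 1. -/
lemma image_rpow_Ioc (hα : 0 < α) (hc : 0 < c) :
    (fun t => c * t ^ (-α⁻¹)) '' Ioc 0 1 = Ici c := by
  ext r
  constructor
  · rintro ⟨t, ht, rfl⟩
    refine le_mul_of_one_le_right hc.le ?_
    exact Real.one_le_rpow_of_pos_of_le_one_of_nonpos ht.1 ht.2 (by simp [hα.le])
  · intro hr
    have hr' : 0 < r := hc.trans_le hr
    refine ⟨(c / r) ^ α, ⟨Real.rpow_pos_of_pos (by positivity) _, ?_⟩, mul_rpow_inv_div hα hc hr'⟩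
    exact Real.rpow_le_one (by positivity) ((div_le_one hr').2 hr) hα.le

end Substitution

/-- The loss `1 - 1 / (1 + δ t)` in the Laplace transform of an interferer at relative power `t`. -/
def loss (δ t : ℝ) : ℝ≥0∞ := ENNReal.ofReal (δ * t / (1 + δ * t))

@[fun_prop] lemma measurable_loss (δ : ℝ) : Measurable (loss δ) := by
  unfold loss
  fun_prop

lemma lintegral_Ioi_rpow_mul_exp {a s : ℝ} (ha : 0 < a) (hs : 0 < s) :
    ∫⁻ t in Ioi (0 : ℝ), ENNReal.ofReal (t ^ (a - 1) * Real.exp (-(s * t))) =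
      ENNReal.ofReal ((1 / s) ^ a * Real.Gamma a) := by
  rw [← Real.integral_rpow_mul_exp_neg_mul_Ioi ha hs, ofReal_integral_eq_lintegral_ofReal]
  · have h := integrableOn_rpow_mul_exp_neg_mul_rpow (p := 1) (s := a - 1) (b := s) (by linarith)
      one_pos hs
    simpa [IntegrableOn] using h
  · filter_upwards [ae_restrict_mem measurableSet_Ioi] with t ht
    have : 0 < t := ht
    positivity

/-- Write `1 / (1 + δ t)` as the integral of `exp (-(1 + δ t) u)` over `u > 0` and exchange the
integrals. The `t` integral gives `Gamma (1 - p)`, which uses `p < 1`; the remaining `u` integral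
gives `Gamma p`. -/
lemma lintegral_rpow_mul_loss {δ p : ℝ} (hδ : 0 ≤ δ) (hp : 0 < p) (hp1 : p < 1) :
    ∫⁻ t in Ioi (0 : ℝ), ENNReal.ofReal (t ^ (-p - 1)) * loss δ t =
      ENNReal.ofReal (δ ^ p * (Real.Gamma p * Real.Gamma (1 - p))) := by
  rcases hδ.eq_or_lt with rfl | hδ
  · simp [loss, Real.zero_rpow hp.ne']
  have h1 : ∀ t ∈ Ioi (0 : ℝ), ENNReal.ofReal (t ^ (-p - 1)) * loss δ t =
      ∫⁻ u in Ioi (0 : ℝ), ENNReal.ofReal (δ * t ^ (-p) * Real.exp (-u) * Real.exp (-(δ * u * t)))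
          := by
    intro t ht
    have ht' : 0 < t := ht
    have hs : 0 < 1 + δ * t := by positivity
    have h2 := lintegral_Ioi_rpow_mul_exp (a := 1) one_pos hs
    simp only [sub_self, Real.rpow_zero, one_mul, Real.Gamma_one, mul_one, Real.rpow_one] at h2
    have h3 : ∀ u, ENNReal.ofReal (δ * t ^ (-p) * Real.exp (-u) * Real.exp (-(δ * u * t))) =
        ENNReal.ofReal (δ * t ^ (-p)) * ENNReal.ofReal (Real.exp (-((1 + δ * t) * u))) := by
      intro u
      rw [← ENNReal.ofReal_mul (by positivity), mul_assoc, ← Real.exp_add]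
      congr 3
      ring
    simp_rw [h3]
    rw [lintegral_const_mul _ (by fun_prop), h2, loss, ← ENNReal.ofReal_mul (by positivity),
      ← ENNReal.ofReal_mul (by positivity), show -p - 1 = -p + -1 by ring, Real.rpow_add ht',
      Real.rpow_neg_one]
    congr 1
    field_simp
  rw [setLIntegral_congr_fun measurableSet_Ioi h1, lintegral_lintegral_swap (by fun_prop)]
  have h4 : ∀ u ∈ Ioi (0 : ℝ),
      ∫⁻ t in Ioi (0 : ℝ), ENNReal.ofReal (δ * t ^ (-p) * Real.exp (-u) * Real.exp (-(δ * u * t))) =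
      ENNReal.ofReal (δ ^ p * Real.Gamma (1 - p)) *
        ENNReal.ofReal (u ^ (p - 1) * Real.exp (-(1 * u))) := by
    intro u hu
    have hu' : 0 < u := hu
    have h5 := lintegral_Ioi_rpow_mul_exp (a := 1 - p) (s := δ * u) (by linarith) (by positivity)
    have hG := Real.Gamma_pos_of_pos (show 0 < 1 - p by linarith)
    have h6 : ∀ t, ENNReal.ofReal (δ * t ^ (-p) * Real.exp (-u) * Real.exp (-(δ * u * t))) =
        ENNReal.ofReal (δ * Real.exp (-u)) *
          ENNReal.ofReal (t ^ (1 - p - 1) * Real.exp (-(δ * u * t))) := by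
      intro t
      rw [← ENNReal.ofReal_mul (by positivity), show 1 - p - 1 = -p by ring]
      congr 1
      ring
    simp_rw [h6]
    rw [lintegral_const_mul _ (by fun_prop), h5, ← ENNReal.ofReal_mul (by positivity),
      ← ENNReal.ofReal_mul (by positivity)]
    congr 1
    rw [one_mul, one_div, Real.inv_rpow (by positivity), ← Real.rpow_neg (by positivity), neg_sub,
      Real.mul_rpow hδ.le hu'.le, Real.rpow_sub_one hδ.ne']
    field_simp
  rw [setLIntegral_congr_fun measurableSet_Ioi h4, lintegral_const_mul _ (by fun_prop),
    lintegral_Ioi_rpow_mul_exp hp one_pos, ← ENNReal.ofReal_mul]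
  · congr 1
    simp
    ring
  · have hG := Real.Gamma_pos_of_pos (show 0 < 1 - p by linarith)
    positivity

lemma H_nonneg {δ α : ℝ} (hδ : 0 ≤ δ) (hα : 2 < α) : 0 ≤ H δ α := by
  have hp1 : 2 / α < 1 := by rw [div_lt_one (by linarith)]; exact hα
  have := beta_pos (α := 2 / α) (β := 1 - 2 / α) (by positivity) (by linarith)
  unfold H
  positivity

/-- Laplace exponent of the interference from the whole plane. -/
lemma lintegral_loss {δ α c : ℝ} (hδ : 0 ≤ δ) (hα : 2 < α) (hc : 0 < c) :
    ∫⁻ x : Plane, loss δ ((c / ‖x‖) ^ α) = ENNReal.ofReal (Real.pi * c ^ 2 * H δ α) := by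
  have hα0 : 0 < α := by linarith
  have hp1 : 2 / α < 1 := by rw [div_lt_one hα0]; exact hα
  rw [lintegral_fun_norm (f := fun r => loss δ ((c / r) ^ α)) (by fun_prop)]
  have h1 := lintegral_image_rpow hα0 hc measurableSet_Ioi le_rfl (loss δ)
  rw [image_rpow_Ioi hα0 hc] at h1
  rw [h1]
  have h2 : ∀ t, ENNReal.ofReal (2 * Real.pi * c ^ 2 / α * t ^ (-(2 / α) - 1)) * loss δ t =
      ENNReal.ofReal (2 * Real.pi * c ^ 2 / α) *
        (ENNReal.ofReal (t ^ (-(2 / α) - 1)) * loss δ t) := fun t => by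
    rw [ENNReal.ofReal_mul (by positivity), mul_assoc]
  simp_rw [h2]
  -- The arguments of the beta function sum to 1, so its denominator is `Gamma 1 = 1`.
  rw [lintegral_const_mul _ (by fun_prop), lintegral_rpow_mul_loss hδ (by positivity) hp1,
    ← ENNReal.ofReal_mul (by positivity), H, beta]
  congr 1
  simp
  ring

/-- With `c = b + 1` the power of `1 - t` disappears from Euler's integral, and `beta b 1 = 1 / b`.
-/
lemma gaussF_eq {b x : ℝ} (hb : 0 < b) :
    gaussF 1 b (b + 1) (-x) = b * ∫ t in (0 : ℝ)..1, t ^ (b - 1) * (1 + x * t)⁻¹ := by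
  rw [gaussF, add_sub_cancel_left, beta, Real.Gamma_add_one hb.ne', Real.Gamma_one, mul_one]
  have hG := Real.Gamma_pos_of_pos hb
  congr 1
  · field_simp
  · congr 1
    ext t
    rw [sub_self, Real.rpow_zero, mul_one, Real.rpow_neg_one, neg_mul, sub_neg_eq_add]

lemma G_eq {δ α : ℝ} (hα : 2 < α) :
    G δ α = 2 * δ / α * ∫ t in (0 : ℝ)..1, t ^ (-(2 / α)) * (1 + δ * t)⁻¹ := by
  have hα0 : 0 < α := by linarith
  have hp1 : 2 / α < 1 := by rw [div_lt_one hα0]; exact hα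
  have hα2 : α - 2 ≠ 0 := by linarith
  rw [G, show 2 - 2 / α = (1 - 2 / α) + 1 by ring, gaussF_eq (by linarith),
    show 1 - 2 / α - 1 = -(2 / α) by ring, ← mul_assoc]
  congr 1
  field_simp

lemma G_nonneg {δ α : ℝ} (hδ : 0 ≤ δ) (hα : 2 < α) : 0 ≤ G δ α := by
  rw [G_eq hα]
  refine mul_nonneg (by positivity) (intervalIntegral.integral_nonneg zero_le_one fun t ht => ?_)
  have := ht.1
  positivity

/-- Laplace exponent of the interference from outside a disc. -/
lemma setLIntegral_loss {δ α c : ℝ} (hδ : 0 ≤ δ) (hα : 2 < α) (hc : 0 < c) :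
    ∫⁻ x : Plane, (if c ≤ ‖x‖ then loss δ ((c / ‖x‖) ^ α) else 0) =
      ENNReal.ofReal (Real.pi * c ^ 2 * G δ α) := by
  have hα0 : 0 < α := by linarith
  have hp1 : 2 / α < 1 := by rw [div_lt_one hα0]; exact hα
  rw [lintegral_fun_norm (f := fun r => if c ≤ r then loss δ ((c / r) ^ α) else 0)
    (Measurable.ite measurableSet_Ici (by fun_prop) measurable_const)]
  have h0 : ∀ r, ENNReal.ofReal (2 * Real.pi * r) *
      (if c ≤ r then loss δ ((c / r) ^ α) else 0) =
      (Ici c).indicator (fun r => ENNReal.ofReal (2 * Real.pi * r) * loss δ ((c / r) ^ α)) r := by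
    intro r
    by_cases h : c ≤ r <;> simp [h]
  simp_rw [h0]
  rw [setLIntegral_indicator measurableSet_Ici,
    inter_eq_left.2 (Ici_subset_Ioi.2 hc)]
  have h1 := lintegral_image_rpow hα0 hc measurableSet_Ioc (s := Ioc 0 1) Ioc_subset_Ioi_self (loss
      δ)
  rw [image_rpow_Ioc hα0 hc] at h1
  rw [h1, G_eq hα, intervalIntegral.integral_of_le zero_le_one,
    show Real.pi * c ^ 2 * (2 * δ / α * ∫ t in Ioc (0 : ℝ) 1, t ^ (-(2 / α)) * (1 + δ * t)⁻¹) =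
      ∫ t in Ioc (0 : ℝ) 1, 2 * Real.pi * c ^ 2 * δ / α * (t ^ (-(2 / α)) * (1 + δ * t)⁻¹) by
      rw [integral_const_mul]; ring, ofReal_integral_eq_lintegral_ofReal]
  · refine setLIntegral_congr_fun measurableSet_Ioc fun t ht => ?_
    have ht' : 0 < t := ht.1
    rw [loss, ← ENNReal.ofReal_mul (by positivity), sub_eq_add_neg, Real.rpow_add ht',
      Real.rpow_neg_one]
    congr 1
    field_simp
  · refine Integrable.const_mul ?_ _
    have h2 : IntegrableOn (fun t : ℝ => t ^ (-(2 / α))) (Ioc 0 1) := by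
      rw [← intervalIntegrable_iff_integrableOn_Ioc_of_le zero_le_one]
      exact intervalIntegral.intervalIntegrable_rpow' (by linarith)
    -- The factor `1 / (1 + δ t)` is at most 1, and `2 / α < 1` makes the power integrable at 0.
    refine Integrable.mono h2 (by fun_prop) ?_
    filter_upwards [ae_restrict_mem measurableSet_Ioc] with t ht
    have ht' : 0 < t := ht.1
    rw [norm_mul]
    refine mul_le_of_le_one_right (norm_nonneg _) ?_
    rw [Real.norm_of_nonneg (by positivity)]
    exact inv_le_one_of_one_le₀ (by nlinarith)
  · filter_upwards [ae_restrict_mem measurableSet_Ioc] with t ht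
    have ht' : 0 < t := ht.1
    positivity

/-! ## Interference kernels -/

/-- The factor that a macro base station at `x` contributes to the success probability of a user
that excludes macro base stations closer than `c`. -/
def macroKernel (α δ c : ℝ) (x : Plane) : ℝ≥0∞ :=
  if c ≤ ‖x‖ then (1 + ENNReal.ofReal (δ * (c / ‖x‖) ^ α))⁻¹ else 0

/-- The factor that a helper at `y` contributes to the success probability of a user that is served
by a helper at distance `z`. -/
def helperKernel (α δ : ℝ) (q r : ℝ≥0∞) (z : ℝ) (y : Plane) : ℝ≥0∞ :=
  (if z ≤ ‖y‖ then 1 else 1 - q) * ((1 + ENNReal.ofReal (δ * (z / ‖y‖) ^ α))⁻¹ * r + (1 - r))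

lemma inv_one_add_ofReal {x : ℝ} (hx : 0 ≤ x) :
    (1 + ENNReal.ofReal x)⁻¹ = ENNReal.ofReal (1 / (1 + x)) := by
  rw [one_div, ENNReal.ofReal_inv_of_pos (by positivity), ENNReal.ofReal_add zero_le_one hx,
    ENNReal.ofReal_one]

lemma measurable_macroKernel (α δ : ℝ) :
    Measurable (Function.uncurry (macroKernel α δ)) := by
  refine Measurable.ite (measurableSet_le measurable_fst measurable_snd.norm) ?_ measurable_const
  fun_prop

lemma measurable_helperKernel (α δ : ℝ) (q r : ℝ≥0∞) :
    Measurable (Function.uncurry (helperKernel α δ q r)) := by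
  refine Measurable.mul (Measurable.ite (measurableSet_le measurable_fst measurable_snd.norm)
    measurable_const measurable_const) ?_
  fun_prop

lemma macroKernel_le_one (α δ c : ℝ) (x : Plane) : macroKernel α δ c x ≤ 1 := by
  unfold macroKernel
  split_ifs
  · exact ENNReal.inv_le_one.2 le_self_add
  · exact zero_le

lemma activeMean_le_one {v r : ℝ≥0∞} (hr : r ≤ 1) : (1 + v)⁻¹ * r + (1 - r) ≤ 1 := by
  calc (1 + v)⁻¹ * r + (1 - r) ≤ 1 * r + (1 - r) := by
        gcongr; exact ENNReal.inv_le_one.2 le_self_add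
    _ = 1 := by rw [one_mul, add_tsub_cancel_of_le hr]

section HelperKernel

variable {α δ : ℝ} {q r : ℝ≥0∞}

lemma helperKernel_le_one (hr : r ≤ 1) (z : ℝ) (y : Plane) : helperKernel α δ q r z y ≤ 1 := by
  refine mul_le_one' ?_ (activeMean_le_one hr)
  split_ifs
  · exact le_rfl
  · exact tsub_le_self

/-- A larger serving distance enlarges the disc without caching helpers and raises the relative
power of every interferer, so both factors decrease. -/
lemma helperKernel_antitoneOn (hα : 0 < α) (hδ : 0 ≤ δ) (y : Plane) :
    AntitoneOn (fun z => helperKernel α δ q r z y) (Ici 0) := by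
  intro z hz z' hz' h
  have hz0 : 0 ≤ z := hz
  dsimp only [helperKernel]
  refine mul_le_mul' ?_ ?_
  · split_ifs with h1 h2 h2
    · exact le_rfl
    · exact absurd (h.trans h1) h2
    · exact tsub_le_self
    · exact le_rfl
  · gcongr

/-- Beyond the serving distance only the activity average is left, and its two terms cannot both
vanish. -/
lemma helperKernel_ne_zero {z : ℝ} {y : Plane} (hz : z < ‖y‖) : helperKernel α δ q r z y ≠ 0 := by
  unfold helperKernel
  rw [if_pos hz.le, one_mul]
  intro h
  rw [add_eq_zero] at h
  rcases mul_eq_zero.1 h.1 with h1 | h1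
  · simp at h1
  · simp [h1] at h

/-- Left continuity in the serving distance: at the jump `z = ‖y‖` the non-strict inequality in the
kernel selects the left limit. -/
lemma helperKernel_iInf (hα : 0 < α) (hδ : 0 ≤ δ) (hr : r ≤ 1) (y : Plane) (z : ℝ)
    (u : ℕ → ℝ) (hu : Monotone u) (hu0 : ∀ m, 0 ≤ u m ∧ u m < z) (hlim : Tendsto u atTop (𝓝 z)) :
    ⨅ m, helperKernel α δ q r (u m) y = helperKernel α δ q r z y := by
  have hanti : Antitone fun m => helperKernel α δ q r (u m) y := fun m n h =>
    helperKernel_antitoneOn hα hδ y (hu0 m).1 (hu0 n).1 (hu h)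
  refine tendsto_nhds_unique (tendsto_atTop_iInf hanti) ?_
  have hrtop : r ≠ ∞ := (hr.trans_lt ENNReal.one_lt_top).ne
  refine ENNReal.Tendsto.mul ?_ (Or.inr ?_) ?_ (Or.inr ?_)
  · refine tendsto_const_nhds.congr' ?_
    rcases le_or_gt z ‖y‖ with h | h
    · filter_upwards with m
      rw [if_pos h, if_pos ((hu0 m).2.le.trans h)]
    · filter_upwards [hlim.eventually (lt_mem_nhds h)] with m hm
      rw [if_neg h.not_ge, if_neg hm.not_ge]
  · exact ((activeMean_le_one hr).trans_lt ENNReal.one_lt_top).ne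
  · refine Tendsto.add (ENNReal.Tendsto.mul_const ?_ (Or.inr hrtop)) tendsto_const_nhds
    refine tendsto_inv_iff.2 (tendsto_const_nhds.add (ENNReal.tendsto_ofReal ?_))
    exact ((hlim.div_const _).rpow_const (Or.inr hα.le)).const_mul δ
  · split_ifs
    · exact ENNReal.one_ne_top
    · exact (tsub_le_self.trans_lt ENNReal.one_lt_top).ne

end HelperKernel

lemma lintegral_lt_norm {c : ℝ} (hc : 0 ≤ c) :
    ∫⁻ x : Plane, (if c ≤ ‖x‖ then 0 else 1) = ENNReal.ofReal (Real.pi * c ^ 2) := by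
  have h : ∀ x : Plane, (if c ≤ ‖x‖ then 0 else 1 : ℝ≥0∞) =
      (Metric.ball (0 : Plane) c).indicator 1 x := by
    intro x
    by_cases hx : c ≤ ‖x‖
    · simp [hx]
    · simp [hx, not_le.1 hx]
  simp_rw [h]
  rw [lintegral_indicator_one measurableSet_ball, EuclideanSpace.volume_ball_fin_two,
    ← ENNReal.ofReal_pow hc, ← ENNReal.ofReal_mul (by positivity), mul_comm]

lemma measurable_le_norm_ite {c : ℝ} {f g : Plane → ℝ≥0∞} (hf : Measurable f) (hg : Measurable g) :
    Measurable fun x : Plane => if c ≤ ‖x‖ then f x else g x :=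
  Measurable.ite (measurableSet_le measurable_const measurable_norm) hf hg

/-- Interference from outside the disc of radius `c` gives `G`; the void disc itself gives the
summand 1. -/
lemma lintegral_one_sub_macroKernel {α δ c : ℝ} (hα : 2 < α) (hδ : 0 ≤ δ) (hc : 0 < c) :
    ∫⁻ x, (1 - macroKernel α δ c x) = ENNReal.ofReal (Real.pi * c ^ 2 * (G δ α + 1)) := by
  have h : ∀ x, 1 - macroKernel α δ c x = (if c ≤ ‖x‖ then loss δ ((c / ‖x‖) ^ α) else 0) +
      (if c ≤ ‖x‖ then 0 else 1) := by
    intro x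
    unfold macroKernel loss
    have ht : 0 ≤ δ * (c / ‖x‖) ^ α := by positivity
    split_ifs
    · rw [inv_one_add_ofReal ht, ← ENNReal.ofReal_one, ← ENNReal.ofReal_sub _ (by positivity),
        add_zero]
      congr 1
      field_simp
      ring
    · simp
  have hm : Measurable fun x : Plane => if c ≤ ‖x‖ then loss δ ((c / ‖x‖) ^ α) else 0 :=
    measurable_le_norm_ite (by fun_prop) measurable_const
  have hG := G_nonneg hδ hα
  simp_rw [h]
  rw [lintegral_add_left hm, setLIntegral_loss hδ hα hc, lintegral_lt_norm hc.le,
    ← ENNReal.ofReal_add (by positivity) (by positivity)]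
  congr 1
  ring

/-- Outside the disc the integrand is `r * loss`, inside it is `q + (1 - q) * r * loss`. Splitting
`r` as `r q + r (1 - q)` outside, the caching part sees only the exterior and gives `G`, the
non-caching part sees the whole plane and gives `H`, and `q` multiplies the area of the disc. -/
lemma lintegral_one_sub_helperKernel {α δ z q r : ℝ} (hα : 2 < α) (hδ : 0 ≤ δ) (hz : 0 < z)
    (hq : 0 ≤ q) (hq1 : q ≤ 1) (hr : 0 ≤ r) (hr1 : r ≤ 1) :
    ∫⁻ y, (1 - helperKernel α δ (ENNReal.ofReal q) (ENNReal.ofReal r) z y) =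
      ENNReal.ofReal (Real.pi * z ^ 2 * (r * q * G δ α + r * (1 - q) * H δ α + q)) := by
  have h1q : 0 ≤ 1 - q := by linarith
  have h1r : 0 ≤ 1 - r := by linarith
  have h : ∀ y, 1 - helperKernel α δ (ENNReal.ofReal q) (ENNReal.ofReal r) z y =
      ENNReal.ofReal (r * q) * (if z ≤ ‖y‖ then loss δ ((z / ‖y‖) ^ α) else 0) +
      ENNReal.ofReal (r * (1 - q)) * loss δ ((z / ‖y‖) ^ α) +
      ENNReal.ofReal q * (if z ≤ ‖y‖ then 0 else 1) := by
    intro y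
    unfold helperKernel loss
    have ht : 0 ≤ δ * (z / ‖y‖) ^ α := by positivity
    set t := δ * (z / ‖y‖) ^ α
    have h1t : (0 : ℝ) < 1 + t := by positivity
    have hact : (1 + ENNReal.ofReal t)⁻¹ * ENNReal.ofReal r + (1 - ENNReal.ofReal r) =
        ENNReal.ofReal (1 / (1 + t) * r + (1 - r)) := by
      rw [inv_one_add_ofReal ht, ← ENNReal.ofReal_one, ← ENNReal.ofReal_sub _ hr,
        ← ENNReal.ofReal_mul (by positivity), ENNReal.ofReal_add (by positivity) h1r]
    rw [hact]
    split_ifs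
    · rw [one_mul, ← ENNReal.ofReal_one, ← ENNReal.ofReal_sub _ (by positivity), mul_zero, add_zero,
        ← ENNReal.ofReal_mul (by positivity), ← ENNReal.ofReal_mul (by positivity),
        ← ENNReal.ofReal_add (by positivity) (by positivity)]
      congr 1
      field_simp
      ring
    · rw [mul_zero, zero_add, mul_one, ← ENNReal.ofReal_one, ← ENNReal.ofReal_sub _ hq,
        ← ENNReal.ofReal_mul (by positivity), ← ENNReal.ofReal_sub _ (by positivity),
        ← ENNReal.ofReal_mul (by positivity), ← ENNReal.ofReal_add (by positivity) (by positivity)]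
      congr 1
      field_simp
      ring
  have hm : Measurable fun x : Plane => if z ≤ ‖x‖ then loss δ ((z / ‖x‖) ^ α) else 0 :=
    measurable_le_norm_ite (by fun_prop) measurable_const
  have hm1 : Measurable fun y : Plane => ENNReal.ofReal (r * q) *
      (if z ≤ ‖y‖ then loss δ ((z / ‖y‖) ^ α) else 0) := hm.const_mul _
  have hm2 : Measurable fun y : Plane => ENNReal.ofReal (r * (1 - q)) * loss δ ((z / ‖y‖) ^ α) := by
    fun_prop
  have hm3 : Measurable fun y : Plane => (if z ≤ ‖y‖ then 0 else 1 : ℝ≥0∞) :=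
    measurable_le_norm_ite measurable_const measurable_const
  have hm12 : Measurable fun y : Plane => ENNReal.ofReal (r * q) *
      (if z ≤ ‖y‖ then loss δ ((z / ‖y‖) ^ α) else 0) +
      ENNReal.ofReal (r * (1 - q)) * loss δ ((z / ‖y‖) ^ α) := hm1.add hm2
  have hG := G_nonneg hδ hα
  have hH := H_nonneg hδ hα
  simp_rw [h]
  rw [lintegral_add_left hm12, lintegral_add_left hm1, lintegral_const_mul _ hm,
    lintegral_const_mul _ (by fun_prop), lintegral_const_mul _ hm3, setLIntegral_loss hδ hα hz,
    lintegral_loss hδ hα hz, lintegral_lt_norm hz.le, ← ENNReal.ofReal_mul (by positivity),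
    ← ENNReal.ofReal_mul (by positivity), ← ENNReal.ofReal_mul (by positivity),
    ← ENNReal.ofReal_add (by positivity) (by positivity),
    ← ENNReal.ofReal_add (by positivity) (by positivity)]
  congr 1
  ring

/-! ### Exclusion radii and the density of success in the serving distance. -/

namespace Params

variable (p : Params)

lemma card_groupLp : p.groupLp.card = p.N - p.NMp := by simp [groupLp]

lemma pLp_pos : 0 < p.pLp := by
  have h1 := p.N2_pos
  have h2 := p.NMp_lt
  rw [pLp, card_groupLp]
  have : 0 < p.N - p.NMp := by omega
  positivity

lemma pLp_le_one : p.pLp ≤ 1 := by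
  have h2 := p.NMp_lt
  have : 0 < p.N - p.NMp := by omega
  rw [pLp, card_groupLp, div_le_one (by positivity)]
  exact_mod_cast p.N2_le

lemma α_pos : 0 < p.α := by linarith [p.two_lt_α]

/-- Ratio of the exclusion radii of the two tiers. -/
def ratio : ℝ := (p.P1 / p.P2) ^ p.α⁻¹

lemma ratio_pos : 0 < p.ratio := Real.rpow_pos_of_pos (div_pos p.P1_pos p.P2_pos) _

lemma ratio_rpow : p.ratio ^ p.α = p.P1 / p.P2 := by
  rw [ratio, ← Real.rpow_mul (div_pos p.P1_pos p.P2_pos).le, inv_mul_cancel₀ p.α_pos.ne',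
    Real.rpow_one]

lemma ratio_sq : p.ratio ^ 2 = p.P1 ^ (2 / p.α) / p.P2 ^ (2 / p.α) := by
  rw [ratio, ← Real.rpow_natCast, ← Real.rpow_mul (div_pos p.P1_pos p.P2_pos).le,
    ← Real.div_rpow p.P1_pos.le p.P2_pos.le]
  congr 1
  push_cast
  ring

/-- The density, in the distance `z` of the serving helper, of the probability of being served by
a helper and exceeding the threshold `δ`, when helpers are active with probability `r`. -/
def successDensity (r δ z : ℝ) : ℝ :=
  2 * Real.pi * p.pLp * p.lam2 * z *
    Real.exp (-(z ^ p.α * p.P2⁻¹ * δ * p.noise)) *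
    Real.exp (-(Real.pi * p.pLp * p.lam2 * z ^ 2 *
      (p.xi r .helper * CacheHetNet.G δ p.α + p.varsigma r .helper * CacheHetNet.H δ p.α +
        p.zeta .helper)))

/-- Probability that a user served by a helper at distance `z` is not prevented by noise, nor by a
macro base station, from exceeding the threshold `δ`. -/
def macroWeight (δ : ℝ) (z : ℝ) : ℝ≥0∞ :=
  (Ioi 0).indicator (fun z => negExp (ENNReal.ofReal (δ * z ^ p.α / p.P2 * p.noise)) *
    negExp (ENNReal.ofReal p.lam1 * ∫⁻ x, (1 - macroKernel p.α δ (p.ratio * z) x))) z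

lemma measurable_macroWeight (δ : ℝ) : Measurable (p.macroWeight δ) := by
  refine Measurable.indicator (Measurable.mul (by fun_prop) (measurable_negExp.comp
    (Measurable.const_mul ?_ _))) measurableSet_Ioi
  refine Measurable.lintegral_prod_right' (f := fun x : ℝ × Plane =>
    1 - macroKernel p.α δ (p.ratio * x.1) x.2) ?_
  exact measurable_const.sub ((measurable_macroKernel p.α δ).comp
    ((measurable_fst.const_mul _).prodMk measurable_snd))

lemma macroWeight_le_one (δ z : ℝ) : p.macroWeight δ z ≤ 1 := by
  refine Set.indicator_apply_le' (fun _ => ?_) (fun _ => zero_le)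
  exact mul_le_one' (negExp_le_one _) (negExp_le_one _)

/-- The macro and helper exponents add. Since `ratio ^ 2` is `P1 ^ (2 / α) / P2 ^ (2 / α)`,
factoring out `pLp * lam2` leaves exactly the coefficients `ξ`, `ς` and `ζ`. -/
lemma successDensity_eq {r δ z : ℝ} (hδ : 0 ≤ δ) (hr : 0 ≤ r) (hr1 : r ≤ 1) (hz : 0 < z) :
    ENNReal.ofReal (2 * Real.pi * z) * (p.macroWeight δ z *
        negExp (ENNReal.ofReal p.lam2 * ∫⁻ y, (1 - helperKernel p.α δ (ENNReal.ofReal p.pLp)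
          (ENNReal.ofReal r) z y))) * ENNReal.ofReal (p.pLp * p.lam2) =
      ENNReal.ofReal (p.successDensity r δ z) := by
  have hα := p.two_lt_α
  have hα0 := p.α_pos
  have hq := p.pLp_pos
  have hq1 : 0 ≤ 1 - p.pLp := by linarith [p.pLp_le_one]
  have hl1 := p.lam1_pos
  have hl2 := p.lam2_pos
  have hP1 := p.P1_pos
  have hP2 := p.P2_pos
  have hκ := p.ratio_pos
  have hn := p.noise_nonneg
  have hG := G_nonneg hδ hα
  have hH := H_nonneg hδ hα
  have hP1' : 0 < p.P1 ^ (2 / p.α) := Real.rpow_pos_of_pos hP1 _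
  have hP2' : 0 < p.P2 ^ (2 / p.α) := Real.rpow_pos_of_pos hP2 _
  rw [macroWeight, Set.indicator_of_mem (mem_Ioi.2 hz),
    lintegral_one_sub_macroKernel hα hδ (by positivity),
    lintegral_one_sub_helperKernel hα hδ hz hq.le p.pLp_le_one hr hr1,
    ← ENNReal.ofReal_mul hl1.le, ← ENNReal.ofReal_mul hl2.le,
    negExp_ofReal (by positivity), negExp_ofReal (by positivity), negExp_ofReal (by positivity),
    ← ENNReal.ofReal_mul (by positivity), ← ENNReal.ofReal_mul (by positivity),
    ← ENNReal.ofReal_mul (by positivity), ← ENNReal.ofReal_mul (by positivity), successDensity]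
  congr 1
  have he : Real.exp (-(p.lam1 * (Real.pi * (p.ratio * z) ^ 2 * (CacheHetNet.G δ p.α + 1)))) *
      Real.exp (-(p.lam2 * (Real.pi * z ^ 2 * (r * p.pLp * CacheHetNet.G δ p.α +
        r * (1 - p.pLp) * CacheHetNet.H δ p.α + p.pLp)))) =
      Real.exp (-(Real.pi * p.pLp * p.lam2 * z ^ 2 *
      (p.xi r .helper * CacheHetNet.G δ p.α + p.varsigma r .helper * CacheHetNet.H δ p.α +
        p.zeta .helper))) := by
    rw [← Real.exp_add, mul_pow, ratio_sq, xi, varsigma, zeta, weight, effDensity, power]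
    congr 1
    field_simp
    ring
  rw [← he, show δ * z ^ p.α / p.P2 * p.noise = z ^ p.α * p.P2⁻¹ * δ * p.noise by
    rw [div_eq_mul_inv]; ring]
  ring

end Params

/-! ## Independence of positions, marks and load -/

section Sequences

variable {Ω α β : Type*} [MeasurableSpace α] [MeasurableSpace β] {m : MeasurableSpace Ω}

lemma measurable_seq {f : ℕ → Ω → α} (hf : ∀ k, Measurable (f k)) :
    Measurable fun ω k => f k ω :=
  measurable_pi_lambda _ hf

lemma measurable_pair {f : Ω → α} {g : Ω → β} (hf : Measurable f) (hg : Measurable g) :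
    Measurable fun ω => (f ω, g ω) :=
  hf.prodMk hg

end Sequences

namespace Network

variable {Ω : Type*} (S : Network Ω)

/-- Sigma-algebra generated by a set of sources of randomness. -/
@[reducible] def sigmaOf (A : Set Source) : MeasurableSpace Ω := ⨆ s ∈ A, S.sigma s

/-- Whether helper `k` caches the content `n`. -/
def caches (n k : ℕ) (ω : Ω) : Bool := decide (n ∈ S.cache k ω)

/-- The positions of all base stations. -/
def positions (ω : Ω) : (ℕ → Plane) × (ℕ → Plane) :=
  (fun k => S.mbsPos k ω, fun k => S.helperPos k ω)

/-- The marks of all base stations. -/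
def marks (n : ℕ) (ω : Ω) : (ℕ → Bool) × (ℕ → Bool) × (ℕ → ℝ) × (ℕ → ℝ) :=
  (fun k => S.caches n k ω, fun k => S.active k ω, fun k => S.mbsFading k ω,
    fun k => S.helperFading k ω)

section Sources

variable {S} {A : Set Source}

lemma sigma_le_sigmaOf {s : Source} (hs : s ∈ A) : S.sigma s ≤ S.sigmaOf A :=
  le_biSup S.sigma hs

lemma measurable_mbsPos (h : .mbsPos ∈ A) (k : ℕ) : Measurable[S.sigmaOf A] (S.mbsPos k) :=
  measurable_iff_comap_le.2 ((le_iSup (fun j => MeasurableSpace.comap (S.mbsPos j) inferInstance)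
    k).trans (sigma_le_sigmaOf h))

lemma measurable_helperPos (h : .helperPos ∈ A) (k : ℕ) :
    Measurable[S.sigmaOf A] (S.helperPos k) :=
  measurable_iff_comap_le.2 ((le_iSup (fun j => MeasurableSpace.comap (S.helperPos j)
    inferInstance) k).trans (sigma_le_sigmaOf h))

lemma measurable_mbsFading {k : ℕ} (h : .mbsFading k ∈ A) :
    Measurable[S.sigmaOf A] (S.mbsFading k) :=
  measurable_iff_comap_le.2 (sigma_le_sigmaOf h)

lemma measurable_helperFading {k : ℕ} (h : .helperFading k ∈ A) :
    Measurable[S.sigmaOf A] (S.helperFading k) :=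
  measurable_iff_comap_le.2 (sigma_le_sigmaOf h)

lemma measurable_active {k : ℕ} (h : .active k ∈ A) : Measurable[S.sigmaOf A] (S.active k) :=
  measurable_iff_comap_le.2 (sigma_le_sigmaOf h)

lemma measurable_load (h : .load ∈ A) : Measurable[S.sigmaOf A] S.load :=
  measurable_iff_comap_le.2 (sigma_le_sigmaOf h)

lemma measurable_caches {k : ℕ} (h : .cache k ∈ A) (n : ℕ) :
    Measurable[S.sigmaOf A] (S.caches n k) := by
  refine measurable_iff_comap_le.2 (le_trans ?_ (sigma_le_sigmaOf h))
  rintro _ ⟨B, -, rfl⟩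
  exact ⟨(fun C => decide (n ∈ C)) ⁻¹' B, trivial, rfl⟩

lemma measurable_positions_of_mem (h1 : .mbsPos ∈ A) (h2 : .helperPos ∈ A) :
    Measurable[S.sigmaOf A] S.positions :=
  measurable_pair (measurable_seq fun k => measurable_mbsPos h1 k)
    (measurable_seq fun k => measurable_helperPos h2 k)

lemma measurable_marks_of_mem (hc : ∀ k, .cache k ∈ A) (ha : ∀ k, .active k ∈ A)
    (hh : ∀ k, .mbsFading k ∈ A) (hg : ∀ k, .helperFading k ∈ A) (n : ℕ) :
    Measurable[S.sigmaOf A] (S.marks n) :=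
  measurable_pair (measurable_seq fun k => measurable_caches (hc k) n)
    (measurable_pair (measurable_seq fun k => measurable_active (ha k))
    (measurable_pair (measurable_seq fun k => measurable_mbsFading (hh k))
    (measurable_seq fun k => measurable_helperFading (hg k))))

end Sources

namespace IsModel

variable {S} {p : Params} [m0 : MeasurableSpace Ω] {μ : Measure Ω} (hS : S.IsModel p μ)
include hS

lemma sigmaOf_le (A : Set Source) : S.sigmaOf A ≤ m0 := iSup₂_le fun s _ => hS.sigma_le s

/-- Disjoint groups of independent sources generate independent sigma-algebras, so each independence
claim below reduces to naming two disjoint sets of sources. -/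
lemma indepFun {A B : Set Source} (hAB : Disjoint A B) {α β : Type*} [MeasurableSpace α]
    [MeasurableSpace β] {X : Ω → α} {Y : Ω → β} (hX : Measurable[S.sigmaOf A] X)
    (hY : Measurable[S.sigmaOf B] Y) : IndepFun X Y μ :=
  (IndepFun_iff_Indep _ _ _).2 (indep_of_indep_of_le_left (indep_of_indep_of_le_right
    (indep_iSup_of_disjoint hS.sigma_le hS.indep hAB) hY.comap_le) hX.comap_le)

lemma iIndepFun_of_comap_le {ι α : Type*} [MeasurableSpace α] {X : ι → Ω → α} {s : ι → Source}
    (hs : Function.Injective s) (hX : ∀ i, MeasurableSpace.comap (X i) inferInstance ≤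
      S.sigma (s i)) : iIndepFun X μ := by
  have h : iIndep (fun i => S.sigma (s i)) μ := hS.indep.precomp hs
  rw [iIndepFun_iff_iIndep]
  exact iIndep_of_iIndep_of_le h hX

lemma iIndepFun_caches (n : ℕ) : iIndepFun (S.caches n) μ :=
  hS.iIndepFun_of_comap_le (s := .cache) (fun _ _ h => by injection h) fun k => by
    rintro _ ⟨B, -, rfl⟩
    exact ⟨(fun C => decide (n ∈ C)) ⁻¹' B, trivial, rfl⟩

lemma iIndepFun_active : iIndepFun S.active μ :=
  hS.iIndepFun_of_comap_le (s := .active) (fun _ _ h => by injection h) fun _ => le_rfl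

lemma iIndepFun_mbsFading : iIndepFun S.mbsFading μ :=
  hS.iIndepFun_of_comap_le (s := .mbsFading) (fun _ _ h => by injection h) fun _ => le_rfl

lemma iIndepFun_helperFading : iIndepFun S.helperFading μ :=
  hS.iIndepFun_of_comap_le (s := .helperFading) (fun _ _ h => by injection h) fun _ => le_rfl

/-- The grouped independence fields each split the sources into a set and its complement. The
activity probability is still expressed through the association probability of the model, not yet
through its closed form. -/
lemma isMarking {n : ℕ} (hn : n ∈ p.groupLp) :
    IsMarking μ (ENNReal.ofReal p.pLp) (ENNReal.ofReal (p.activeProb (S.helperTierProb p μ)))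
      S.mbsFading S.helperFading (S.caches n) S.active where
  measurable_h k := (measurable_mbsFading (mem_univ _)).mono (hS.sigmaOf_le univ) le_rfl
  measurable_g k := (measurable_helperFading (mem_univ _)).mono (hS.sigmaOf_le univ) le_rfl
  measurable_c k := (measurable_caches (mem_univ _) n).mono (hS.sigmaOf_le univ) le_rfl
  measurable_a k := (measurable_active (mem_univ _)).mono (hS.sigmaOf_le univ) le_rfl
  indep_g j := by
    refine hS.indepFun (A := {.helperFading j}ᶜ) (B := {.helperFading j}) disjoint_compl_left ?_
      (measurable_helperFading rfl)
    refine measurable_pair (measurable_seq fun k => measurable_caches (by simp) n)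
      (measurable_pair (measurable_seq fun k => measurable_active (by simp))
      (measurable_pair (measurable_seq fun k => measurable_mbsFading (by simp))
      (measurable_seq fun k => ?_)))
    split_ifs with h
    · exact measurable_const
    · exact measurable_helperFading (by simpa using h)
  indep_cah_g := hS.indepFun (A := (range .helperFading)ᶜ) (B := range .helperFading)
    disjoint_compl_left
    (measurable_pair (measurable_seq fun k => measurable_caches (by simp) n)
      (measurable_pair (measurable_seq fun k => measurable_active (by simp))
      (measurable_seq fun k => measurable_mbsFading (by simp))))
    (measurable_seq fun k => measurable_helperFading (by simp))
  indep_c_ah := hS.indepFun (A := range .cache) (B := (range .cache)ᶜ) disjoint_compl_right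
    (measurable_seq fun k => measurable_caches (by simp) n)
    (measurable_pair (measurable_seq fun k => measurable_active (by simp))
      (measurable_seq fun k => measurable_mbsFading (by simp)))
  indep_a_h := hS.indepFun (A := range .active) (B := (range .active)ᶜ) disjoint_compl_right
    (measurable_seq fun k => measurable_active (by simp))
    (measurable_seq fun k => measurable_mbsFading (by simp))
  iIndep_h := hS.iIndepFun_mbsFading
  iIndep_g := hS.iIndepFun_helperFading
  iIndep_c := hS.iIndepFun_caches n
  iIndep_a := hS.iIndepFun_active
  law_h := hS.mbsFading_law
  law_g := hS.helperFading_law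
  law_c k := by simpa [caches] using hS.cache_prob k n hn
  law_a := hS.active_prob

lemma measurable_positions : Measurable S.positions :=
  (measurable_positions_of_mem (mem_univ _) (mem_univ _)).mono (hS.sigmaOf_le univ) le_rfl

lemma measurable_marks (n : ℕ) : Measurable (S.marks n) :=
  (measurable_marks_of_mem (fun _ => mem_univ _) (fun _ => mem_univ _) (fun _ => mem_univ _)
    (fun _ => mem_univ _) n).mono (hS.sigmaOf_le univ) le_rfl

lemma measurable_load : Measurable S.load :=
  (Network.measurable_load (mem_univ _)).mono (hS.sigmaOf_le univ) le_rfl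

lemma indepFun_positions_marks (n : ℕ) : IndepFun S.positions (S.marks n) μ :=
  hS.indepFun (A := {.mbsPos, .helperPos}) (B := {.mbsPos, .helperPos}ᶜ) disjoint_compl_right
    (measurable_positions_of_mem (by simp) (by simp))
    (measurable_marks_of_mem (by simp) (by simp) (by simp) (by simp) n)

lemma indepFun_helperPos_mbsPos :
    IndepFun (fun ω k => S.helperPos k ω) (fun ω k => S.mbsPos k ω) μ :=
  by
  have h1 := (measurable_seq fun k => measurable_helperPos (S := S) (mem_singleton
      Source.helperPos) k)
  have h2 := (measurable_seq fun k => measurable_mbsPos (S := S) (mem_singleton Source.mbsPos) k)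
  have h3 : Disjoint ({.helperPos} : Set Source) {.mbsPos} := disjoint_singleton.2 (by simp)
  exact hS.indepFun h3 h1 h2

lemma indepFun_positions_marks_load (n : ℕ) :
    IndepFun (fun ω => (S.positions ω, S.marks n ω)) S.load μ :=
  hS.indepFun (A := {.load}ᶜ) (B := {.load}) disjoint_compl_left
    (measurable_pair (measurable_positions_of_mem (by simp) (by simp))
      (measurable_marks_of_mem (by simp) (by simp) (by simp) (by simp) n))
    (Network.measurable_load rfl)

end IsModel
end Network
/-! ## Probability of being served by a given helper above a threshold -/

namespace Params

variable (p : Params)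

/-- Noise and interference, normalised by the mean power received from helper `j` and multiplied by
the threshold `δ`. -/
def normalizedLoad (δ : ℝ) (j : ℕ) (x y : ℕ → Plane) (a : ℕ → Bool) (h g : ℕ → ℝ) : ℝ≥0∞ :=
  IsMarking.markLoad (ENNReal.ofReal (δ * ‖y j‖ ^ p.α / p.P2 * p.noise))
    (fun i => ENNReal.ofReal (δ * (p.ratio * ‖y j‖ / ‖x i‖) ^ p.α))
    (fun k => ENNReal.ofReal (δ * (‖y j‖ / ‖y k‖) ^ p.α)) j a h g

/-- The configurations of positions and marks in which helper `j` serves the user and the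
threshold `δ` is exceeded. -/
def successEvent (δ : ℝ) (j : ℕ) :
    Set (((ℕ → Plane) × (ℕ → Plane)) × (ℕ → Bool) × (ℕ → Bool) × (ℕ → ℝ) × (ℕ → ℝ)) :=
  {x | (∀ i, p.ratio * ‖x.1.2 j‖ ≤ ‖x.1.1 i‖) ∧
    (x.2.1 j = true ∧ ∀ k, x.2.1 k = true → ‖x.1.2 j‖ ≤ ‖x.1.2 k‖) ∧
    p.normalizedLoad δ j x.1.1 x.1.2 x.2.2.1 x.2.2.2.1 x.2.2.2.2 ≤ ENNReal.ofReal (x.2.2.2.2 j)}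

lemma measurableSet_successEvent (δ : ℝ) (j : ℕ) : MeasurableSet (p.successEvent δ j) := by
  have h : p.successEvent δ j = (⋂ i, {x | p.ratio * ‖x.1.2 j‖ ≤ ‖x.1.1 i‖}) ∩
      ({x | x.2.1 j = true} ∩ ⋂ k, ({x | x.2.1 k = true}ᶜ ∪ {x | ‖x.1.2 j‖ ≤ ‖x.1.2 k‖})) ∩
      {x | p.normalizedLoad δ j x.1.1 x.1.2 x.2.2.1 x.2.2.2.1 x.2.2.2.2 ≤
        ENNReal.ofReal (x.2.2.2.2 j)} := by
    ext x
    simp [successEvent, and_assoc, imp_iff_not_or]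
  rw [h]
  refine MeasurableSet.inter (MeasurableSet.inter ?_ (MeasurableSet.inter ?_ ?_)) ?_
  · exact MeasurableSet.iInter fun i => measurableSet_le (by fun_prop) (by fun_prop)
  · exact measurableSet_eq_fun (by fun_prop) measurable_const
  · exact MeasurableSet.iInter fun k => (measurableSet_eq_fun (by fun_prop)
      measurable_const).compl.union (measurableSet_le (by fun_prop) (by fun_prop))
  · refine measurableSet_le ?_ (by fun_prop)
    have h1 : Measurable fun x : ((ℕ → Plane) × (ℕ → Plane)) × (ℕ → Bool) × (ℕ → Bool) ×
        (ℕ → ℝ) × (ℕ → ℝ) => ∑' i, ENNReal.ofReal (x.2.2.2.1 i) *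
          ENNReal.ofReal (δ * (p.ratio * ‖x.1.2 j‖ / ‖x.1.1 i‖) ^ p.α) :=
      Measurable.tsum fun i => by fun_prop
    have h2 : Measurable fun x : ((ℕ → Plane) × (ℕ → Plane)) × (ℕ → Bool) × (ℕ → Bool) ×
        (ℕ → ℝ) × (ℕ → ℝ) => ∑' k, if k ≠ j ∧ x.2.2.1 k = true then
          ENNReal.ofReal (x.2.2.2.2 k) * ENNReal.ofReal (δ * (‖x.1.2 j‖ / ‖x.1.2 k‖) ^ p.α)
          else 0 := by
      refine Measurable.tsum fun k => Measurable.ite ?_ (by fun_prop) measurable_const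
      by_cases hk : k = j
      · simp [hk]
      · simp only [ne_eq, hk, not_false_eq_true, true_and]
        exact measurableSet_eq_fun (by fun_prop) measurable_const
    have h0 : Measurable fun x : ((ℕ → Plane) × (ℕ → Plane)) × (ℕ → Bool) × (ℕ → Bool) ×
        (ℕ → ℝ) × (ℕ → ℝ) => ENNReal.ofReal (δ * ‖x.1.2 j‖ ^ p.α / p.P2 * p.noise) := by
      fun_prop
    exact (h0.add h1).add h2

end Params

/-- The factor of the success probability at given positions `y` of the helpers and `x` of the
macro base stations. -/
def Params.positionFactor (p : Params) (δ : ℝ) (q r : ℝ≥0∞) (j : ℕ) (y x : ℕ → Plane) : ℝ≥0∞ :=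
  negExp (ENNReal.ofReal (δ * ‖y j‖ ^ p.α / p.P2 * p.noise)) *
    iprod (fun k => if k = j then 1 else helperKernel p.α δ q r ‖y j‖ (y k)) *
    iprod (fun i => macroKernel p.α δ (p.ratio * ‖y j‖) (x i))

lemma Params.measurable_positionFactor (p : Params) (δ : ℝ) (q r : ℝ≥0∞) (j : ℕ) :
    Measurable (Function.uncurry (p.positionFactor δ q r j)) := by
  refine Measurable.mul (Measurable.mul (measurable_negExp.comp (by fun_prop))
    (measurable_iprod fun k => ?_)) (measurable_iprod fun i => ?_)
  · split_ifs
    · exact measurable_const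
    · exact (measurable_helperKernel p.α δ q r).comp (f := fun z : (ℕ → Plane) × (ℕ → Plane) =>
        (‖z.1 j‖, z.1 k)) (by fun_prop)
  · exact (measurable_macroKernel p.α δ).comp (f := fun z : (ℕ → Plane) × (ℕ → Plane) =>
        (p.ratio * ‖z.1 j‖, z.2 i)) (by fun_prop)

/-- One macro station inside the exclusion disc has kernel 0 and annihilates the product, which
encodes the association constraint. -/
lemma iprod_macroKernel (α δ c : ℝ) (x : ℕ → Plane) [Decidable (∀ i, c ≤ ‖x i‖)] :
    iprod (fun i => macroKernel α δ c (x i)) = if ∀ i, c ≤ ‖x i‖ then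
      iprod (fun i => (1 + ENNReal.ofReal (δ * (c / ‖x i‖) ^ α))⁻¹) else 0 := by
  split_ifs with h
  · simp only [macroKernel, h, if_true]
  · push Not at h
    obtain ⟨i, hi⟩ := h
    rw [iprod_eq_mul_iprod_ne (fun k => macroKernel_le_one _ _ _ _) i, macroKernel,
      if_neg hi.not_ge, zero_mul]

namespace Network.IsModel

variable {Ω : Type*} {S : Network Ω} {p : Params} [m0 : MeasurableSpace Ω] {μ : Measure Ω}
  [IsProbabilityMeasure μ] (hS : S.IsModel p μ)
include hS

/-- Conditioning on the positions leaves only marks. If a macro station violates the exclusion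
radius both sides vanish; otherwise `IsMarking.measure_success` applies with the powers relative to
helper `j`. -/
lemma measure_successEvent_eq_lintegral {n : ℕ} (hn : n ∈ p.groupLp) (δ : ℝ) (j : ℕ) :
    μ {ω | (S.positions ω, S.marks n ω) ∈ p.successEvent δ j} =
      ∫⁻ ω, ENNReal.ofReal p.pLp * p.positionFactor δ (ENNReal.ofReal p.pLp)
        (ENNReal.ofReal (p.activeProb (S.helperTierProb p μ))) j (fun k => S.helperPos k ω)
        (fun i => S.mbsPos i ω) ∂μ := by
  classical
  have hm := hS.measurable_positions.prodMk (hS.measurable_marks n)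
  have hE := p.measurableSet_successEvent δ j
  have h1 : μ {ω | (S.positions ω, S.marks n ω) ∈ p.successEvent δ j} =
      ∫⁻ ω, (p.successEvent δ j).indicator 1 (S.positions ω, S.marks n ω) ∂μ := by
    exact (lintegral_indicator_one (hm hE)).symm
  rw [h1, lintegral_decouple hS.measurable_positions (hS.measurable_marks n)
    (hS.indepFun_positions_marks n) (G := fun a b => (p.successEvent δ j).indicator 1 (a, b))
    (measurable_one.indicator hE)]
  refine lintegral_congr fun ω => ?_
  have h2 : ∫⁻ ω', (p.successEvent δ j).indicator 1
      (S.positions ω, S.marks n ω') ∂μ =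
      μ {ω' | (S.positions ω, S.marks n ω') ∈ p.successEvent δ j} := by
    exact lintegral_indicator_one ((measurable_const.prodMk (hS.measurable_marks n)) hE)
  rw [h2, Params.positionFactor, iprod_macroKernel]
  split_ifs with hgeo
  · have h3 := IsMarking.measure_success (hS.isMarking hn) j
      (Q := fun k => ‖S.helperPos j ω‖ ≤ ‖S.helperPos k ω‖) le_rfl
      (ENNReal.ofReal (δ * ‖S.helperPos j ω‖ ^ p.α / p.P2 * p.noise))
      (u := fun i => ENNReal.ofReal (δ * (p.ratio * ‖S.helperPos j ω‖ / ‖S.mbsPos i ω‖) ^ p.α))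
      (fun _ => ENNReal.ofReal_ne_top)
      (v := fun k => ENNReal.ofReal (δ * (‖S.helperPos j ω‖ / ‖S.helperPos k ω‖) ^ p.α))
      (fun _ => ENNReal.ofReal_ne_top)
    have h4 : {ω' | (S.positions ω, S.marks n ω') ∈ p.successEvent δ j} = _ :=
      Set.ext fun ω' => (by
        exact ⟨fun H => ⟨H.2.1, H.2.2⟩, fun H => ⟨hgeo, H.1, H.2⟩⟩ :
        _ ↔ ω' ∈ {ω' | (S.caches n j ω' = true ∧ (∀ k, S.caches n k ω' = true →
          ‖S.helperPos j ω‖ ≤ ‖S.helperPos k ω‖)) ∧ IsMarking.markLoad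
          (ENNReal.ofReal (δ * ‖S.helperPos j ω‖ ^ p.α / p.P2 * p.noise))
          (fun i => ENNReal.ofReal (δ * (p.ratio * ‖S.helperPos j ω‖ / ‖S.mbsPos i ω‖) ^ p.α))
          (fun k => ENNReal.ofReal (δ * (‖S.helperPos j ω‖ / ‖S.helperPos k ω‖) ^ p.α)) j
          (fun k => S.active k ω') (fun k => S.mbsFading k ω') (fun k => S.helperFading k ω') ≤
          ENNReal.ofReal (S.helperFading j ω')})
    rw [h4, h3]
    simp only [helperKernel]
    ring
  · have h3 : {ω' | (S.positions ω, S.marks n ω') ∈ p.successEvent δ j} = ∅ :=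
      Set.eq_empty_of_forall_notMem fun ω' H => hgeo H.1
    rw [h3, measure_empty, mul_zero, mul_zero]


lemma ae_helperPos_ne_zero : ∀ᵐ ω ∂μ, ∀ j, S.helperPos j ω ≠ 0 := hS.helper_poisson.ae_ne_zero

lemma ae_mbsPos_ne_zero : ∀ᵐ ω ∂μ, ∀ j, S.mbsPos j ω ≠ 0 := hS.mbs_poisson.ae_ne_zero

/-- With the helper positions fixed, the macro positions are averaged out by the generating
functional. -/
lemma measure_successEvent {n : ℕ} (hn : n ∈ p.groupLp) (δ : ℝ) (j : ℕ) :
    μ {ω | (S.positions ω, S.marks n ω) ∈ p.successEvent δ j} =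
      ENNReal.ofReal p.pLp * ∫⁻ ω, p.macroWeight δ ‖S.helperPos j ω‖ *
        iprod (fun k => if k = j then 1 else helperKernel p.α δ (ENNReal.ofReal p.pLp)
          (ENNReal.ofReal (p.activeProb (S.helperTierProb p μ))) ‖S.helperPos j ω‖
          (S.helperPos k ω)) ∂μ := by
  set r := ENNReal.ofReal (p.activeProb (S.helperTierProb p μ))
  set q := ENNReal.ofReal p.pLp
  have hx : Measurable fun ω k => S.mbsPos k ω := measurable_seq hS.mbs_poisson.measurable
  have hy : Measurable fun ω k => S.helperPos k ω := measurable_seq hS.helper_poisson.measurable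
  have hk := p.measurable_positionFactor δ q r j
  rw [hS.measure_successEvent_eq_lintegral hn]
  rw [lintegral_const_mul' _ _ ENNReal.ofReal_ne_top,
    lintegral_decouple hy hx hS.indepFun_helperPos_mbsPos (G := p.positionFactor δ q r j) hk]
  congr 1
  refine lintegral_congr_ae ?_
  filter_upwards [hS.ae_helperPos_ne_zero] with ω hω
  simp only [Params.positionFactor]
  have hm : ∀ c, Measurable fun ω' => iprod fun i => macroKernel p.α δ c (S.mbsPos i ω') :=
    fun c => measurable_iprod fun i => (measurable_macroKernel p.α δ).comp
      (measurable_const.prodMk (hS.mbs_poisson.measurable i))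
  rw [lintegral_const_mul _ (hm _), hS.mbs_poisson.lintegral_iprod_eq
    (f := macroKernel p.α δ (p.ratio * ‖S.helperPos j ω‖)) p.lam1_pos.le
    ((measurable_macroKernel p.α δ).comp (measurable_const.prodMk measurable_id))
    (macroKernel_le_one _ _ _), Params.macroWeight,
    Set.indicator_of_mem (mem_Ioi.2 (norm_pos_iff.2 (hω j)))]
  ring

lemma tsum_measure_successEvent {n : ℕ} (hn : n ∈ p.groupLp) {δ : ℝ} (hδ : 0 ≤ δ)
    (hr : 0 ≤ p.activeProb (S.helperTierProb p μ)) (hr1 : p.activeProb (S.helperTierProb p μ) ≤ 1) :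
    ∑' j, μ {ω | (S.positions ω, S.marks n ω) ∈ p.successEvent δ j} =
      ∫⁻ z in Ioi (0 : ℝ),
        ENNReal.ofReal (p.successDensity (p.activeProb (S.helperTierProb p μ)) δ z) := by
  set r := p.activeProb (S.helperTierProb p μ)
  have hw : Measurable fun z => p.macroWeight δ z * negExp (ENNReal.ofReal p.lam2 *
      ∫⁻ y, (1 - helperKernel p.α δ (ENNReal.ofReal p.pLp) (ENNReal.ofReal r) z y)) := by
    refine (p.measurable_macroWeight δ).mul (measurable_negExp.comp (Measurable.const_mul ?_ _))
    exact Measurable.lintegral_prod_right' (measurable_const.sub (measurable_helperKernel _ _ _ _))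
  have hr1' : ENNReal.ofReal r ≤ 1 := by simpa using hr1
  have hym := hS.helper_poisson.measurable
  simp_rw [fun j => hS.measure_successEvent hn δ j]
  -- Mecke formula for the helpers with weight `macroWeight`, whose indicator of `Ioi 0` makes it
  -- vanish at 0 as required; polar coordinates follow.
  rw [ENNReal.tsum_mul_left, ← lintegral_tsum, hS.helper_poisson.lintegral_tsum_iprod_norm
    p.lam2_pos.le (measurable_helperKernel _ _ _ _) (fun _ _ => helperKernel_le_one hr1' _ _)
    (helperKernel_antitoneOn p.α_pos hδ)
    (fun y z _ u hu hu0 hl => helperKernel_iInf p.α_pos hδ hr1' y z u hu hu0 hl)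
    (fun z y _ h => helperKernel_ne_zero h) (p.measurable_macroWeight δ)
    (p.macroWeight_le_one δ) (by simp [Params.macroWeight]),
    lintegral_fun_norm hw,
    ← mul_assoc, ← ENNReal.ofReal_mul p.pLp_pos.le, ← lintegral_const_mul']
  · refine setLIntegral_congr_fun measurableSet_Ioi fun z hz => ?_
    rw [← p.successDensity_eq hδ hr hr1 hz, mul_comm]
  · exact ENNReal.ofReal_ne_top
  · intro j
    refine ((p.measurable_macroWeight δ).comp (hym j).norm).mul
      (measurable_iprod fun k => ?_) |>.aemeasurable
    split_ifs
    · exact measurable_const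
    · exact (measurable_helperKernel _ _ _ _).comp ((hym j).norm.prodMk (hym k))

end Network.IsModel

/-! ## Association and access success -/

namespace Params

variable (p : Params)

lemma popularity_nonneg (n : ℕ) : 0 ≤ p.popularity n := by
  unfold popularity
  positivity

lemma activeProb_mem_Icc {A : ℝ} (hA : 0 ≤ A) : p.activeProb A ∈ Icc 0 1 := by
  have hu := p.lamU_pos
  have hl := p.lam2_pos
  have h : (1 : ℝ) ≤ 1 + A * p.lamU / (3.5 * p.lam2) := by
    have : 0 ≤ A * p.lamU / (3.5 * p.lam2) := by positivity
    linarith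
  have h1 := Real.rpow_le_one_of_one_le_of_nonpos h (show (-3.5 : ℝ) ≤ 0 by norm_num)
  have h2 : 0 ≤ (1 + A * p.lamU / (3.5 * p.lam2)) ^ (-3.5 : ℝ) := by positivity
  constructor <;> unfold activeProb <;> linarith

lemma loadProb_nonneg {A : ℝ} (hA : 0 ≤ A) (l : ℕ) : 0 ≤ p.loadProb A l := by
  have hu := p.lamU_pos
  have hl := p.lam2_pos
  have h1 : 0 < Real.Gamma (l + 4.5) := Real.Gamma_pos_of_pos (by positivity)
  have h2 : 0 < Real.Gamma 3.5 := Real.Gamma_pos_of_pos (by norm_num)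
  unfold loadProb
  positivity

lemma threshold_pos (l : ℕ) : 0 < p.threshold l := by
  have h1 := p.R0_pos
  have h2 := p.W_pos
  rw [threshold, sub_pos]
  exact Real.one_lt_rpow one_lt_two (by positivity)

lemma measurable_successDensity (r δ : ℝ) : Measurable (p.successDensity r δ) := by
  unfold successDensity
  fun_prop

lemma weight_pos (k : Tier) : 0 < p.weight k := by
  have h1 := p.lam1_pos
  have h2 := p.lam2_pos
  have h3 := p.P1_pos
  have h4 := p.P2_pos
  have h5 := p.pLp_pos
  cases k <;> simp only [weight, effDensity, power] <;> positivity

lemma zeta_helper : p.zeta .helper = (p.assocLp .helper)⁻¹ := by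
  rw [assocLp, inv_div]
  rfl

lemma assocLp_pos (k : Tier) : 0 < p.assocLp k :=
  div_pos (p.weight_pos k) (add_pos (p.weight_pos _) (p.weight_pos _))

/-- Here `G` and `H` vanish, so the activity probability `r` drops out. With `ζ = A⁻¹` the density
is `A * 2 b z exp (-b z ^ 2)`, which has an elementary antiderivative. -/
lemma lintegral_successDensity_zero (r : ℝ) :
    ∫⁻ z in Ioi (0 : ℝ), ENNReal.ofReal (p.successDensity r 0 z) =
      ENNReal.ofReal (p.assocLp .helper) := by
  have h2 := p.lam2_pos
  have h5 := p.pLp_pos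
  have hα := p.α_pos
  set A := p.assocLp .helper with hA
  have hA0 : 0 < A := p.assocLp_pos _
  set b := Real.pi * p.pLp * p.lam2 * A⁻¹ with hb
  have hb0 : 0 < b := by positivity
  have hH : H 0 p.α = 0 := by
    rw [H, Real.zero_rpow (by positivity)]
    ring
  have hG : G 0 p.α = 0 := by simp [G]
  have hden : p.successDensity r 0 = fun z => A * (2 * b * z * Real.exp (-(b * z ^ 2))) := by
    ext z
    have e : Real.pi * p.pLp * p.lam2 * z ^ 2 * A⁻¹ = b * z ^ 2 := by rw [hb]; ring
    simp only [successDensity, hG, hH, zeta_helper, ← hA, mul_zero, zero_add, zero_mul, neg_zero,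
      Real.exp_zero, mul_one, e]
    rw [hb]
    field_simp
  have hderiv : ∀ z ∈ Ioi (0 : ℝ), HasDerivAt (fun z => -(A * Real.exp (-(b * z ^ 2))))
      (p.successDensity r 0 z) z := by
    intro z _
    have h := (((((hasDerivAt_pow 2 z).const_mul b).neg).exp).const_mul A).neg
    rw [hden]
    refine h.congr_deriv ?_
    simp only [Pi.neg_apply]
    push_cast
    ring
  have hcont : ContinuousWithinAt (fun z => -(A * Real.exp (-(b * z ^ 2)))) (Ici 0) 0 := by
    fun_prop
  have hpos : ∀ z ∈ Ioi (0 : ℝ), 0 ≤ p.successDensity r 0 z := by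
    intro z hz
    have hz0 : (0 : ℝ) < z := hz
    rw [hden]
    positivity
  have hlim : Tendsto (fun z => -(A * Real.exp (-(b * z ^ 2)))) atTop (𝓝 0) := by
    have h := (Real.tendsto_exp_neg_atTop_nhds_zero.comp
      ((tendsto_pow_atTop two_ne_zero).const_mul_atTop hb0)).const_mul A |>.neg
    simpa using h
  rw [← ofReal_integral_eq_lintegral_ofReal (integrableOn_Ioi_deriv_of_nonneg hcont hderiv hpos
      hlim)
    ((ae_restrict_iff' measurableSet_Ioi).2 (Eventually.of_forall hpos)),
    integral_Ioi_of_hasDerivAt_of_nonneg hcont hderiv hpos hlim]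
  simp

end Params

namespace Network

variable {Ω : Type*} {S : Network Ω} {p : Params}

lemma mean_le_mean_iff {P Q a b : ℝ} (hP : 0 < P) (hQ : 0 < Q) (ha : 0 < a) (hb : 0 < b)
    {α : ℝ} (hα : 0 < α) :
    P * a ^ (-α) ≤ Q * b ^ (-α) ↔ (P / Q) ^ α⁻¹ * b ≤ a := by
  have h1 : 0 < a ^ α := Real.rpow_pos_of_pos ha _
  have h2 : 0 < b ^ α := Real.rpow_pos_of_pos hb _
  have h3 : 0 < (P / Q) ^ α⁻¹ := Real.rpow_pos_of_pos (div_pos hP hQ) _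
  rw [← Real.rpow_le_rpow_iff (by positivity) ha.le hα, Real.mul_rpow h3.le hb.le,
    ← Real.rpow_mul (div_pos hP hQ).le, inv_mul_cancel₀ hα.ne', Real.rpow_one,
    Real.rpow_neg ha.le, Real.rpow_neg hb.le, ← div_eq_mul_inv, ← div_eq_mul_inv,
    div_le_div_iff₀ h1 h2, div_mul_eq_mul_div, div_le_iff₀ hQ, mul_comm Q]

/-- Powers are compared through distances. Positions must be nonzero because a station at the origin
would have mean power 0, from `0 ^ (-α) = 0`. -/
lemma servedBy_iff {n j : ℕ} {ω : Ω} (hx : ∀ i, S.mbsPos i ω ≠ 0) (hy : ∀ i, S.helperPos i ω ≠ 0) :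
    S.ServedBy p n j ω ↔ (∀ i, p.ratio * ‖S.helperPos j ω‖ ≤ ‖S.mbsPos i ω‖) ∧
      (S.caches n j ω = true ∧
        ∀ k, S.caches n k ω = true → ‖S.helperPos j ω‖ ≤ ‖S.helperPos k ω‖) := by
  have h1 : ∀ i, S.mbsMean p i ω ≤ S.helperMean p j ω ↔
      p.ratio * ‖S.helperPos j ω‖ ≤ ‖S.mbsPos i ω‖ := fun i =>
    mean_le_mean_iff p.P1_pos p.P2_pos (norm_pos_iff.2 (hx i)) (norm_pos_iff.2 (hy j)) p.α_pos
  have h2 : ∀ k, S.helperMean p k ω ≤ S.helperMean p j ω ↔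
      ‖S.helperPos j ω‖ ≤ ‖S.helperPos k ω‖ := fun k => by
    have := mean_le_mean_iff p.P2_pos p.P2_pos (norm_pos_iff.2 (hy k)) (norm_pos_iff.2 (hy j))
      p.α_pos
    rwa [div_self p.P2_pos.ne', Real.one_rpow, one_mul] at this
  simp only [ServedBy, h1, h2, caches, decide_eq_true_eq]
  tauto

/-- Scaling by `δ ‖y j‖ ^ α / P2` turns each mean power into `δ` times a power of a distance ratio.
The caching and non-caching sums merge into one over helpers other than `j`, because by `hc` helper
`j` is absent from the non-caching sum. -/
lemma normalizedLoad_eq {n j : ℕ} {ω : Ω} {δ : ℝ} (hδ : 0 ≤ δ) (hc : n ∈ S.cache j ω) :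
    p.normalizedLoad δ j (fun k => S.mbsPos k ω) (fun k => S.helperPos k ω)
      (fun k => S.active k ω) (fun k => S.mbsFading k ω) (fun k => S.helperFading k ω) =
      ENNReal.ofReal (δ * ‖S.helperPos j ω‖ ^ p.α / p.P2) *
        (S.mbsInterference p ω + S.cachingInterference p n j ω + S.nonCachingInterference p n ω +
          ENNReal.ofReal p.noise) := by
  have hP1 := p.P1_pos
  have hP2 := p.P2_pos
  have hκ := p.ratio_pos
  have hc1 : 0 ≤ δ * ‖S.helperPos j ω‖ ^ p.α / p.P2 := by positivity
  have hterm : ∀ (c a x : ℝ), 0 ≤ c → c ^ p.α = a / p.P2 → ∀ g : ℝ,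
      ENNReal.ofReal g * ENNReal.ofReal (δ * (c * ‖S.helperPos j ω‖ / ‖x‖) ^ p.α) =
      ENNReal.ofReal (δ * ‖S.helperPos j ω‖ ^ p.α / p.P2) *
        ENNReal.ofReal (g * (a * ‖x‖ ^ (-p.α))) := by
    intro c a x hc hca g
    rw [← ENNReal.ofReal_mul' (by positivity), ← ENNReal.ofReal_mul hc1]
    congr 1
    rw [Real.div_rpow (by positivity) (norm_nonneg _), Real.mul_rpow hc (norm_nonneg _), hca,
      Real.rpow_neg (norm_nonneg _)]
    field_simp
  have hsum : S.cachingInterference p n j ω + S.nonCachingInterference p n ω =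
      ∑' k, if k ≠ j ∧ S.active k ω = true then
        ENNReal.ofReal (S.helperFading k ω * S.helperMean p k ω) else 0 := by
    rw [cachingInterference, nonCachingInterference, ← ENNReal.tsum_add]
    congr 1
    ext k
    by_cases hkj : k = j
    · subst hkj
      simp [hc]
    · by_cases hk : n ∈ S.cache k ω <;> simp [hkj, hk]
  rw [Params.normalizedLoad, IsMarking.markLoad, add_assoc (S.mbsInterference p ω), hsum, mul_add,
    mul_add, mbsInterference, ← ENNReal.tsum_mul_left, ← ENNReal.tsum_mul_left,
    ← ENNReal.ofReal_mul hc1, add_assoc, add_comm]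
  congr 1
  congr 1
  · congr 1
    ext i
    simpa [mbsMean] using hterm p.ratio p.P1 ‖S.mbsPos i ω‖ hκ.le p.ratio_rpow (S.mbsFading i ω)
  · congr 1
    ext k
    rw [mul_ite, mul_zero]
    congr 1
    simpa [helperMean] using hterm 1 p.P2 ‖S.helperPos k ω‖ zero_le_one (by simp [hP2.ne'])
        (S.helperFading k ω)

lemma sinr_nonneg (n j : ℕ) (ω : Ω) : 0 ≤ S.sinr p n j ω := ENNReal.toReal_nonneg

/-- Macro station 0 makes the denominator positive, so the extended quotient is finite and `toReal`
loses nothing. If the interference is infinite, the SINR is 0 and both sides fail. -/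
lemma le_sinr_iff {n j : ℕ} {ω : Ω} (hx : S.mbsPos 0 ω ≠ 0) (hy : S.helperPos j ω ≠ 0)
    (hh : 0 < S.mbsFading 0 ω) (hg : 0 < S.helperFading j ω) {δ : ℝ} (hδ : 0 < δ)
    (hc : n ∈ S.cache j ω) :
    δ ≤ S.sinr p n j ω ↔
      p.normalizedLoad δ j (fun k => S.mbsPos k ω) (fun k => S.helperPos k ω)
      (fun k => S.active k ω) (fun k => S.mbsFading k ω) (fun k => S.helperFading k ω) ≤
        ENNReal.ofReal (S.helperFading j ω) := by
  have hP1 := p.P1_pos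
  have hP2 := p.P2_pos
  have hxn : 0 < ‖S.mbsPos 0 ω‖ := norm_pos_iff.2 hx
  have hyn : 0 < ‖S.helperPos j ω‖ := norm_pos_iff.2 hy
  have hya : 0 < ‖S.helperPos j ω‖ ^ p.α := Real.rpow_pos_of_pos hyn _
  rw [normalizedLoad_eq hδ.le hc]
  have hI : S.mbsInterference p ω ≠ 0 := by
    rw [mbsInterference, Ne, ENNReal.tsum_eq_zero]
    intro h
    have h0 := h 0
    rw [ENNReal.ofReal_eq_zero] at h0
    have : 0 < S.mbsFading 0 ω * S.mbsMean p 0 ω := by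
      unfold mbsMean
      positivity
    linarith
  have hs : 0 < S.helperFading j ω * S.helperMean p j ω := by
    unfold helperMean
    positivity
  have hD : S.mbsInterference p ω + S.cachingInterference p n j ω +
      S.nonCachingInterference p n ω + ENNReal.ofReal p.noise ≠ 0 := by
    simp [hI]
  set D := S.mbsInterference p ω + S.cachingInterference p n j ω +
      S.nonCachingInterference p n ω + ENNReal.ofReal p.noise with hDdef
  have hfin : ENNReal.ofReal (S.helperFading j ω * S.helperMean p j ω) / D ≠ ∞ :=
    ENNReal.div_ne_top ENNReal.ofReal_ne_top hD
  rw [sinr, ← hDdef, ← ENNReal.ofReal_le_iff_le_toReal hfin,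
    ENNReal.le_div_iff_mul_le (Or.inl hD) (Or.inr ENNReal.ofReal_ne_top)]
  have hκ : 0 < ‖S.helperPos j ω‖ ^ p.α / p.P2 := by positivity
  have hκ' : ENNReal.ofReal (‖S.helperPos j ω‖ ^ p.α / p.P2) ≠ 0 := by simpa using hκ
  rw [← ENNReal.mul_le_mul_iff_right hκ' ENNReal.ofReal_ne_top, ← mul_assoc,
    ← ENNReal.ofReal_mul hκ.le, ← ENNReal.ofReal_mul hκ.le]
  have e1 : ‖S.helperPos j ω‖ ^ p.α / p.P2 * δ = δ * ‖S.helperPos j ω‖ ^ p.α / p.P2 := by ring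
  have e2 : ‖S.helperPos j ω‖ ^ p.α / p.P2 * (S.helperFading j ω * S.helperMean p j ω) =
      S.helperFading j ω := by
    rw [helperMean, Real.rpow_neg hyn.le]
    field_simp
  rw [e1, e2]

lemma le_rate_iff {n j l : ℕ} {ω : Ω} (hl : S.load ω = l + 1) :
    p.R0 ≤ S.rate p n j ω ↔ p.threshold l ≤ S.sinr p n j ω := by
  have hW := p.W_pos
  have hs := S.sinr_nonneg (p := p) n j ω
  rw [rate, hl, Params.threshold, sub_le_iff_le_add', ← Real.le_logb_iff_rpow_le one_lt_two
    (by positivity), div_mul_eq_mul_div, le_div_iff₀ (by positivity), div_le_iff₀ hW]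
  push_cast
  rw [mul_comm p.R0, mul_comm p.W]

lemma rate_of_load_eq_zero {n j : ℕ} {ω : Ω} (hl : S.load ω = 0) : S.rate p n j ω = 0 := by
  simp [rate, hl]

end Network

lemma ae_pos_of_map_eq_expMeasure_one {Ω : Type*} [MeasurableSpace Ω] {μ : Measure Ω} {x : Ω → ℝ}
    (hx : Measurable x) (hlaw : μ.map x = expMeasure 1) :
    ∀ᵐ ω ∂μ, 0 < x ω := by
  have h : ∀ᵐ y ∂(μ.map x), 0 < y := by
    have hP : IsProbabilityMeasure (expMeasure 1) := isProbabilityMeasure_expMeasure one_pos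
    rw [hlaw, ae_iff]
    have h0 : {y : ℝ | ¬0 < y} = Iic 0 := by
      ext y
      simp
    rw [h0, ← ofReal_cdf, cdf_expMeasure_eq one_pos]
    simp
  exact ae_of_ae_map hx.aemeasurable h

namespace Network.IsModel

variable {Ω : Type*} {S : Network Ω} {p : Params} [m0 : MeasurableSpace Ω] {μ : Measure Ω}
  [IsProbabilityMeasure μ] (hS : S.IsModel p μ)
include hS

lemma ae_positions : ∀ᵐ ω ∂μ, (∀ i, S.mbsPos i ω ≠ 0) ∧ (∀ k, S.helperPos k ω ≠ 0) ∧
    ∀ j k, ‖S.helperPos j ω‖ = ‖S.helperPos k ω‖ → j = k := by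
  filter_upwards [hS.ae_mbsPos_ne_zero, hS.ae_helperPos_ne_zero,
    hS.helper_poisson.ae_norm_injective p.lam2_pos.le] with ω h1 h2 h3
  exact ⟨h1, h2, h3⟩

lemma measurableSet_preimage_successEvent (n : ℕ) (δ : ℝ) (j : ℕ) :
    MeasurableSet {ω | (S.positions ω, S.marks n ω) ∈ p.successEvent δ j} :=
  (hS.measurable_positions.prodMk (hS.measurable_marks n)) (p.measurableSet_successEvent δ j)

/-- Two serving helpers would each be at most as far as the other, hence equidistant from the
origin, hence equal. -/
lemma mem_successEvent_unique (n : ℕ) : ∀ᵐ ω ∂μ, ∀ j k, ∀ δ δ' : ℝ,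
    (S.positions ω, S.marks n ω) ∈ p.successEvent δ j →
    (S.positions ω, S.marks n ω) ∈ p.successEvent δ' k → j = k := by
  filter_upwards [hS.ae_positions] with ω hω j k δ δ' hj hk
  exact hω.2.2 j k (le_antisymm (hj.2.1.2 k hk.2.1.1) (hk.2.1.2 j hj.2.1.1))

lemma helperTierProb_nonneg : 0 ≤ S.helperTierProb p μ :=
  Finset.sum_nonneg fun n _ => mul_nonneg (p.popularity_nonneg n) measureReal_nonneg

/-- Association is success at threshold 0, where the normalized load vanishes and the fading
condition is automatic. -/
lemma measure_helperAssoc {n : ℕ} (hn : n ∈ p.groupLp) :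
    μ (S.helperAssoc p n) = ENNReal.ofReal (p.assocLp .helper) := by
  obtain ⟨hr, hr1⟩ := p.activeProb_mem_Icc hS.helperTierProb_nonneg
  have h1 : S.helperAssoc p n =ᵐ[μ]
      ⋃ j, {ω | (S.positions ω, S.marks n ω) ∈ p.successEvent 0 j} := by
    refine eventuallyEq_set.2 ?_
    filter_upwards [hS.ae_positions] with ω hω
    simp only [helperAssoc, Set.mem_ofPred_eq, mem_iUnion]
    refine exists_congr fun j => ?_
    rw [servedBy_iff hω.1 hω.2.1]
    refine ⟨fun h => ⟨h.1, h.2, ?_⟩, fun h => ⟨h.1, h.2.1⟩⟩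
    have h0 : p.normalizedLoad 0 j (fun k => S.mbsPos k ω) (fun k => S.helperPos k ω)
        (fun k => S.active k ω) (fun k => S.mbsFading k ω) (fun k => S.helperFading k ω) = 0 := by
      simp [Params.normalizedLoad, IsMarking.markLoad]
    exact h0.le.trans zero_le
  rw [measure_congr h1, measure_iUnion₀, hS.tsum_measure_successEvent hn le_rfl hr hr1,
    p.lintegral_successDensity_zero]
  · intro j k hjk
    refine measure_eq_zero_iff_ae_notMem.2 ?_
    filter_upwards [hS.mem_successEvent_unique n] with ω hω h
    exact hjk (hω j k 0 0 h.1 h.2)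
  · exact fun j => (hS.measurableSet_preimage_successEvent n 0 j).nullMeasurableSet

/-- The association probability of the model is given by its closed form. -/
lemma helperTierProb_eq : S.helperTierProb p μ = p.A2 := by
  rw [helperTierProb, Params.A2, Params.QLp, Finset.sum_mul]
  refine Finset.sum_congr rfl fun n hn => ?_
  rw [Measure.real, hS.measure_helperAssoc hn, ENNReal.toReal_ofReal (p.assocLp_pos _).le]

lemma accessSuccess_ae_eq (n : ℕ) : S.accessSuccess p n =ᵐ[μ]
    ⋃ x : ℕ × ℕ, {ω | (S.positions ω, S.marks n ω) ∈ p.successEvent (p.threshold x.1) x.2} ∩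
      {ω | S.load ω = x.1 + 1} := by
  have hgpos : ∀ᵐ ω ∂μ, ∀ j, 0 < S.helperFading j ω := ae_all_iff.2 fun j =>
    ae_pos_of_map_eq_expMeasure_one ((measurable_helperFading (mem_univ _)).mono (hS.sigmaOf_le
        univ) le_rfl)
      (hS.helperFading_law j)
  have hhpos : ∀ᵐ ω ∂μ, 0 < S.mbsFading 0 ω :=
    ae_pos_of_map_eq_expMeasure_one ((measurable_mbsFading (mem_univ _)).mono (hS.sigmaOf_le univ)
        le_rfl)
      (hS.mbsFading_law 0)
  refine eventuallyEq_set.2 ?_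
  filter_upwards [hS.ae_positions, hgpos, hhpos] with ω hω hg hh
  have hmem : ∀ l j, (S.positions ω, S.marks n ω) ∈ p.successEvent (p.threshold l) j ↔
      S.ServedBy p n j ω ∧ p.threshold l ≤ S.sinr p n j ω := by
    intro l j
    constructor
    · intro h
      have hs := (servedBy_iff hω.1 hω.2.1).2 ⟨h.1, h.2.1⟩
      exact ⟨hs, (le_sinr_iff (hω.1 0) (hω.2.1 j) hh (hg j) (p.threshold_pos l) hs.1).2 h.2.2⟩
    · rintro ⟨hs, h⟩
      have hs' := (servedBy_iff hω.1 hω.2.1).1 hs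
      exact ⟨hs'.1, hs'.2,
        (le_sinr_iff (hω.1 0) (hω.2.1 j) hh (hg j) (p.threshold_pos l) hs.1).1 h⟩
  simp only [accessSuccess, Set.mem_ofPred_eq, mem_iUnion, mem_inter_iff, hmem, Prod.exists]
  constructor
  · rintro ⟨j, hs, h⟩
    -- At load 0 division by zero makes the rate 0, which is below `R0`, so this case contributes
    -- nothing.
    rcases hl : S.load ω with _ | l
    · rw [rate_of_load_eq_zero hl] at h
      exact absurd h p.R0_pos.not_ge
    · exact ⟨l, j, ⟨hs, (le_rate_iff hl).1 h⟩, rfl⟩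
  · rintro ⟨l, j, ⟨hs, h⟩, hl⟩
    exact ⟨j, hs, (le_rate_iff hl).2 h⟩

/-- Countable additivity over loads and helpers, independence of the load, then Tonelli to bring the
sum over loads inside the integral; `helperTierProb_eq` replaces the association probability by its
closed form. -/
theorem measure_accessSuccess {n : ℕ} (hn : n ∈ p.groupLp) :
    μ (S.accessSuccess p n) = ∫⁻ z in Ioi (0 : ℝ), ∑' l : ℕ,
      ENNReal.ofReal (p.successDensity p.pa (p.threshold l) z * p.loadProb p.A2 l) := by
  obtain ⟨hr, hr1⟩ := p.activeProb_mem_Icc hS.helperTierProb_nonneg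
  have hL := p.loadProb_nonneg hS.helperTierProb_nonneg
  have hlm := hS.measurable_load
  have hA : p.activeProb (S.helperTierProb p μ) = p.pa := by rw [hS.helperTierProb_eq, Params.pa]
  have hprod : ∀ l j, μ ({ω | (S.positions ω, S.marks n ω) ∈ p.successEvent (p.threshold l) j} ∩
      {ω | S.load ω = l + 1}) =
      μ {ω | (S.positions ω, S.marks n ω) ∈ p.successEvent (p.threshold l) j} *
        ENNReal.ofReal (p.loadProb p.A2 l) := by
    intro l j
    have h := (hS.indepFun_positions_marks_load n).measure_inter_preimage_eq_mul
      (p.successEvent (p.threshold l) j) {l + 1} (p.measurableSet_successEvent _ j)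
      (measurableSet_singleton _)
    rw [← hS.helperTierProb_eq, ← hS.load_prob l]
    exact h
  rw [measure_congr (hS.accessSuccess_ae_eq n), measure_iUnion₀,
    tsum_congr fun x : ℕ × ℕ => hprod x.1 x.2, ENNReal.tsum_prod (f := fun l j =>
      μ {ω | (S.positions ω, S.marks n ω) ∈ p.successEvent (p.threshold l) j} *
        ENNReal.ofReal (p.loadProb p.A2 l)), lintegral_tsum]
  · refine tsum_congr fun l => ?_
    rw [ENNReal.tsum_mul_right, hS.tsum_measure_successEvent hn (p.threshold_pos l).le hr hr1, hA,
      ← lintegral_mul_const' _ _ ENNReal.ofReal_ne_top]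
    refine lintegral_congr fun z => ?_
    rw [← hS.helperTierProb_eq, ENNReal.ofReal_mul' (hL l)]
  · exact fun l => (((p.measurable_successDensity _ _).mul_const _).ennreal_ofReal).aemeasurable
  · rintro ⟨l, j⟩ ⟨l', j'⟩ hne
    refine measure_eq_zero_iff_ae_notMem.2 ?_
    -- Events with different loads are disjoint; for equal loads the serving helper is almost surely
    -- unique.
    filter_upwards [hS.mem_successEvent_unique n] with ω hω h
    have hl : l = l' := by
      have h1 : S.load ω = l + 1 := h.1.2
      have h2 : S.load ω = l' + 1 := h.2.2
      omega
    exact hne (Prod.ext hl (hω _ _ _ _ h.1.1 h.2.1))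
  · exact fun x => ((hS.measurableSet_preimage_successEvent n _ _).inter
      (hlm (measurableSet_singleton _))).nullMeasurableSet

end Network.IsModel

end CacheHetNet

end

theorem lemma3 {Ω : Type*} [MeasurableSpace Ω] (μ : Measure Ω) [IsProbabilityMeasure μ]
    (p : CacheHetNet.Params) (S : CacheHetNet.Network Ω) (hS : S.IsModel p μ)
    (n : ℕ) (hn : n ∈ p.groupLp) :
    μ (S.accessSuccess p n) =
      ∫⁻ z in Ioi (0 : ℝ), ∑' l : ℕ, ENNReal.ofReal
        (2 * Real.pi * p.pLp * p.lam2 * z *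
          Real.exp (-(z ^ p.α * p.P2⁻¹ * p.threshold l * p.noise)) *
          Real.exp (-(Real.pi * p.pLp * p.lam2 * z ^ 2 *
            (p.xi p.pa .helper * CacheHetNet.G (p.threshold l) p.α +
              p.varsigma p.pa .helper * CacheHetNet.H (p.threshold l) p.α +
              p.zeta .helper))) *
          p.loadProb p.A2 l) :=
  hS.measure_accessSuccess hn
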